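/- For $n\ge 0$ let $A_n=\mathbb{C}[t]/(t^{n+1})$ and $B_n=\mathbb{C}[x,y]/(x^{n+1},y^2)\simeq A_n\otimes_{\mathbb{C}}A_1$, with the homomorphism $B_n\to A_n$, $x\mapsto t$, $y\mapsto 0$. A deformation over $\operatorname{Spec} B$ of a pair $(X,D)$ over $\operatorname{Spec}A$ ($X$ a scheme, $D\subset X$ a closed subscheme, both flat over $A$), along a ring homomorphism $B\to A$, is a scheme $Y$ with a closed subscheme $E\subset Y$, both flat over $B$, together with an identification of the base change of $(Y,E)$ to $A$ with $(X,D)$; isomorphisms of deformations are isomorphisms of pairs over $B$ that respect these identifications. Let $X$ be a reduced scheme of finite type over $\mathbb{C}$ and let $D\subset X$ be an effective (Cartier) divisor contained in the smooth locus of $X$. Let $(X_n,D_n)$ be a deformation of $(X,D)$ over $A_n$ (along $A_n\to\mathbb{C}$, $t\mapsto 0$). Let $T^1((X_n,D_n)/A_n)$ be the set of isomorphism classes of deformations of $(X_n,D_n)$ over $B_n$ along $B_n\to A_n$. Let $\Omega^1_{X_n/A_n}(\log D_n)$ be the $\mathcal{O}_{X_n}$-module generated by $\Omega^1_{X_n/A_n}$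 and symbols $d\log f$, for local equations $f$ of $D_n$, with the relations $f\,d\log f=df$ and $d\log(uf)=d\log f+u^{-1}du$ for units $u$ (if $D$ is smooth, this is the usual locally free sheaf of logarithmic differentials near $D_n$). Then there is a bijection $$T^1((X_n,D_n)/A_n)\;\simeq\;\operatorname{Ext}^1_{\mathcal{O}_{X_n}}\bigl(\Omega^1_{X_n/A_n}(\log D_n),\mathcal{O}_{X_n}\bigr)$$ which is an isomorphism of $A_n$-modules for the natural operations on $T^1$: with $A_n[\varepsilon]=B_n$ ($\varepsilon=y$), the multiple of a class by $a\in A_n$ is its base change along $\varepsilon\mapsto a\varepsilon$, and $\zeta$ is the sum of $\xi$ and $\eta$ if and only if some deformation of $(X_n,D_n)$ over $A_n[\varepsilon_1,\varepsilon_2]/(\varepsilon_1,\varepsilon_2)^2$ induces $\xi,\eta,\zeta$ under $(\varepsilon_1,\varepsilon_2)\mapsto(\varepsilon,0),(0,\varepsilon),(\varepsilon,\varepsilon)$ respectively. -/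

import Mathlib

open CategoryTheory AlgebraicGeometry Opposite

noncomputable section

namespace LogDef

section LogKaehler

variable (R S : Type) [CommRing R] [CommRing S] [Algebra R S] (G : Set S)

/-- The relations `f • dlog f = d f` for `f ∈ G`, and `dlog (u f) = dlog f + u⁻¹ d u` for
`f, u f ∈ G` with `u` a unit, in the module `Ω[S⁄R] ⊕ S^(G)`; the basis vector of the free
module `S^(G)` at `f` stands for `dlog f`. -/
def logRelations : Submodule S (Ω[S⁄R] × (G →₀ S)) :=
  Submodule.span S
    ({w | ∃ f : G, w = (KaehlerDifferential.D R S f.1, -Finsupp.single f f.1)} ∪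
     {w | ∃ (f g : G) (u : Sˣ), g.1 = u * f.1 ∧
        w = ((↑u⁻¹ : S) • KaehlerDifferential.D R S u,
          Finsupp.single f 1 - Finsupp.single g 1)})

/-- The module of relative differentials of `S` over `R` with logarithmic poles along the
elements of `G`: it is generated by `Ω[S⁄R]` and symbols `dlog f`, `f ∈ G`, subject to the
relations above. -/
abbrev LogKaehler : Type := (Ω[S⁄R] × (G →₀ S)) ⧸ logRelations R S G

namespace LogKaehler

/-- The derivation `d` with values in logarithmic differentials. -/
def d : Derivation R S (LogKaehler R S G) :=
  ((logRelations R S G).mkQ ∘ₗ LinearMap.inl S _ _).compDer (KaehlerDifferential.D R S)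

/-- The logarithmic differential `dlog f` of `f ∈ G`. -/
def dlog (f : G) : LogKaehler R S G :=
  (logRelations R S G).mkQ (0, Finsupp.single f 1)

variable {R S G}

lemma smul_dlog (f : G) : f.1 • dlog R S G f = d R S G f.1 := by
  rw [eq_comm, ← sub_eq_zero]
  change (logRelations R S G).mkQ _ - f.1 • (logRelations R S G).mkQ _ = 0
  rw [← map_smul, ← map_sub, Submodule.mkQ_apply, Submodule.Quotient.mk_eq_zero]
  refine Submodule.subset_span (Or.inl ⟨f, ?_⟩)
  simp

lemma dlog_of_eq_mul (f g : G) (u : Sˣ) (h : g.1 = u * f.1) :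
    dlog R S G g = dlog R S G f + (↑u⁻¹ : S) • d R S G u := by
  rw [eq_comm, ← sub_eq_zero]
  change (logRelations R S G).mkQ _ + (↑u⁻¹ : S) • (logRelations R S G).mkQ _ -
    (logRelations R S G).mkQ _ = 0
  rw [← map_smul, ← map_add, ← map_sub, Submodule.mkQ_apply, Submodule.Quotient.mk_eq_zero]
  refine Submodule.subset_span (Or.inr ⟨f, g, u, h, ?_⟩)
  simp

section lift

variable {M : Type} [AddCommGroup M] [Module R M] [Module S M] [IsScalarTower R S M]

/-- The universal property of the module of logarithmic differentials. -/
def lift (δ : Derivation R S M) (l : G → M) (h₁ : ∀ f : G, f.1 • l f = δ f.1)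
    (h₂ : ∀ (f g : G) (u : Sˣ), g.1 = u * f.1 → l g = l f + (↑u⁻¹ : S) • δ u) :
    LogKaehler R S G →ₗ[S] M :=
  (logRelations R S G).liftQ
    (δ.liftKaehlerDifferential.coprod (Finsupp.linearCombination S l)) (by
      refine Submodule.span_le.mpr ?_
      rintro _ (⟨f, rfl⟩ | ⟨f, g, u, h, rfl⟩)
      · simp [h₁]
      · simp [h₂ f g u h])

variable (δ : Derivation R S M) (l : G → M) (h₁ : ∀ f : G, f.1 • l f = δ f.1)
    (h₂ : ∀ (f g : G) (u : Sˣ), g.1 = u * f.1 → l g = l f + (↑u⁻¹ : S) • δ u)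

@[simp] lemma lift_d (a : S) : lift δ l h₁ h₂ (d R S G a) = δ a := by
  change (δ.liftKaehlerDifferential.coprod (Finsupp.linearCombination S l))
    (KaehlerDifferential.D R S a, 0) = _
  simp

@[simp] lemma lift_dlog (f : G) : lift δ l h₁ h₂ (dlog R S G f) = l f := by
  change (δ.liftKaehlerDifferential.coprod (Finsupp.linearCombination S l))
    (0, Finsupp.single f 1) = _
  simp

variable (R S G) in
lemma span_eq_top :
    Submodule.span S (Set.range (d R S G) ∪ Set.range (dlog R S G)) = ⊤ := by
  rw [eq_top_iff]
  rintro x -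
  obtain ⟨⟨ω, s⟩, rfl⟩ := Submodule.Quotient.mk_surjective _ x
  have e : (Submodule.Quotient.mk (ω, s) : LogKaehler R S G) =
      (logRelations R S G).mkQ (LinearMap.inl S _ _ ω) +
        (logRelations R S G).mkQ (LinearMap.inr S _ _ s) := by
    rw [← map_add]; simp
  rw [e]
  clear e
  refine Submodule.add_mem _ ?_ ?_
  · have : ω ∈ Submodule.span S (Set.range (KaehlerDifferential.D R S)) := by
      rw [KaehlerDifferential.span_range_derivation]; trivial
    induction this using Submodule.span_induction with
    | mem x h => obtain ⟨a, rfl⟩ := h; exact Submodule.subset_span (Or.inl ⟨a, rfl⟩)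
    | zero => simp only [map_zero, Submodule.zero_mem]
    | add x y _ _ hx hy => simpa only [map_add] using Submodule.add_mem _ hx hy
    | smul a x _ hx => simpa only [map_smul] using Submodule.smul_mem _ a hx
  · induction s using Finsupp.induction_linear with
    | zero => simp only [map_zero, Submodule.zero_mem]
    | add f g hf hg => simpa only [map_add] using Submodule.add_mem _ hf hg
    | single f a =>
      have : Finsupp.single f a = a • (Finsupp.single f 1 : G →₀ S) := by simp
      rw [this, map_smul, map_smul]
      exact Submodule.smul_mem _ _ (Submodule.subset_span (Or.inr ⟨f, rfl⟩))

end lift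

section map

variable {S' : Type} [CommRing S'] [Algebra R S'] {G' : Set S'}
  (ρ : S →ₐ[R] S') (hρ : ∀ f ∈ G, ρ f ∈ G')

/-- Functoriality of logarithmic differentials. -/
def map : LogKaehler R S G →ₛₗ[ρ.toRingHom] LogKaehler R S' G' :=
  letI := Module.compHom (LogKaehler R S' G') ρ.toRingHom
  haveI : IsScalarTower R S (LogKaehler R S' G') := ⟨fun r s x ↦ by
    change ρ (r • s) • x = r • (ρ s • x)
    rw [map_smul, smul_assoc]⟩
  let δ : Derivation R S (LogKaehler R S' G') :=
    { toLinearMap := (d R S' G').toLinearMap ∘ₗ ρ.toLinearMap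
      map_one_eq_zero' := by simp
      leibniz' := fun a b ↦ by
        change d R S' G' (ρ (a * b)) = ρ a • d R S' G' (ρ b) + ρ b • d R S' G' (ρ a)
        rw [map_mul, Derivation.leibniz] }
  let φ : LogKaehler R S G →ₗ[S] LogKaehler R S' G' :=
    lift δ (fun f ↦ dlog R S' G' ⟨ρ f.1, hρ _ f.2⟩)
      (fun f ↦ smul_dlog (R := R) (G := G') ⟨ρ f.1, hρ _ f.2⟩)
      (fun f g u h ↦ (dlog_of_eq_mul (R := R) (G := G') ⟨ρ f.1, hρ _ f.2⟩ ⟨ρ g.1, hρ _ g.2⟩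
        (Units.map ρ.toRingHom.toMonoidHom u) (by simp [h])))
  { toFun := φ
    map_add' := φ.map_add
    map_smul' := φ.map_smul }

@[simp] lemma map_d (a : S) : map ρ hρ (d R S G a) = d R S' G' (ρ a) := by
  let := Module.compHom (LogKaehler R S' G') ρ.toRingHom
  have : IsScalarTower R S (LogKaehler R S' G') := ⟨fun r s x ↦ by
    change ρ (r • s) • x = r • (ρ s • x)
    rw [map_smul, smul_assoc]⟩
  unfold map
  dsimp only
  apply @lift_d
  · exact fun f ↦ smul_dlog (R := R) (G := G') ⟨ρ f.1, hρ _ f.2⟩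
  · exact fun f g u h ↦ dlog_of_eq_mul (R := R) (G := G') ⟨ρ f.1, hρ _ f.2⟩ ⟨ρ g.1, hρ _ g.2⟩
      (Units.map ρ.toRingHom.toMonoidHom u) (by simp [h])

@[simp] lemma map_dlog (f : G) :
    map ρ hρ (dlog R S G f) = dlog R S' G' ⟨ρ f.1, hρ _ f.2⟩ := by
  let := Module.compHom (LogKaehler R S' G') ρ.toRingHom
  have : IsScalarTower R S (LogKaehler R S' G') := ⟨fun r s x ↦ by
    change ρ (r • s) • x = r • (ρ s • x)
    rw [map_smul, smul_assoc]⟩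
  unfold map
  dsimp only
  apply @lift_dlog
  · exact fun f ↦ smul_dlog (R := R) (G := G') ⟨ρ f.1, hρ _ f.2⟩
  · exact fun f g u h ↦ dlog_of_eq_mul (R := R) (G := G') ⟨ρ f.1, hρ _ f.2⟩ ⟨ρ g.1, hρ _ g.2⟩
      (Units.map ρ.toRingHom.toMonoidHom u) (by simp [h])

lemma map_id (ρ : S →ₐ[R] S) (hρ : ∀ f ∈ G, ρ f ∈ G) (h : ∀ a, ρ a = a)
    (x : LogKaehler R S G) : map ρ hρ x = x := by
  have hx : x ∈ Submodule.span S (Set.range (d R S G) ∪ Set.range (dlog R S G)) := by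
    rw [span_eq_top]; trivial
  induction hx using Submodule.span_induction with
  | mem x hx =>
    obtain ⟨a, rfl⟩ | ⟨f, rfl⟩ := hx
    · rw [map_d, h]
    · rw [map_dlog]; congr; exact h _
  | zero => exact LinearMap.map_zero _
  | add x y _ _ hx hy => rw [map_add, hx, hy]
  | smul a x _ hx => rw [map_smulₛₗ, hx]; exact congrArg (· • x) (h a)

lemma map_comp {S'' : Type} [CommRing S''] [Algebra R S''] {G'' : Set S''}
    (σ : S' →ₐ[R] S'') (hσ : ∀ f ∈ G', σ f ∈ G'') (τ : S →ₐ[R] S'') (hτ : ∀ f ∈ G, τ f ∈ G'')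
    (h : ∀ a, τ a = σ (ρ a)) (x : LogKaehler R S G) :
    map τ hτ x = map σ hσ (map ρ hρ x) := by
  have hx : x ∈ Submodule.span S (Set.range (d R S G) ∪ Set.range (dlog R S G)) := by
    rw [span_eq_top]; trivial
  induction hx using Submodule.span_induction with
  | mem x hx =>
    obtain ⟨a, rfl⟩ | ⟨f, rfl⟩ := hx
    · rw [map_d, map_d, map_d, h]
    · rw [map_dlog, map_dlog, map_dlog]; exact congrArg (dlog R S'' G'') (Subtype.ext (h _))
  | zero => simp only [LinearMap.map_zero]
  | add x y _ _ hx hy => simp only [_root_.map_add, hx, hy]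
  | smul a x _ hx =>
    simp only [map_smulₛₗ, hx]; exact congrArg (· • map σ hσ (map ρ hρ x)) (h a)

end map

end LogKaehler
end LogKaehler

section Sheaf

variable {A : Type} [CommRing A] {X D : Scheme.{0}}

/-- The structure homomorphism `A → Γ(X, U)` of a scheme over `Spec A`. -/
def structHom (π : X ⟶ Spec (.of A)) (U : X.Opens) : A →+* Γ(X, U) :=
  (X.presheaf.map (homOfLE le_top : U ⟶ ⊤).op).hom.comp
    (π.appTop.hom.comp (Scheme.ΓSpecIso (.of A)).inv.hom)

/-- The equations on the open `U` of the closed subscheme `D`: the sections `f ∈ Γ(X, U)` whose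
restriction to each affine open `V ⊆ U` is a nonzerodivisor that generates the ideal of `D ∩ V`. -/
def localEquations (ι : D ⟶ X) (U : X.Opens) : Set Γ(X, U) :=
  {f | ∀ (V : X.Opens) (i : V ≤ U), IsAffineOpen V →
    RingHom.ker (ι.app V).hom = Ideal.span {X.presheaf.map (homOfLE i).op f} ∧
      X.presheaf.map (homOfLE i).op f ∈ nonZeroDivisors Γ(X, V)}

/-- `D` is an effective (Cartier) divisor of `X`: locally on `X` it is defined by one equation which
is a nonzerodivisor. -/
def IsEffectiveCartier (ι : D ⟶ X) : Prop :=
  ∀ x : X, ∃ U : X.Opens, x ∈ U ∧ (localEquations ι U).Nonempty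

variable (π : X ⟶ Spec (.of A)) (ι : D ⟶ X)

lemma map_mem_localEquations {U V : X.Opens} (i : V ≤ U) {f : Γ(X, U)}
    (hf : f ∈ localEquations ι U) :
    X.presheaf.map (homOfLE i).op f ∈ localEquations ι V := by
  intro W j hW
  have := hf W (j.trans i) hW
  have e : X.presheaf.map (homOfLE j).op (X.presheaf.map (homOfLE i).op f) =
      X.presheaf.map (homOfLE (j.trans i)).op f := by
    rw [← ConcreteCategory.comp_apply, ← Functor.map_comp]; rfl
  rwa [e]

/-- `Γ(X, U)` as an `A`-algebra, for `X` a scheme over `Spec A`. -/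
@[reducible] def sectionsAlgebra (U : X.Opens) : Algebra A Γ(X, U) := (structHom π U).toAlgebra

/-- The restriction map `Γ(X, U) → Γ(X, V)` as a homomorphism of `A`-algebras. -/
def restrictAlgHom {U V : X.Opens} (i : V ≤ U) :
    letI := sectionsAlgebra π U
    letI := sectionsAlgebra π V
    Γ(X, U) →ₐ[A] Γ(X, V) :=
  letI := sectionsAlgebra π U
  letI := sectionsAlgebra π V
  { (X.presheaf.map (homOfLE i).op).hom with
    commutes' := fun a ↦ by
      change X.presheaf.map (homOfLE i).op (X.presheaf.map _ _) = X.presheaf.map _ _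
      rw [← ConcreteCategory.comp_apply, ← Functor.map_comp]; rfl }

/-- The sections over `U` of the presheaf of logarithmic differentials: `Ω[Γ(X, U)⁄A]` together
with a symbol `dlog f` for every equation `f` of `D` on `U`. -/
abbrev LogSections (U : X.Opens) : Type :=
  @LogKaehler A Γ(X, U) _ _ (sectionsAlgebra π U) (localEquations ι U)

/-- The restriction maps of the presheaf of logarithmic differentials. -/
def LogSections.restrict {U V : X.Opens} (i : V ≤ U) :
    LogSections π ι U →ₛₗ[(X.presheaf.map (homOfLE i).op).hom] LogSections π ι V :=
  @LogKaehler.map A Γ(X, U) _ _ (sectionsAlgebra π U) (localEquations ι U) Γ(X, V) _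
    (sectionsAlgebra π V) (localEquations ι V) (restrictAlgHom π i) (fun _ hf ↦ map_mem_localEquations ι i hf)

lemma LogSections.restrict_refl {U : X.Opens} (i : U ≤ U) (x : LogSections π ι U) :
    LogSections.restrict π ι i x = x :=
  @LogKaehler.map_id A Γ(X, U) _ _ (sectionsAlgebra π U) (localEquations ι U)
    (restrictAlgHom π i) (fun _ hf ↦ map_mem_localEquations ι i hf)
    (fun a ↦ by
      change X.presheaf.map (𝟙 _) a = a
      rw [CategoryTheory.Functor.map_id]; rfl) x

lemma LogSections.restrict_restrict {U V W : X.Opens} (i : V ≤ U) (j : W ≤ V) (k : W ≤ U)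
    (x : LogSections π ι U) :
    LogSections.restrict π ι k x = LogSections.restrict π ι j (LogSections.restrict π ι i x) :=
  @LogKaehler.map_comp A Γ(X, U) _ _ (sectionsAlgebra π U) (localEquations ι U)
    Γ(X, V) _ (sectionsAlgebra π V) (localEquations ι V)
    (restrictAlgHom π i) (fun _ hf ↦ map_mem_localEquations ι i hf)
    Γ(X, W) _ (sectionsAlgebra π W) (localEquations ι W)
    (restrictAlgHom π j) (fun _ hf ↦ map_mem_localEquations ι j hf)
    (restrictAlgHom π k) (fun _ hf ↦ map_mem_localEquations ι k hf)
    (fun a ↦ by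
      change X.presheaf.map (homOfLE k).op a =
        X.presheaf.map (homOfLE j).op (X.presheaf.map (homOfLE i).op a)
      rw [← ConcreteCategory.comp_apply, ← Functor.map_comp]; rfl) x

/-- The presheaf of logarithmic differentials, as a presheaf of abelian groups. -/
def logDifferentialsAb : (X.Opens)ᵒᵖ ⥤ Ab where
  obj U := AddCommGrpCat.of (LogSections π ι U.unop)
  map i := AddCommGrpCat.ofHom (LogSections.restrict π ι (leOfHom i.unop)).toAddMonoidHom
  map_id _ := AddCommGrpCat.hom_ext (AddMonoidHom.ext fun x ↦ LogSections.restrict_refl π ι _ x)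
  map_comp _ _ := AddCommGrpCat.hom_ext
    (AddMonoidHom.ext fun x ↦ LogSections.restrict_restrict π ι _ _ _ x)

instance (U : (X.Opens)ᵒᵖ) : Module (X.ringCatSheaf.obj.obj U) ((logDifferentialsAb π ι).obj U) :=
  letI m : Module Γ(X, U.unop) (LogSections π ι U.unop) := inferInstance
  m

/-- The presheaf of logarithmic differentials, as a presheaf of modules. -/
def logDifferentialsPresheaf : X.PresheafOfModules :=
  PresheafOfModules.ofPresheaf (logDifferentialsAb π ι)
    fun _ _ i r m ↦ (LogSections.restrict π ι (leOfHom i.unop)).map_smulₛₗ r m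

/-- The sheaf `Ω¹_{X/A}(log D)` on a scheme `X` over `Spec A` with a closed subscheme `D`, as a sheaf
of `𝒪_X`-modules: the sheafification of the presheaf above. Where `D` is a divisor
with equation `f`, it is generated by `Ω¹_{X/A}` and one more section `dlog f` with the single
relation `f • dlog f = d f`; away from `D` it is `Ω¹_{X/A}`. If `X` and `D` are smooth over `A` it is
locally free with basis `dlog x₁, d x₂, …, d x_r` in local coordinates such that `D = {x₁ = 0}`. -/
def logDifferentials : X.Modules :=
  (PresheafOfModules.sheafification (𝟙 X.ringCatSheaf.obj)).obj (logDifferentialsPresheaf π ι)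

/-- The structure sheaf as a module over itself. -/
abbrev structureSheaf (X : Scheme.{0}) : X.Modules := SheafOfModules.unit X.ringCatSheaf

/-- Multiplication by `a ∈ A` on the structure sheaf of a scheme over `Spec A`. -/
def mulHom (a : A) : structureSheaf X ⟶ structureSheaf X :=
  (SheafOfModules.unitHomEquiv (SheafOfModules.unit X.ringCatSheaf)).symm
    (PresheafOfModules.sectionsMk (fun U ↦ structHom π U.unop a) (fun U V i ↦ by
      change X.presheaf.map i (X.presheaf.map _ _) = X.presheaf.map _ _
      rw [← ConcreteCategory.comp_apply, ← Functor.map_comp]; rfl))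

end Sheaf

section Deformations

/-- A pair `(X, D)` over `Spec A`: a scheme `X` and a closed subscheme `D` of `X`, both flat over
`Spec A`. (Over a field, flatness is automatic.) -/
structure FlatPair (A : Type) [CommRing A] where
  X : Scheme.{0}
  D : Scheme.{0}
  ι : D ⟶ X
  π : X ⟶ Spec (.of A)
  isClosedImmersion : IsClosedImmersion ι
  flat : Flat π
  flat_divisor : Flat (ι ≫ π)

/-- A deformation over `Spec B` of a pair `(X, D)` over `Spec A`, along a ring homomorphism
`α : B → A`: a pair over `Spec B`, flat together with its divisor part, and cartesian squares that
identify its base change along `α` with `(X, D)`: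
```
    D  ---iD-->  total.D
    |               |
    X  ---iX-->  total.X
    |               |
  Spec A ------> Spec B
```
-/
structure Deformation {A B : Type} [CommRing A] [CommRing B] (P : FlatPair A) (α : B →+* A) where
  total : FlatPair B
  iX : P.X ⟶ total.X
  iD : P.D ⟶ total.D
  isPullback_X : IsPullback iX P.π total.π (Spec.map (CommRingCat.ofHom α))
  isPullback_D : IsPullback iD P.ι total.ι iX

namespace Deformation

variable {A B : Type} [CommRing A] [CommRing B] {P : FlatPair A} {α : B →+* A}

/-- An isomorphism of deformations: isomorphisms over `Spec B` of the two schemes and of their closed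
subschemes, compatible with the closed immersions and with the markings. -/
structure Equivalence (Y Y' : Deformation P α) where
  eX : Y.total.X ≅ Y'.total.X
  eD : Y.total.D ≅ Y'.total.D
  comm_π : eX.hom ≫ Y'.total.π = Y.total.π := by cat_disch
  comm_ι : eD.hom ≫ Y'.total.ι = Y.total.ι ≫ eX.hom := by cat_disch
  comm_iX : Y.iX ≫ eX.hom = Y'.iX := by cat_disch
  comm_iD : Y.iD ≫ eD.hom = Y'.iD := by cat_disch

/-- The inverse of an isomorphism of deformations. -/
def Equivalence.symm {Y Y' : Deformation P α} (e : Equivalence Y Y') : Equivalence Y' Y where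
  eX := e.eX.symm
  eD := e.eD.symm
  comm_π := by simp [← e.comm_π]
  comm_ι := by
    rw [← cancel_epi e.eD.hom, ← cancel_mono e.eX.hom]
    simp [e.comm_ι]
  comm_iX := by simp [← e.comm_iX]
  comm_iD := by simp [← e.comm_iD]

/-- Isomorphism of deformations is an equivalence relation. -/
instance setoid (P : FlatPair A) (α : B →+* A) : Setoid (Deformation P α) where
  r Y Y' := Nonempty (Equivalence Y Y')
  iseqv :=
    { refl := fun Y ↦ ⟨{ eX := Iso.refl _, eD := Iso.refl _ }⟩
      symm := fun ⟨e⟩ ↦ ⟨e.symm⟩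
      trans := fun {Y Y' Y''} ⟨e⟩ ⟨e'⟩ ↦ ⟨{
        eX := e.eX ≪≫ e'.eX
        eD := e.eD ≪≫ e'.eD
        comm_π := by simp [e.comm_π, e'.comm_π]
        comm_ι := by simp [← reassoc_of% e.comm_ι, e'.comm_ι]
        comm_iX := by simp [reassoc_of% e.comm_iX, e'.comm_iX]
        comm_iD := by simp [reassoc_of% e.comm_iD, e'.comm_iD] }⟩ }

/-- The deformation `Y'` over `Spec B'` is the base change of the deformation `Y` over `Spec B` along
`g : B → B'`, compatibly with the markings. -/
def IsBaseChange {B' : Type} [CommRing B'] {α' : B' →+* A} (g : B →+* B')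
    (Y : Deformation P α) (Y' : Deformation P α') : Prop :=
  ∃ (qX : Y'.total.X ⟶ Y.total.X) (qD : Y'.total.D ⟶ Y.total.D),
    IsPullback qX Y'.total.π Y.total.π (Spec.map (CommRingCat.ofHom g)) ∧
    IsPullback qD Y'.total.ι Y.total.ι qX ∧
    Y'.iX ≫ qX = Y.iX ∧ Y'.iD ≫ qD = Y.iD

end Deformation

variable {A : Type} [CommRing A]

/-- The augmentation `A ⊕ M → A` of the square-zero extension of `A` by `M`. -/
abbrev augmentation (A M : Type) [CommRing A] [AddCommGroup M] [Module A M] [Module Aᵐᵒᵖ M]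
    [IsCentralScalar A M] : TrivSqZeroExt A M →+* A :=
  (TrivSqZeroExt.fstHom A A M).toRingHom

/-- The ring homomorphism `A ⊕ M → A ⊕ N` over `A` induced by a linear map `M → N`. -/
abbrev mapHom {M N : Type} [AddCommGroup M] [Module A M] [Module Aᵐᵒᵖ M]
    [IsCentralScalar A M] [AddCommGroup N] [Module A N] [Module Aᵐᵒᵖ N]
    [IsCentralScalar A N] (f : M →ₗ[A] N) : TrivSqZeroExt A M →+* TrivSqZeroExt A N :=
  (TrivSqZeroExt.map f).toRingHom

/-- The `T¹`-space of a pair over `A`: isomorphism classes of deformations of the pair along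
`A[ε] → A`, `ε ↦ 0`. Here `TrivSqZeroExt A A` is the ring `DualNumber A` of dual numbers
`A[ε] = A[y]/(y²)`; for `A = ℂ[t]/(t^(n+1))` this is `ℂ[x,y]/(x^(n+1), y²) = A ⊗ ℂ[y]/(y²)`, with
`x ↦ t`, `y ↦ 0` as the map to `A`. -/
def T1 (P : FlatPair A) : Type 1 := Quotient (Deformation.setoid P (augmentation A A))

/-- The class of a deformation in the `T¹`-space. -/
def T1.mk {P : FlatPair A} (Y : Deformation P (augmentation A A)) : T1 P :=
  Quotient.mk _ Y

/-- The addition of the `T¹`-space, by functoriality: `ζ` is the sum of `ξ` and `η` if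
there is a deformation over `A[ε₁, ε₂]/(ε₁, ε₂)²` that induces `ξ` under `(ε₁, ε₂) ↦ (ε, 0)`,
`η` under `(ε₁, ε₂) ↦ (0, ε)` and `ζ` under `(ε₁, ε₂) ↦ (ε, ε)`. -/
def T1.IsSum {P : FlatPair A} (ξ η ζ : T1 P) : Prop :=
  ∃ (Z : Deformation P (augmentation A (A × A))) (Y₁ Y₂ Y : Deformation P (augmentation A A)),
    Z.IsBaseChange (mapHom (LinearMap.fst A A A)) Y₁ ∧
    Z.IsBaseChange (mapHom (LinearMap.snd A A A)) Y₂ ∧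
    Z.IsBaseChange (mapHom (LinearMap.fst A A A + LinearMap.snd A A A)) Y ∧
    T1.mk Y₁ = ξ ∧ T1.mk Y₂ = η ∧ T1.mk Y = ζ

/-- The scalar multiplication of the `T¹`-space, by functoriality: `ζ` is `a` times `ξ` if it is
induced from `ξ` by the homomorphism `A[ε] → A[ε]`, `ε ↦ a ε`. -/
def T1.IsSMul {P : FlatPair A} (a : A) (ξ ζ : T1 P) : Prop :=
  ∃ Y Y' : Deformation P (augmentation A A),
    Y.IsBaseChange (mapHom (a • LinearMap.id)) Y' ∧ T1.mk Y = ξ ∧ T1.mk Y' = ζ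

end Deformations

section Ext

variable {A : Type} [CommRing A] (P : FlatPair A)

/-- The group `Ext¹(Ω¹_{X/A}(log D), 𝒪_X)` in the category of `𝒪_X`-modules. -/
def LogExt1 : Type 1 :=
  @Abelian.Ext P.X.Modules _ _ (HasExt.standard _) (logDifferentials P.π P.ι) (structureSheaf P.X) 1

instance : AddCommGroup (LogExt1 P) :=
  letI := HasExt.standard P.X.Modules
  inferInstanceAs (AddCommGroup (Abelian.Ext (logDifferentials P.π P.ι) (structureSheaf P.X) 1))

/-- The action of `A` on `Ext¹`, through multiplication on the second argument `𝒪_X`. -/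
instance : SMul A (LogExt1 P) where
  smul a e :=
    letI := HasExt.standard P.X.Modules
    Abelian.Ext.comp e (Abelian.Ext.mk₀ (mulHom P.π a)) (add_zero 1)

end Ext

/-- The ring `A_n = ℂ[t]/(t^(n+1))`. -/
abbrev TruncPoly (n : ℕ) : Type :=
  Polynomial ℂ ⧸ Ideal.span {(Polynomial.X : Polynomial ℂ) ^ (n + 1)}

/-- The residue map `A_n → ℂ`, `t ↦ 0`. -/
def residue (n : ℕ) : TruncPoly n →+* ℂ :=
  Ideal.Quotient.lift _ (Polynomial.evalRingHom 0) (fun p hp ↦ by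
    obtain ⟨q, rfl⟩ := Ideal.mem_span_singleton.mp hp
    simp)

end LogDef

end

/-!
Logarithmic differentials classify the first-order deformations of a pair because a deformation
carries, after enlarging its structure sheaf, a derivation that lifts the scalars, and what this
derivation fails to be on the structure sheaf itself is a class in `Ext¹`. Cocycles on an open cover
would not suffice to say this, as `X` may be singular away from `D` and its deformations are then
not locally trivial; the enlargement by an injective sheaf takes care of both the gluing and the
local contributions.

Let `A` be the base ring, `(X, D)` the pair over `A`, `Ω = Ω¹_{X/A}(log D)`. Choose a resolution
`0 → 𝒪 → I → J → 0` with `I` injective such that equations of `D` act bijectively on `I` (`InjRes`).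
Then `Ext¹(Ω, 𝒪) = Hom(Ω, J) / Hom(Ω, I)` (`connecting_surjective`, `connecting_eq_zero_iff`). Given
a deformation `Y` over `A ⊕ M` and a linear map `c : M → A`, say that `φ : Ω → J` belongs to `Y`
along `c` (`Rel`) if there is a derivation `δ : 𝒪_Y → I` which is `c` on the scalars `M`, induces
`φ ∘ d` in `J`, and for which `δ y / g` induces `φ (dlog g)` for each lift `y` of an equation `g` to
an equation of the divisor of `Y`. This quotient makes sense as `g` acts bijectively on `I`, and
modulo `𝒪` it does not depend on the lift.

* Every derivation that is `c` on the scalars determines such a `φ` (`Rel.exists_of_sheafDer`), and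
  for `c = 0` it is a morphism `Ω → I` (`Rel.exists_hom`). So the class of `φ` in `Ext¹` depends
  only on `Y` and `c` (`Rel.connecting_eq`).
* Conversely, the pairs `(f, m)` of a function `f` and a section `m` of `I` over `φ (d f)` form the
  structure sheaf of a deformation over the dual numbers, in which the pairs `(g, g ℓ)`, with `ℓ`
  a lift of `φ (dlog g)`, are the equations of the divisor (`modelDeformation`). Lifts `m` exist
  over affine opens since `H¹(𝒪)` vanishes there (`InjRes.exists_qI_eq`). A derivation `δ` on `Y`
  over `φ` gives the isomorphism `y ↦ (y mod M, δ y)` from the functions on `Y` to these pairs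
  (`nonempty_equivalence_modelDeformation`), so `φ` determines `Y`. The construction is made for a
  finite family of morphisms `φ`, and with two of them it gives deformations over `A[ε₁, ε₂]`.
* Derivations pull back along base changes (`Rel.of_isBaseChange`), and they can be added and
  multiplied by scalars (`Rel.add`, `Rel.smul`); this gives the compatibility with the operations
  on `T¹`.

It remains to find a resolution for which every deformation over the dual numbers has a derivation.
Let `I` be the product over the generic points `x` of injective modules that contain the local rings
`𝒪_x` (`skyInjRes`). As `X` is flat over `A = ℂ[t] / (t ^ (n + 1))` and reduced modulo `t`, functions
are determined by their germs at the generic points (`eq_zero_of_germ_genericPoints`), so `𝒪` embeds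
in `I`. Equations of `D`, being nonzerodivisors, are units at the generic points
(`isUnit_germ_of_mem_localEquations`). The residue field `κ(x)` of `𝒪_x` is a finitely generated
extension of `ℂ`, hence formally smooth, so the local ring at `x` of a deformation over `A[ε]` is the
tensor product of `A[ε]` and `κ(x)` and has the derivation `∂/∂ε`
(`exists_ringHom_trivSqZeroExt`). The product of these derivations is the derivation required
(`exists_rel`).
-/

noncomputable section

namespace LogDef

/-! ### Flat modules and nilpotent ideals -/

section FlatNilpotent

variable {B : Type*} [CommRing B] {K : Ideal B}

lemma exists_fintype_sum_of_mem_smul_top {S : Type*} [AddCommGroup S] [Module B S] {x : S}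
    (hx : x ∈ K • (⊤ : Submodule B S)) :
    ∃ (n : ℕ) (k : Fin n → B) (s : Fin n → S), (∀ i, k i ∈ K) ∧ x = ∑ i, k i • s i := by
  refine Submodule.smul_induction_on hx
    (fun r hr m _ ↦ ⟨1, fun _ ↦ r, fun _ ↦ m, fun _ ↦ hr, by simp⟩) ?_
  rintro x y ⟨n, k, s, hk, rfl⟩ ⟨n', k', s', hk', rfl⟩
  refine ⟨n + n', Fin.append k k', Fin.append s s', fun i ↦ ?_, ?_⟩
  · induction i using Fin.addCases <;> simp [hk, hk']
  · simp [Fin.sum_univ_add]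

/-- Nakayama's lemma for a nilpotent ideal; no finiteness is needed. -/
lemma le_of_le_sup_smul {S : Type*} [AddCommGroup S] [Module B S] (hK : IsNilpotent K)
    {N L : Submodule B S} (h : L ≤ N ⊔ K • L) : L ≤ N := by
  obtain ⟨n, hn⟩ := hK
  have key : ∀ m : ℕ, L ≤ N ⊔ K ^ m • L := by
    intro m
    induction m with
    | zero => simp
    | succ m ih =>
      calc L ≤ N ⊔ K • L := h
        _ ≤ N ⊔ K • (N ⊔ K ^ m • L) := sup_le_sup_left (smul_mono_right _ ih) _
        _ ≤ N ⊔ K ^ (m + 1) • L := by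
          rw [Submodule.smul_sup, pow_succ', mul_smul]
          exact sup_le le_sup_left (sup_le_sup_right Submodule.smul_le_right _)
  simpa [hn] using key n

/-- If the quotient `T` of `S` is flat, then the kernel of `S → T` meets `K S` in `K` times the
kernel. -/
lemma ker_inf_smul_top_le {S T : Type*} [AddCommGroup S] [Module B S] [AddCommGroup T]
    [Module B T] [Module.Flat B T] (f : S →ₗ[B] T) (hf : Function.Surjective f) :
    LinearMap.ker f ⊓ K • (⊤ : Submodule B S) ≤ K • LinearMap.ker f := by
  rintro x ⟨hx0, hx⟩
  obtain ⟨n, k, s, hk, rfl⟩ := exists_fintype_sum_of_mem_smul_top hx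
  have h0 : ∑ i, k i • f (s i) = 0 := by simpa using hx0
  obtain ⟨m, a, t, hat, ha⟩ := Module.Flat.isTrivialRelation_of_sum_smul_eq_zero h0
  choose s' hs' using fun j ↦ hf (t j)
  have e : ∑ i, k i • s i = ∑ i, k i • (s i - ∑ j, a i j • s' j) := by
    simp only [smul_sub, Finset.sum_sub_distrib, Finset.smul_sum, smul_smul]
    rw [Finset.sum_comm]
    simp [← Finset.sum_smul, ha]
  rw [e]
  refine Submodule.sum_mem _ fun i _ ↦ Submodule.smul_mem_smul (hk i) ?_
  simp [hat i, hs']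

/-- A linear map to a flat module is bijective if it is so modulo a nilpotent ideal. -/
lemma bijective_of_flat_of_isNilpotent (hK : IsNilpotent K) {S T : Type*} [AddCommGroup S]
    [Module B S] [AddCommGroup T] [Module B T] [Module.Flat B T] (f : S →ₗ[B] T)
    (hs : ∀ t, ∃ s, t - f s ∈ K • (⊤ : Submodule B T))
    (hi : ∀ s, f s ∈ K • (⊤ : Submodule B T) → s ∈ K • (⊤ : Submodule B S)) :
    Function.Bijective f := by
  have hsurj : Function.Surjective f := by
    rw [← LinearMap.range_eq_top, eq_top_iff]
    refine le_of_le_sup_smul hK fun t _ ↦ ?_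
    obtain ⟨s, hs⟩ := hs t
    rw [← add_sub_cancel (f s) t]
    exact Submodule.add_mem_sup ⟨s, rfl⟩ hs
  refine ⟨?_, hsurj⟩
  rw [← LinearMap.ker_eq_bot, eq_bot_iff]
  refine le_of_le_sup_smul hK ?_
  rw [bot_sup_eq]
  refine le_trans (le_inf le_rfl fun x hx ↦ hi x ?_) (ker_inf_smul_top_le f hsurj)
  rw [LinearMap.mem_ker.mp hx]; exact Submodule.zero_mem _

/-- Over a local ring with nilpotent maximal ideal every flat module is free. -/
lemma free_of_flat_of_isNilpotent_maximalIdeal [IsLocalRing B]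
    (hB : IsNilpotent (IsLocalRing.maximalIdeal B)) (T : Type*) [AddCommGroup T] [Module B T]
    [Module.Flat B T] : Module.Free B T := by
  let m := IsLocalRing.maximalIdeal B
  let : Field (B ⧸ m) := Ideal.Quotient.field m
  let b := Module.Free.chooseBasis (B ⧸ m) (T ⧸ m • (⊤ : Submodule B T))
  choose t ht using fun i ↦ Submodule.Quotient.mk_surjective (m • (⊤ : Submodule B T)) (b i)
  let f : (_ →₀ B) →ₗ[B] T := Finsupp.linearCombination B t
  have hf : ∀ s, Submodule.Quotient.mk (f s) =
      Finsupp.linearCombination (B ⧸ m) b (s.mapRange (Ideal.Quotient.mk m) (map_zero _)) := by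
    intro s
    induction s using Finsupp.induction_linear with
    | zero => simp [f]
    | add x y hx hy =>
      rw [map_add, Submodule.Quotient.mk_add, hx, hy, Finsupp.mapRange_add (by simp), map_add]
    | single i a =>
      simp only [f, Finsupp.linearCombination_single, Finsupp.mapRange_single, ← ht]
      rfl
  refine Module.Free.of_equiv (LinearEquiv.ofBijective f
    (bijective_of_flat_of_isNilpotent hB f (fun x ↦ ?_) (fun s hs ↦ ?_)))
  · obtain ⟨c, hc⟩ : ∃ c, Finsupp.linearCombination (B ⧸ m) b c = Submodule.Quotient.mk x :=
      ⟨b.repr (Submodule.Quotient.mk x), b.linearCombination_repr _⟩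
    obtain ⟨s, rfl⟩ := Finsupp.mapRange_surjective (Ideal.Quotient.mk m) (map_zero _)
      Ideal.Quotient.mk_surjective c
    refine ⟨s, ?_⟩
    rw [← Submodule.Quotient.eq, hf, hc]
  · rw [← Submodule.Quotient.mk_eq_zero, hf] at hs
    have h0 := (linearIndependent_iff.mp b.linearIndependent) _ hs
    rw [← s.sum_single]
    refine Submodule.sum_mem _ fun i _ ↦ ?_
    have : s i ∈ m := by
      simpa [Ideal.Quotient.eq_zero_iff_mem] using DFunLike.congr_fun h0 i
    simpa using Submodule.smul_mem_smul this (Submodule.mem_top (x := Finsupp.single i (1 : B)))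

end FlatNilpotent

section Equations

variable {B : Type*} [CommRing B] {K : Ideal B} {S T R : Type*} [CommRing S] [CommRing T]
  [CommRing R] [Algebra B S] [Algebra B T]

/-- If `T = S / I` is flat over `B`, a lift to `I` of a generator of the image of `I` in
`R = S / K S` generates `I`. -/
lemma ker_eq_span_of_flat (hK : IsNilpotent K) [Module.Flat B T] (f : S →ₐ[B] T)
    (hf : Function.Surjective f) (ρ : S →+* R)
    (hρ : ∀ s, ρ s = 0 → s ∈ K • (⊤ : Submodule B S)) {g : S} (hg : f g = 0)
    (h : ∀ s, f s = 0 → ρ s ∈ Ideal.span {ρ g}) (hρs : Function.Surjective ρ) :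
    RingHom.ker f = Ideal.span {g} := by
  apply le_antisymm
  · have : (LinearMap.ker f.toLinearMap) ≤ (Ideal.span {g}).restrictScalars B := by
      refine le_of_le_sup_smul hK fun s hs ↦ ?_
      obtain ⟨r, hr⟩ := Ideal.mem_span_singleton'.mp (h s hs)
      obtain ⟨r, rfl⟩ := hρs r
      have h1 : s - r * g ∈ K • LinearMap.ker f.toLinearMap := by
        refine ker_inf_smul_top_le f.toLinearMap hf ⟨?_, hρ _ (by simp [hr])⟩
        have : f s = 0 := hs
        simp [this, hg]
      rw [← add_sub_cancel (r * g) s]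
      exact Submodule.add_mem_sup (Ideal.mul_mem_left _ _ (Ideal.mem_span_singleton_self g)) h1
    exact fun s hs ↦ this hs
  · rw [Ideal.span_singleton_le_iff_mem]
    exact hg

/-- A generator of the ideal `I` with `S` flat and `S / I` free over `B` is a nonzerodivisor if
it is one modulo a nilpotent ideal of `B`. -/
lemma mem_nonZeroDivisors_of_flat (hK : IsNilpotent K) [Module.Flat B S] [Module.Free B T]
    (f : S →ₐ[B] T) (hf : Function.Surjective f) (ρ : S →+* R)
    (hρ : ∀ s, ρ s = 0 → s ∈ K • (⊤ : Submodule B S)) {g : S}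
    (hg : RingHom.ker f = Ideal.span {g}) (hnz : ρ g ∈ nonZeroDivisors R) :
    g ∈ nonZeroDivisors S := by
  obtain ⟨σ, hσ⟩ := Module.projective_lifting_property f.toLinearMap LinearMap.id hf
  have hσ' : ∀ t, f (σ t) = t := fun t ↦ LinearMap.congr_fun hσ t
  -- the kernel of a surjection onto a free module is a direct summand, hence flat
  have : Module.Flat B (LinearMap.ker f.toLinearMap) := by
    refine Module.Flat.of_retract (LinearMap.ker f.toLinearMap).subtype
      ((LinearMap.id - σ ∘ₗ f.toLinearMap).codRestrict _ fun s ↦ ?_) ?_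
    · refine LinearMap.ext ?_
      rintro ⟨x, hx⟩
      have hx : f x = 0 := hx
      exact Subtype.ext (by simp [hx])
    · change f (s - σ (f s)) = 0
      rw [map_sub, hσ', sub_self]
  have hgf : f g = 0 := by
    rw [← RingHom.mem_ker, hg]; exact Ideal.mem_span_singleton_self g
  let μ : S →ₗ[B] LinearMap.ker f.toLinearMap :=
    (LinearMap.mulLeft B g).codRestrict _ fun s ↦ by simp [hgf]
  have hμ : Function.Surjective μ := by
    rintro ⟨x, hx⟩
    have hx : x ∈ RingHom.ker f := hx
    rw [hg, Ideal.mem_span_singleton'] at hx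
    obtain ⟨r, rfl⟩ := hx
    exact ⟨r, Subtype.ext (mul_comm g r)⟩
  have h0 : LinearMap.ker μ = ⊥ := by
    rw [eq_bot_iff]
    refine le_of_le_sup_smul hK ?_
    rw [bot_sup_eq]
    refine le_trans (le_inf le_rfl fun x hx ↦ hρ x ?_) (ker_inf_smul_top_le μ hμ)
    have hx : g * x = 0 := congrArg Subtype.val (LinearMap.mem_ker.mp hx)
    refine (mem_nonZeroDivisors_iff.mp hnz).1 _ ?_
    rw [← map_mul, hx, map_zero]
  rw [mem_nonZeroDivisors_iff_right]
  intro x hx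
  have : x ∈ LinearMap.ker μ := Subtype.ext ((mul_comm g x).trans hx)
  simpa [h0] using this

end Equations

section SquareZero

variable {A M : Type*} [CommRing A] [AddCommGroup M] [Module A M] [Module Aᵐᵒᵖ M]
  [IsCentralScalar A M]

lemma isNilpotent_ker_fstHom :
    IsNilpotent (RingHom.ker (TrivSqZeroExt.fstHom A A M).toRingHom) := by
  refine ⟨2, ?_⟩
  rw [pow_two, Ideal.zero_eq_bot, eq_bot_iff, Ideal.mul_le]
  intro x hx y hy
  have hx : x.fst = 0 := hx
  have hy : y.fst = 0 := hy
  rw [Submodule.mem_bot]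
  ext <;> simp [hx, hy]

/-- Flatness over a square-zero extension `A ⊕ M` with `M` free, tested on a module `T` whose
quotient by `M T` is the free `A`-module `R`. -/
lemma flat_of_squareZero {ι : Type*} [Fintype ι] (c : M ≃ₗ[A] (ι → A))
    {T R : Type*} [AddCommGroup T] [Module (TrivSqZeroExt A M) T] [AddCommGroup R] [Module A R]
    [Module.Free A R] (ρ : T →+ R) (hρ : ∀ (b : TrivSqZeroExt A M) (t : T), ρ (b • t) = b.fst • ρ t)
    (hs : Function.Surjective ρ)
    (hk : ∀ t, ρ t = 0 →
      t ∈ RingHom.ker (TrivSqZeroExt.fstHom A A M).toRingHom •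
        (⊤ : Submodule (TrivSqZeroExt A M) T))
    [DecidableEq ι]
    (hi : ∀ t : ι → T, ∑ i, (TrivSqZeroExt.inr (c.symm (Pi.single i 1)) : TrivSqZeroExt A M) • t i
      = 0 → ∀ i, ρ (t i) = 0) :
    Module.Flat (TrivSqZeroExt A M) T := by
  let b := Module.Free.chooseBasis A R
  choose t ht using fun i ↦ hs (b i)
  have hsum : ∀ s : _ →₀ TrivSqZeroExt A M, ρ (Finsupp.linearCombination _ t s) =
      Finsupp.linearCombination A b (s.mapRange TrivSqZeroExt.fst TrivSqZeroExt.fst_zero) := by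
    intro s
    induction s using Finsupp.induction_linear with
    | zero => simp
    | add x y hx hy =>
      rw [map_add, map_add, hx, hy, Finsupp.mapRange_add (by simp), map_add]
    | single i a => simp [hρ, ht]
  have hinr : ∀ m : M, (TrivSqZeroExt.inr m : TrivSqZeroExt A M) =
      ∑ i, TrivSqZeroExt.inr (c.symm (Pi.single i 1)) * TrivSqZeroExt.inl (c m i) := by
    intro m
    have : m = ∑ i, c m i • c.symm (Pi.single i 1) := by
      apply c.injective
      ext j
      simp [Finset.sum_apply, Pi.single_apply]
    conv_lhs => rw [this]
    rw [TrivSqZeroExt.inr_sum]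
    refine Finset.sum_congr rfl fun i _ ↦ ?_
    ext <;> simp
  have hli : LinearIndependent (TrivSqZeroExt A M) t := by
    rw [linearIndependent_iff]
    intro s hs0
    have h1 := hsum s
    rw [hs0, map_zero] at h1
    have h2 := linearIndependent_iff.mp b.linearIndependent _ h1.symm
    have h3 : ∀ x, (s x).fst = 0 := fun x ↦ by simpa using DFunLike.congr_fun h2 x
    have h4 : Finsupp.linearCombination _ t s = ∑ i,
        (TrivSqZeroExt.inr (c.symm (Pi.single i 1)) : TrivSqZeroExt A M) •
          Finsupp.linearCombination (TrivSqZeroExt A M) t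
            (s.mapRange (fun x ↦ TrivSqZeroExt.inl (c x.snd i)) (by simp)) := by
      simp only [← map_smul, ← map_sum]
      congr 1
      ext1 x
      rw [Finsupp.finsetSum_apply]
      simp only [Finsupp.smul_apply, Finsupp.mapRange_apply, smul_eq_mul, ← hinr]
      ext <;> simp [h3]
    rw [h4] at hs0
    have h5 := hi _ hs0
    ext1 x
    have h6 : c (s x).snd = 0 := by
      funext i
      have := h5 i
      rw [hsum] at this
      have := DFunLike.congr_fun (linearIndependent_iff.mp b.linearIndependent _ this) x
      simpa using this
    ext
    · exact h3 x
    · simpa using h6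
  have hsp : ⊤ ≤ Submodule.span (TrivSqZeroExt A M) (Set.range t) := by
    refine le_of_le_sup_smul isNilpotent_ker_fstHom fun x _ ↦ ?_
    obtain ⟨s, hs⟩ : ∃ s : _ →₀ TrivSqZeroExt A M, ρ (Finsupp.linearCombination _ t s) = ρ x := by
      refine ⟨(b.repr (ρ x)).mapRange TrivSqZeroExt.inl (TrivSqZeroExt.inl_zero M), ?_⟩
      rw [hsum]
      conv_rhs => rw [← b.linearCombination_repr (ρ x)]
      congr 1
      exact Finsupp.ext fun i ↦ by
        rw [Finsupp.mapRange_apply, Finsupp.mapRange_apply]; exact TrivSqZeroExt.fst_inl _ _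
    rw [← add_sub_cancel (Finsupp.linearCombination _ t s) x]
    refine Submodule.add_mem_sup ?_ (hk _ (by simp [hs]))
    rw [Finsupp.mem_span_range_iff_exists_finsupp]
    exact ⟨s, by rw [Finsupp.linearCombination_apply]⟩
  have := Module.Free.of_basis (Module.Basis.mk hli hsp)
  infer_instance

end SquareZero

section Generic

open TensorProduct

/-- Let `T'` be flat over the `k`-algebra `B` with residue field `k`, nilpotent augmentation ideal
`K`, and let `T' / K T' = κ` be formally smooth over `k`. Then `T' ≃ B ⊗ κ`: there is a section `σ`
of the residue map such that ring homomorphisms from `T'` are pairs of compatible homomorphisms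
from `B` and from `κ`. -/
lemma exists_section_of_formallySmooth {k B T' κ : Type*} [Field k] [CommRing B] [Algebra k B]
    (e : B →ₐ[k] k) (hK : IsNilpotent (RingHom.ker e)) [CommRing T'] [Field κ]
    [Algebra k κ] [Algebra.FormallySmooth k κ] [Algebra B T'] [Module.Flat B T']
    (π : T' →+* κ) (hπs : Function.Surjective π)
    (hπB : ∀ b, π (algebraMap B T' b) = algebraMap k κ (e b))
    (hπk : ∀ y, π y = 0 → y ∈ (RingHom.ker e).map (algebraMap B T')) :
    ∃ σ : κ →+* T', (∀ a : k, σ (algebraMap k κ a) = algebraMap B T' (algebraMap k B a)) ∧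
      (∀ (E : Type _) [CommRing E] (u : B →+* E) (v : κ →+* E),
        (∀ a : k, u (algebraMap k B a) = v (algebraMap k κ a)) →
          ∃ Ψ : T' →+* E, (∀ b, Ψ (algebraMap B T' b) = u b) ∧ ∀ x, Ψ (σ x) = v x) ∧
      (∀ (E : Type _) [CommRing E] (Ψ Ψ' : T' →+* E),
        (∀ b, Ψ (algebraMap B T' b) = Ψ' (algebraMap B T' b)) → (∀ x, Ψ (σ x) = Ψ' (σ x)) →
          Ψ = Ψ') := by
  let K : Ideal B := RingHom.ker e
  letI : Algebra k T' := ((algebraMap B T').comp (algebraMap k B)).toAlgebra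
  have : IsScalarTower k B T' := IsScalarTower.of_algebraMap_eq fun _ ↦ rfl
  let π' : T' →ₐ[k] κ :=
    { π with
      commutes' := fun a ↦ by
        change π (algebraMap B T' (algebraMap k B a)) = _
        rw [hπB, e.commutes]; rfl }
  have hker : IsNilpotent (RingHom.ker (π' : T' →+* κ)) := by
    obtain ⟨n, hn⟩ := hK
    refine ⟨n, ?_⟩
    rw [Ideal.zero_eq_bot, eq_bot_iff]
    refine (Ideal.pow_right_mono (fun y hy ↦ hπk y hy) n).trans ?_
    rw [← Ideal.map_pow, hn, Ideal.zero_eq_bot, Ideal.map_bot]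
  let σ : κ →ₐ[k] T' := Algebra.FormallySmooth.liftOfSurjective (AlgHom.id k κ) π' hπs hker
  have hσ : ∀ x, π (σ x) = x := fun x ↦
    Algebra.FormallySmooth.liftOfSurjective_apply (AlgHom.id k κ) π' hπs hker x
  let f : B ⊗[k] κ →ₐ[B] T' :=
    Algebra.TensorProduct.lift (Algebra.ofId B T') σ fun _ _ ↦ Commute.all _ _
  have hf : ∀ b x, f (b ⊗ₜ x) = algebraMap B T' b * σ x := fun b x ↦ by
    simp [f, Algebra.ofId_apply]
  have hKT : ∀ y : T', y ∈ K.map (algebraMap B T') ↔ y ∈ K • (⊤ : Submodule B T') := fun y ↦ by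
    rw [Ideal.smul_top_eq_map]; rfl
  have hred : ∀ s : B ⊗[k] κ, ∃ x : κ, s - 1 ⊗ₜ x ∈ K • (⊤ : Submodule B (B ⊗[k] κ)) := by
    intro s
    induction s with
    | zero => exact ⟨0, by simp⟩
    | tmul b x =>
      refine ⟨e b • x, ?_⟩
      have : b ⊗ₜ x - 1 ⊗ₜ[k] (e b • x) = (b - algebraMap k B (e b)) • ((1 : B) ⊗ₜ[k] x) := by
        rw [← TensorProduct.smul_tmul, TensorProduct.smul_tmul', ← TensorProduct.sub_tmul]
        congr 1
        rw [Algebra.algebraMap_eq_smul_one]; simp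
      rw [this]
      refine Submodule.smul_mem_smul ?_ trivial
      change e _ = 0
      rw [map_sub, AlgHom.commutes, Algebra.algebraMap_self_apply, sub_self]
    | add x y hx hy =>
      obtain ⟨x', hx⟩ := hx
      obtain ⟨y', hy⟩ := hy
      refine ⟨x' + y', ?_⟩
      rw [TensorProduct.tmul_add, add_sub_add_comm]
      exact Submodule.add_mem _ hx hy
  have hbij : Function.Bijective f := by
    refine bijective_of_flat_of_isNilpotent hK f.toLinearMap (fun t ↦ ?_) (fun s hs ↦ ?_)
    · refine ⟨1 ⊗ₜ π t, (hKT _).mp (hπk _ ?_)⟩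
      have e1 : f.toLinearMap ((1 : B) ⊗ₜ[k] π t) = σ (π t) := by
        rw [AlgHom.toLinearMap_apply, hf, map_one, one_mul]
      rw [e1, map_sub, hσ, sub_self]
    · obtain ⟨x, hx⟩ := hred s
      have hfx : f s - σ x ∈ K.map (algebraMap B T') := by
        have := Submodule.mem_map_of_mem (f := f.toLinearMap) hx
        rw [Submodule.map_smul''] at this
        have := (hKT _).mpr (Submodule.smul_mono le_rfl le_top this)
        have e1 : f.toLinearMap (s - 1 ⊗ₜ x) = f s - σ x := by
          rw [map_sub, AlgHom.toLinearMap_apply, AlgHom.toLinearMap_apply, hf, map_one, one_mul]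
        rwa [e1] at this
      have hsx : σ x ∈ K.map (algebraMap B T') := by
        have := Ideal.sub_mem _ ((hKT _).mpr hs) hfx
        rwa [AlgHom.toLinearMap_apply, sub_sub_cancel] at this
      have hx0 : x = 0 := by
        have h0 : K.map (algebraMap B T') ≤ RingHom.ker π := by
          rw [Ideal.map_le_iff_le_comap]
          intro b hb
          have hb : e b = 0 := hb
          change π _ = 0
          rw [hπB, hb, map_zero]
        rw [← hσ x]; exact h0 hsx
      simpa [hx0] using hx
  let F := AlgEquiv.ofBijective f hbij
  have hF : ∀ s, F s = f s := fun _ ↦ rfl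
  refine ⟨σ.toRingHom, fun a ↦ σ.commutes a, ?_, ?_⟩
  · intro E _ u v huv
    letI : Algebra k E := (v.comp (algebraMap k κ)).toAlgebra
    let u' : B →ₐ[k] E := { u with commutes' := huv }
    let v' : κ →ₐ[k] E := { v with commutes' := fun _ ↦ rfl }
    let w : B ⊗[k] κ →ₐ[k] E := Algebra.TensorProduct.lift u' v' fun _ _ ↦ Commute.all _ _
    have hw : ∀ b x, w (b ⊗ₜ x) = u b * v x := fun b x ↦ by
      simp only [w, Algebra.TensorProduct.lift_tmul]; rfl
    refine ⟨w.toRingHom.comp F.symm.toRingEquiv.toRingHom, fun b ↦ ?_, fun x ↦ ?_⟩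
    · change w (F.symm _) = _
      have : algebraMap B T' b = F (b ⊗ₜ 1) := by
        rw [hF, hf, map_one, mul_one]
      rw [this, F.symm_apply_apply, hw, map_one, mul_one]
    · change w (F.symm _) = _
      have : σ x = F (1 ⊗ₜ x) := by
        rw [hF, hf, map_one, one_mul]
      change w (F.symm (σ x)) = _
      rw [this, F.symm_apply_apply, hw, map_one, one_mul]
  · intro E _ Ψ Ψ' h1 h2
    ext y
    obtain ⟨s, rfl⟩ := hbij.2 y
    induction s with
    | zero => simp
    | tmul b x => rw [hf, map_mul, map_mul, h1]; exact congrArg _ (h2 x)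
    | add x y hx hy => rw [map_add, map_add, map_add, hx, hy]

/-- Let `T'` be flat over the dual numbers `A[ε]`, with `T' / ε T' = T` and residue field
`κ` formally smooth over the residue field `k` of `A`. Then `T' ≃ A[ε] ⊗ κ`, so `∂/∂ε` extends to
`T'`: it appears here as the second component of a ring homomorphism to `T ⊕ T`. -/
lemma exists_ringHom_trivSqZeroExt {k A T T' κ : Type} [Field k] [CommRing A] [Algebra k A]
    (e : A →ₐ[k] k) (he : IsNilpotent (RingHom.ker e)) [CommRing T] [CommRing T'] [Field κ]
    [Algebra k κ] [Algebra.FormallySmooth k κ] [Algebra A T] [Algebra (TrivSqZeroExt A A) T']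
    [Module.Flat (TrivSqZeroExt A A) T'] (ρ : T' →+* T) (hρs : Function.Surjective ρ)
    (hρ : ∀ b : TrivSqZeroExt A A, ρ (algebraMap _ T' b) = algebraMap A T b.fst)
    (hρk : ∀ y, ρ y = 0 → y ∈ (RingHom.ker (TrivSqZeroExt.fstHom A A A).toRingHom).map
      (algebraMap (TrivSqZeroExt A A) T'))
    (p : T →+* κ) (hps : Function.Surjective p)
    (hp : ∀ a, p (algebraMap A T a) = algebraMap k κ (e a))
    (hpk : ∀ x, p x = 0 → x ∈ (RingHom.ker e).map (algebraMap A T)) :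
    ∃ Ψ : T' →+* TrivSqZeroExt T T, (∀ y, (Ψ y).fst = ρ y) ∧
      ∀ b : TrivSqZeroExt A A, Ψ (algebraMap _ T' b) =
        TrivSqZeroExt.inl (algebraMap A T b.fst) + TrivSqZeroExt.inr (algebraMap A T b.snd) := by
  letI : Algebra k (TrivSqZeroExt A A) :=
    ((TrivSqZeroExt.inlHom A A).comp (algebraMap k A)).toAlgebra
  have hkB : ∀ a : k, algebraMap k (TrivSqZeroExt A A) a =
    TrivSqZeroExt.inl (algebraMap k A a) := fun _ ↦ rfl
  let fst : TrivSqZeroExt A A →+* A := (TrivSqZeroExt.fstHom A A A).toRingHom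
  have hfst : ∀ b, fst b = b.fst := fun _ ↦ rfl
  let fB : TrivSqZeroExt A A →ₐ[k] k :=
    { e.toRingHom.comp fst with commutes' := fun a ↦ e.commutes a }
  have hfB : ∀ b, fB b = e b.fst := fun _ ↦ rfl
  have hK : IsNilpotent (RingHom.ker fB) := by
    obtain ⟨n, hn⟩ := he
    have h1 : (RingHom.ker fB).map fst ≤ RingHom.ker e := by
      rw [Ideal.map_le_iff_le_comap]
      exact fun b hb ↦ hb
    have h2 : (RingHom.ker fB) ^ n ≤ RingHom.ker fst := by
      intro b hb
      have := Ideal.mem_map_of_mem fst hb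
      rw [Ideal.map_pow] at this
      have := Ideal.pow_right_mono h1 n this
      rw [hn] at this
      exact this
    obtain ⟨m, hm⟩ := isNilpotent_ker_fstHom (A := A) (M := A)
    refine ⟨n * m, ?_⟩
    have := Ideal.pow_right_mono h2 m
    rw [(pow_mul (RingHom.ker fB) n m).symm] at this
    rw [Ideal.zero_eq_bot, eq_bot_iff]
    exact this.trans (by rw [hm]; exact le_rfl)
  have hπk : ∀ y, (p.comp ρ) y = 0 →
      y ∈ (RingHom.ker fB).map (algebraMap (TrivSqZeroExt A A) T') := by
    intro y hy
    have h1 : RingHom.ker ρ ≤ (RingHom.ker fB).map (algebraMap (TrivSqZeroExt A A) T') :=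
      fun z hz ↦ Ideal.map_mono (fun b hb ↦ by
        have hb : b.fst = 0 := hb
        change fB b = 0
        rw [hfB, hb, map_zero]) (hρk z hz)
    have h2 : ρ y ∈ ((RingHom.ker fB).map (algebraMap (TrivSqZeroExt A A) T')).map ρ := by
      rw [Ideal.map_map]
      refine (Ideal.map_le_iff_le_comap.mpr fun a ha ↦ ?_ : (RingHom.ker e).map
        (algebraMap A T) ≤ _) (hpk (ρ y) hy)
      have : algebraMap A T a = (ρ.comp (algebraMap (TrivSqZeroExt A A) T'))
        (TrivSqZeroExt.inl a) := by simp [hρ]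
      rw [Ideal.mem_comap, this]
      exact Ideal.mem_map_of_mem _ ha
    obtain ⟨y', hy', hyy'⟩ := (Ideal.mem_map_iff_of_surjective ρ hρs).mp h2
    rw [← sub_add_cancel y y']
    exact Ideal.add_mem _ (h1 (by rw [RingHom.mem_ker, map_sub, hyy', sub_self])) hy'
  obtain ⟨σ, hσ, hex, huniq⟩ := exists_section_of_formallySmooth fB hK (p.comp ρ) (hps.comp hρs)
    (fun b ↦ by rw [RingHom.comp_apply, hρ, hp, hfB]) hπk
  let u : TrivSqZeroExt A A →+* TrivSqZeroExt T T :=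
    { toFun := fun b ↦ TrivSqZeroExt.inl (algebraMap A T b.fst) +
        TrivSqZeroExt.inr (algebraMap A T b.snd)
      map_one' := by ext <;> simp
      map_zero' := by ext <;> simp
      map_mul' := fun x y ↦ by
        ext
        · simp
        · simp [mul_comm]
          simp only [Algebra.smul_def]
          ring
      map_add' := fun x y ↦ by
        ext
        · simp
        · simp
          simp only [Algebra.smul_def, mul_one] }
  obtain ⟨Ψ, h1, h2⟩ := hex _ u ((TrivSqZeroExt.inlHom T T).comp (ρ.comp σ)) (fun a ↦ by
    rw [RingHom.comp_apply, RingHom.comp_apply, hσ, hρ, hkB]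
    simp [u])
  refine ⟨Ψ, fun y ↦ ?_, h1⟩
  have := huniq _ ((TrivSqZeroExt.fstHom T T T).toRingHom.comp Ψ) ρ
    (fun b ↦ by rw [RingHom.comp_apply, h1, hρ]; simp [u])
    (fun x ↦ by rw [RingHom.comp_apply, h2]; simp)
  exact RingHom.congr_fun this y

end Generic

/-! ### Products of skyscraper modules -/

section Skyscraper

variable (X : Scheme.{0}) (S : Set X) (I : ∀ x : X, ModuleCat.{0} (X.presheaf.stalk x))

/-- The sections over `U` of the product over `x ∈ S` of the skyscraper modules with stalk `I x`
at `x`. -/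
def SkyProd (U : X.Opens) : Type := ∀ x : {x : X // x ∈ U ∧ x ∈ S}, I x.1

instance (U : X.Opens) : AddCommGroup (SkyProd X S I U) :=
  inferInstanceAs (AddCommGroup (∀ x : {x : X // x ∈ U ∧ x ∈ S}, I x.1))

instance (U : X.Opens) : Module Γ(X, U) (SkyProd X S I U) where
  smul f m := fun x ↦ X.presheaf.germ U x.1 x.2.1 f • m x
  one_smul m := funext fun x ↦ by
    change X.presheaf.germ U x.1 x.2.1 1 • m x = m x
    rw [map_one, one_smul]
  mul_smul f g m := funext fun x ↦ by
    change X.presheaf.germ U x.1 x.2.1 (f * g) • m x =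
      X.presheaf.germ U x.1 x.2.1 f • X.presheaf.germ U x.1 x.2.1 g • m x
    rw [map_mul, mul_smul]
  smul_zero f := funext fun x ↦ smul_zero _
  smul_add f m m' := funext fun x ↦ smul_add _ _ _
  add_smul f g m := funext fun x ↦ by
    change X.presheaf.germ U x.1 x.2.1 (f + g) • m x =
      X.presheaf.germ U x.1 x.2.1 f • m x + X.presheaf.germ U x.1 x.2.1 g • m x
    rw [map_add, add_smul]
  zero_smul m := funext fun x ↦ by
    change X.presheaf.germ U x.1 x.2.1 0 • m x = 0
    rw [map_zero, zero_smul]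

variable {X S I} in
lemma SkyProd.smul_apply {U : X.Opens} (f : Γ(X, U)) (m : SkyProd X S I U)
    (x : {x : X // x ∈ U ∧ x ∈ S}) : (f • m) x = X.presheaf.germ U x.1 x.2.1 f • m x := rfl

/-- Restriction of sections of a product of skyscraper modules. -/
def SkyProd.restrict {U V : X.Opens} (i : V ≤ U) : SkyProd X S I U →+ SkyProd X S I V where
  toFun m := fun x ↦ m ⟨x.1, i x.2.1, x.2.2⟩
  map_zero' := rfl
  map_add' _ _ := rfl

lemma SkyProd.restrict_smul {U V : X.Opens} (i : V ≤ U) (r : Γ(X, U)) (m : SkyProd X S I U) :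
    SkyProd.restrict X S I i (r • m) =
      X.presheaf.map (homOfLE i).op r • SkyProd.restrict X S I i m := by
  funext x
  rw [SkyProd.smul_apply, X.presheaf.germ_res_apply (homOfLE i) x.1 x.2.1]
  rfl

/-- The product of skyscraper modules as a presheaf of abelian groups. -/
def skyProdAb : (X.Opens)ᵒᵖ ⥤ Ab where
  obj U := AddCommGrpCat.of (SkyProd X S I U.unop)
  map i := AddCommGrpCat.ofHom (SkyProd.restrict X S I (leOfHom i.unop))
  map_id _ := rfl
  map_comp _ _ := rfl

instance (U : (X.Opens)ᵒᵖ) : Module (X.ringCatSheaf.obj.obj U) ((skyProdAb X S I).obj U) :=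
  letI m : Module Γ(X, U.unop) (SkyProd X S I U.unop) := inferInstance
  m

/-- The product of skyscraper modules as a presheaf of modules. -/
def skyProdPresheaf : X.PresheafOfModules :=
  PresheafOfModules.ofPresheaf (skyProdAb X S I) fun _ _ i r m ↦
    SkyProd.restrict_smul X S I (leOfHom i.unop) r m

lemma skyProdAb_isSheaf : TopCat.Presheaf.IsSheaf (X := X.toTopCat) (skyProdAb X S I) := by
  refine (TopCat.Presheaf.isSheaf_iff_isSheafUniqueGluing _).mpr fun J U sf hsf ↦ ?_
  have hex : ∀ x : {x : X // x ∈ iSup U ∧ x ∈ S}, ∃ j, x.1 ∈ U j := fun x ↦ by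
    simpa using x.2.1
  choose j hj using hex
  refine ⟨fun x ↦ (show SkyProd X S I (U (j x)) from sf (j x)) ⟨x.1, hj x, x.2.2⟩, fun k ↦ ?_,
    fun s hs ↦ ?_⟩
  · funext x
    have hx : x.1 ∈ iSup U := TopologicalSpace.Opens.mem_iSup.mpr ⟨k, x.2.1⟩
    let y : {x : X // x ∈ iSup U ∧ x ∈ S} := ⟨x.1, hx, x.2.2⟩
    have := hsf (j y) k
    exact congrFun (a := (⟨x.1, ⟨hj y, x.2.1⟩, x.2.2⟩ :
      {x : X // x ∈ (U (j y) ⊓ U k : X.Opens) ∧ x ∈ S})) this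
  · funext x
    exact congrFun (hs (j x)) ⟨x.1, hj x, x.2.2⟩

/-- The product of the skyscraper modules with stalk `I x` at `x ∈ S`. -/
def skyProd : X.Modules where
  val := skyProdPresheaf X S I
  isSheaf := skyProdAb_isSheaf X S I

end Skyscraper

section Stalk

variable {X : Scheme.{0}}

instance (M : X.Modules) (x : X) : Module (X.presheaf.stalk x) (M.presheaf.stalk x) :=
  PresheafOfModules.instModuleCarrierStalkCommRingCatCarrierAbPresheafOpensCarrier
    (R := X.presheaf) M.val x

lemma germ_stalk_smul (M : X.Modules) (x : X) (U : X.Opens) (hx : x ∈ U) (r : Γ(X, U))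
    (m : Γ(M, U)) : M.presheaf.germ U x hx (r • m) =
      X.presheaf.germ U x hx r • M.presheaf.germ U x hx m :=
  PresheafOfModules.germ_smul (R := X.presheaf) M.val x U hx r m

/-- The map on stalks induced by a morphism of sheaves of modules. -/
def stalkLinearMap {M N : X.Modules} (f : M ⟶ N) (x : X) :
    M.presheaf.stalk x →ₗ[X.presheaf.stalk x] N.presheaf.stalk x where
  toFun := (TopCat.Presheaf.stalkFunctor Ab x).map f.mapPresheaf
  map_add' := map_add _
  map_smul' r m := by
    obtain ⟨U, hx, m, rfl⟩ := M.presheaf.exists_germ_eq m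
    obtain ⟨V, hx', r, rfl⟩ := X.presheaf.exists_germ_eq r
    have hW : x ∈ U ⊓ V := ⟨hx, hx'⟩
    rw [← M.presheaf.germ_res_apply (homOfLE inf_le_left) x hW,
      ← X.presheaf.germ_res_apply (homOfLE inf_le_right) x hW, ← germ_stalk_smul]
    erw [TopCat.Presheaf.stalkFunctor_map_germ_apply, TopCat.Presheaf.stalkFunctor_map_germ_apply]
    rw [Scheme.Modules.mapPresheaf_app]
    erw [Scheme.Modules.Hom.app_smul]
    exact germ_stalk_smul ..

lemma stalkLinearMap_germ {M N : X.Modules} (f : M ⟶ N) (x : X) (U : X.Opens) (hx : x ∈ U)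
    (m : Γ(M, U)) :
    stalkLinearMap f x (M.presheaf.germ U x hx m) = N.presheaf.germ U x hx (f.app U m) :=
  TopCat.Presheaf.stalkFunctor_map_germ_apply (F := M.presheaf) (G := N.presheaf) U x hx
    f.mapPresheaf m

lemma app_injective_of_mono {M N : X.Modules} (f : M ⟶ N) [Mono f] (U : X.Opens) :
    Function.Injective (f.app U) := by
  have h1 : Mono ((Scheme.Modules.toPresheaf X).map f) := inferInstance
  have h2 : Mono (((Scheme.Modules.toPresheaf X).map f).app (op U)) := inferInstance
  exact (AddCommGrpCat.mono_iff_injective _).mp h2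

lemma stalkLinearMap_injective {M N : X.Modules} (f : M ⟶ N) [Mono f] (x : X) :
    Function.Injective (stalkLinearMap f x) :=
  TopCat.Presheaf.stalkFunctor_map_injective_of_app_injective (f := f.mapPresheaf)
    (fun U ↦ app_injective_of_mono f U) x

end Stalk

section Injective

variable (X : Scheme.{0}) (S : Set X) (I : ∀ x : X, ModuleCat.{0} (X.presheaf.stalk x))

/-- The value at `x ∈ S` of the sections of a product of skyscraper modules, as a cocone. -/
def skyProdCocone (x : X) (hx : x ∈ S) : Limits.Cocone
    ((TopologicalSpace.OpenNhds.inclusion x).op ⋙ (skyProd X S I).presheaf) where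
  pt := AddCommGrpCat.of (I x)
  ι :=
    { app := fun U ↦ AddCommGrpCat.ofHom (X := SkyProd X S I U.unop.1) (AddMonoidHom.mk'
        (fun m : SkyProd X S I U.unop.1 ↦ m ⟨x, U.unop.2, hx⟩) fun _ _ ↦ rfl) }

/-- The value at `x ∈ S` of the germs of a product of skyscraper modules, as a homomorphism of
groups. -/
def skyProdEvalAux (x : X) (hx : x ∈ S) : (skyProd X S I).presheaf.stalk x →+ I x :=
  (Limits.colimit.desc _ (skyProdCocone X S I x hx)).hom

lemma skyProdEvalAux_germ (x : X) (hx : x ∈ S) (U : X.Opens) (hU : x ∈ U) (m : SkyProd X S I U) :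
    skyProdEvalAux X S I x hx ((skyProd X S I).presheaf.germ U x hU m) = m ⟨x, hU, hx⟩ :=
  ConcreteCategory.congr_hom (Limits.colimit.ι_desc (skyProdCocone X S I x hx)
    (op ⟨U, hU⟩ : (TopologicalSpace.OpenNhds x)ᵒᵖ)) m

/-- The value at `x ∈ S` of the germs of a product of skyscraper modules. -/
def skyProdEval (x : X) (hx : x ∈ S) :
    (skyProd X S I).presheaf.stalk x →ₗ[X.presheaf.stalk x] I x where
  toFun := skyProdEvalAux X S I x hx
  map_add' := map_add _
  map_smul' r m := by
    obtain ⟨U, hx1, m, rfl⟩ := (skyProd X S I).presheaf.exists_germ_eq m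
    obtain ⟨V, hx', r, rfl⟩ := X.presheaf.exists_germ_eq r
    have hW : x ∈ U ⊓ V := ⟨hx1, hx'⟩
    rw [← (skyProd X S I).presheaf.germ_res_apply (homOfLE inf_le_left) x hW,
      ← X.presheaf.germ_res_apply (homOfLE inf_le_right) x hW, ← germ_stalk_smul]
    erw [skyProdEvalAux_germ, skyProdEvalAux_germ]
    rfl

lemma skyProdEval_germ (x : X) (hx : x ∈ S) (U : X.Opens) (hU : x ∈ U) (m : SkyProd X S I U) :
    skyProdEval X S I x hx ((skyProd X S I).presheaf.germ U x hU m) = m ⟨x, hU, hx⟩ :=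
  skyProdEvalAux_germ X S I x hx U hU m

/-- A morphism to a product of skyscraper modules, from linear maps on stalks. -/
def toSkyProd (M : X.Modules) (f : ∀ x : X, M.presheaf.stalk x →ₗ[X.presheaf.stalk x] I x) :
    M ⟶ skyProd X S I where
  val := PresheafOfModules.homMk
    { app := fun U ↦ AddCommGrpCat.ofHom (Y := SkyProd X S I U.unop) (AddMonoidHom.mk'
        (fun m : Γ(M, U.unop) ↦ (fun x ↦ f x.1 (M.presheaf.germ U.unop x.1 x.2.1 m)))
        fun m m' ↦ by
          funext x
          exact (congrArg (f x.1) (map_add (M.presheaf.germ U.unop x.1 x.2.1).hom m m')).trans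
            ((f x.1).map_add _ _))
      naturality := fun U V i ↦ by
        ext m
        funext x
        exact congrArg (f x.1) (M.presheaf.germ_res_apply i.unop x.1 x.2.1 m) }
    (fun U r m ↦ by
      funext x
      exact (congrArg (f x.1) (germ_stalk_smul M x.1 U.unop x.2.1 r m)).trans
        ((f x.1).map_smul _ _))

open scoped Classical in
/-- A product of skyscraper modules with injective stalks is injective: a morphism to it is the
same as a family of linear maps on stalks. -/
lemma injective_skyProd (hI : ∀ x, Injective (I x)) : Injective (skyProd X S I) where
  factors {M N} g f _ := by
    have hex (x : X) : ∃ h : N.presheaf.stalk x →ₗ[X.presheaf.stalk x] I x,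
        ∀ (hx : x ∈ S) (m : M.presheaf.stalk x), h (stalkLinearMap f x m) =
          skyProdEval X S I x hx (stalkLinearMap g x m) := by
      by_cases hx : x ∈ S
      · have hinj := Module.injective_module_of_injective_object _ (I x) (inj := hI x)
        obtain ⟨h, hh⟩ := Module.Injective.extension_property _ _ _ _ (stalkLinearMap f x)
          (stalkLinearMap_injective f x) (skyProdEval X S I x hx ∘ₗ stalkLinearMap g x)
        exact ⟨h, fun _ m ↦ LinearMap.congr_fun hh m⟩
      · exact ⟨0, fun h ↦ absurd h hx⟩
    choose h hh using hex
    refine ⟨toSkyProd X S I N h, ?_⟩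
    ext U m
    funext x
    have := hh x.1 x.2.2 (M.presheaf.germ U x.1 x.2.1 m)
    rw [stalkLinearMap_germ, stalkLinearMap_germ] at this
    exact this.trans (skyProdEval_germ ..)

end Injective

/-! ### Sheafification and homomorphisms -/

section Sheafify

variable {X : Scheme.{0}}

/-- The sheaf of modules associated with a presheaf of modules. -/
abbrev sheafify (P : X.PresheafOfModules) : X.Modules :=
  (PresheafOfModules.sheafification (𝟙 X.ringCatSheaf.obj)).obj P

/-- The universal property of sheafification. -/
def sheafEquiv (P : X.PresheafOfModules) (N : X.Modules) :
    (sheafify P ⟶ N) ≃ (P ⟶ N.val) :=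
  PresheafOfModules.sheafificationHomEquiv (𝟙 X.ringCatSheaf.obj)

lemma toPresheaf_map_sheafEquiv {P : X.PresheafOfModules} {N : X.Modules} (f : sheafify P ⟶ N) :
    (PresheafOfModules.toPresheaf _).map (sheafEquiv P N f) =
      CategoryTheory.toSheafify (Opens.grothendieckTopology X) P.presheaf ≫
        (PresheafOfModules.toPresheaf X.ringCatSheaf.obj).map f.val :=
  PresheafOfModules.toPresheaf_map_sheafificationHomEquiv_def _ f

lemma sheafEquiv_comp {P : X.PresheafOfModules} {N N' : X.Modules} (f : sheafify P ⟶ N)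
    (g : N ⟶ N') : sheafEquiv P N' (f ≫ g) = sheafEquiv P N f ≫ g.val := by
  apply (PresheafOfModules.toPresheaf _).map_injective
  rw [Functor.map_comp, toPresheaf_map_sheafEquiv, toPresheaf_map_sheafEquiv]
  rfl

lemma sheafEquiv_add {P : X.PresheafOfModules} {N : X.Modules} (f g : sheafify P ⟶ N) :
    sheafEquiv P N (f + g) = sheafEquiv P N f + sheafEquiv P N g := by
  apply (PresheafOfModules.toPresheaf _).map_injective
  rw [Functor.map_add, toPresheaf_map_sheafEquiv, toPresheaf_map_sheafEquiv,
    toPresheaf_map_sheafEquiv]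
  exact Preadditive.comp_add _ _ _
    (CategoryTheory.toSheafify (Opens.grothendieckTopology X) P.presheaf)
    ((PresheafOfModules.toPresheaf X.ringCatSheaf.obj).map f.val)
    ((PresheafOfModules.toPresheaf X.ringCatSheaf.obj).map g.val)

end Sheafify

section MulEnd

variable {A : Type} [CommRing A] {X : Scheme.{0}} (π : X ⟶ Spec (.of A))

lemma map_structHom {U V : X.Opens} (i : V ⟶ U) (a : A) :
    X.presheaf.map i.op (structHom π U a) = structHom π V a := by
  change X.presheaf.map _ (X.presheaf.map _ _) = X.presheaf.map _ _
  rw [← ConcreteCategory.comp_apply, ← Functor.map_comp]; rfl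

/-- Multiplication by `a ∈ A` on a sheaf of modules over a scheme over `Spec A`. -/
def mulEnd (M : X.Modules) (a : A) : M ⟶ M where
  val := PresheafOfModules.homMk
    { app := fun U ↦ M.smul (structHom π U.unop a)
      naturality := fun U V i ↦ by
        have := Scheme.Modules.map_comp_smul (M := M) i.unop (structHom π U.unop a)
        rw [map_structHom] at this
        exact this.symm }
    (fun U r m ↦ (smul_comm (M := Γ(X, U.unop)) (N := Γ(X, U.unop)) (α := Γ(M, U.unop))
      (structHom π U.unop a) r m))

lemma mulEnd_app (M : X.Modules) (a : A) (U : X.Opens) (m : Γ(M, U)) :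
    (mulEnd π M a).app U m = structHom π U a • m := rfl

lemma mulEnd_naturality {M N : X.Modules} (f : M ⟶ N) (a : A) :
    mulEnd π M a ≫ f = f ≫ mulEnd π N a := by
  ext U m
  exact f.app_smul (structHom π U a) m

lemma mulHom_eq_mulEnd (a : A) : mulHom π a = mulEnd π (structureSheaf X) a := by
  apply (SheafOfModules.unitHomEquiv (SheafOfModules.unit X.ringCatSheaf)).injective
  refine (Equiv.apply_symm_apply _ _).trans (Subtype.ext (funext fun U ↦ ?_))
  exact (mul_one (structHom π U.unop a)).symm

end MulEnd

/-- A resolution `0 → 𝒪 → I → J → 0` of the structure sheaf of `X`, with `I` injective, such that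
the equations of the subscheme `D` act bijectively on `I`. -/
structure InjRes {X D : Scheme.{0}} (ι : D ⟶ X) where
  I : X.Modules
  J : X.Modules
  j : structureSheaf X ⟶ I
  q : I ⟶ J
  w : j ≫ q = 0
  shortExact : (ShortComplex.mk j q w).ShortExact
  injective : Injective I
  bijective_smul : ∀ (U : X.Opens) (g : Γ(X, U)), g ∈ localEquations ι U →
    Function.Bijective fun m : Γ(I, U) ↦ g • m

section ExtOne

open Abelian

variable {A : Type} [CommRing A] (P : FlatPair A) (R : InjRes P.ι)

/-- The connecting homomorphism `Hom(Ω, J) → Ext¹(Ω, 𝒪)`. -/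
def connecting (φ : logDifferentialsPresheaf P.π P.ι ⟶ R.J.val) : LogExt1 P :=
  letI := HasExt.standard P.X.Modules
  (Ext.mk₀ ((sheafEquiv _ R.J).symm φ)).comp R.shortExact.extClass (zero_add 1)

lemma sheafEquiv_symm_add {X : Scheme.{0}} {P : X.PresheafOfModules} {N : X.Modules}
    (φ ψ : P ⟶ N.val) : (sheafEquiv P N).symm (φ + ψ) =
      (sheafEquiv P N).symm φ + (sheafEquiv P N).symm ψ := by
  apply (sheafEquiv P N).injective
  rw [sheafEquiv_add]; simp

lemma sheafEquiv_symm_comp {X : Scheme.{0}} {P : X.PresheafOfModules} {N N' : X.Modules}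
    (φ : P ⟶ N.val) (g : N ⟶ N') : (sheafEquiv P N').symm (φ ≫ g.val) =
      (sheafEquiv P N).symm φ ≫ g := by
  apply (sheafEquiv P N').injective
  rw [sheafEquiv_comp]; simp

lemma connecting_add (φ ψ : logDifferentialsPresheaf P.π P.ι ⟶ R.J.val) :
    connecting P R (φ + ψ) = connecting P R φ + connecting P R ψ := by
  letI := HasExt.standard P.X.Modules
  unfold connecting
  rw [sheafEquiv_symm_add, Ext.mk₀_add, Ext.add_comp]
  rfl

lemma connecting_surjective : Function.Surjective (connecting P R) := by
  letI := HasExt.standard P.X.Modules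
  intro e
  have := R.injective
  obtain ⟨x, hx⟩ := Ext.covariant_sequence_exact₁ (S := ShortComplex.mk R.j R.q R.w)
    (X := logDifferentials P.π P.ι) R.shortExact e (Ext.eq_zero_of_injective _) (zero_add 1)
  obtain ⟨f, rfl⟩ := Ext.addEquiv₀.symm.surjective x
  refine ⟨sheafEquiv _ R.J f, ?_⟩
  refine Eq.trans ?_ hx
  exact congrArg (fun z ↦ (Ext.mk₀ z).comp R.shortExact.extClass (zero_add 1))
    (Equiv.symm_apply_apply (sheafEquiv _ R.J) f)

lemma connecting_eq_zero_iff (φ : logDifferentialsPresheaf P.π P.ι ⟶ R.J.val) :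
    connecting P R φ = 0 ↔ ∃ θ : logDifferentialsPresheaf P.π P.ι ⟶ R.I.val, φ = θ ≫ R.q.val := by
  letI := HasExt.standard P.X.Modules
  constructor
  · intro h
    obtain ⟨x, hx⟩ := Ext.covariant_sequence_exact₃ (S := ShortComplex.mk R.j R.q R.w)
      (X := logDifferentials P.π P.ι) R.shortExact _ (zero_add 1) h
    obtain ⟨f, rfl⟩ := Ext.addEquiv₀.symm.surjective x
    refine ⟨sheafEquiv _ R.I f, ?_⟩
    refine Eq.trans ?_ (sheafEquiv_comp f R.q)
    rw [Ext.addEquiv₀_symm_apply, Ext.mk₀_comp_mk₀] at hx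
    exact (Equiv.symm_apply_eq _).mp ((Ext.mk₀_bijective _ _).1 hx.symm)
  · rintro ⟨θ, rfl⟩
    unfold connecting
    rw [sheafEquiv_symm_comp, ← Ext.mk₀_comp_mk₀, Ext.comp_assoc_of_second_deg_zero]
    have := R.shortExact.comp_extClass
    dsimp at this
    rw [this, Ext.comp_zero]; rfl

lemma connecting_smul (a : A) (φ : logDifferentialsPresheaf P.π P.ι ⟶ R.J.val) :
    connecting P R (φ ≫ (mulEnd P.π R.J a).val) = a • connecting P R φ := by
  letI := HasExt.standard P.X.Modules
  let f : ShortComplex.mk R.j R.q R.w ⟶ ShortComplex.mk R.j R.q R.w :=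
    { τ₁ := mulEnd P.π _ a
      τ₂ := mulEnd P.π _ a
      τ₃ := mulEnd P.π _ a
      comm₁₂ := mulEnd_naturality P.π R.j a
      comm₂₃ := mulEnd_naturality P.π R.q a }
  have h := ShortComplex.ShortExact.extClass_naturality R.shortExact R.shortExact f
  change _ = ((Ext.mk₀ ((sheafEquiv _ R.J).symm φ)).comp R.shortExact.extClass (zero_add 1)).comp
    (Ext.mk₀ (mulHom P.π a)) (add_zero 1)
  unfold connecting
  rw [sheafEquiv_symm_comp, ← Ext.mk₀_comp_mk₀, mulHom_eq_mulEnd, Ext.comp_assoc_of_third_deg_zero,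
    Ext.comp_assoc_of_second_deg_zero]
  exact congrArg (fun z ↦ (Ext.mk₀ ((sheafEquiv _ R.J).symm φ)).comp z (zero_add 1)) h.symm

end ExtOne

/-! ### Sections of sheaves of modules -/

section Sections

variable {X : Scheme.{0}}

/-- The restriction of functions from `U` to `V ≤ U`. -/
def resO {U V : X.Opens} (h : V ≤ U) : Γ(X, U) →+* Γ(X, V) := (X.presheaf.map (homOfLE h).op).hom

/-- The restriction of sections of a sheaf of modules from `U` to `V ≤ U`. -/
def resM (M : X.Modules) {U V : X.Opens} (h : V ≤ U) : Γ(M, U) →+ Γ(M, V) :=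
  (M.presheaf.map (homOfLE h).op).hom

lemma resO_resO {U V W : X.Opens} (h : V ≤ U) (h' : W ≤ V) (f : Γ(X, U)) :
    resO h' (resO h f) = resO (h'.trans h) f := by
  change X.presheaf.map _ (X.presheaf.map _ _) = X.presheaf.map _ _
  rw [← ConcreteCategory.comp_apply, ← Functor.map_comp]; rfl

lemma resO_self {U : X.Opens} (h : U ≤ U) (f : Γ(X, U)) : resO h f = f := by
  change X.presheaf.map (𝟙 _) f = f
  rw [CategoryTheory.Functor.map_id]; rfl

lemma resM_resM (M : X.Modules) {U V W : X.Opens} (h : V ≤ U) (h' : W ≤ V) (m : Γ(M, U)) :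
    resM M h' (resM M h m) = resM M (h'.trans h) m := by
  change M.presheaf.map _ (M.presheaf.map _ _) = M.presheaf.map _ _
  rw [← ConcreteCategory.comp_apply, ← Functor.map_comp]; rfl

lemma resM_self (M : X.Modules) {U : X.Opens} (h : U ≤ U) (m : Γ(M, U)) : resM M h m = m := by
  change M.presheaf.map (𝟙 _) m = m
  rw [CategoryTheory.Functor.map_id]; rfl

lemma resM_smul (M : X.Modules) {U V : X.Opens} (h : V ≤ U) (f : Γ(X, U)) (m : Γ(M, U)) :
    resM M h (f • m) = resO h f • resM M h m :=
  M.map_smul (homOfLE h) f m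

lemma app_resM {M N : X.Modules} (φ : M ⟶ N) {U V : X.Opens} (h : V ≤ U) (m : Γ(M, U)) :
    φ.app V (resM M h m) = resM N h (φ.app U m) :=
  ConcreteCategory.congr_hom (φ.mapPresheaf.naturality (homOfLE h).op) m

lemma germ_resM (M : X.Modules) {U V : X.Opens} (h : V ≤ U) (x : X) (hx : x ∈ V) (m : Γ(M, U)) :
    M.presheaf.germ V x hx (resM M h m) = M.presheaf.germ U x (h hx) m :=
  M.presheaf.germ_res_apply (homOfLE h) x hx m

lemma resM_eq_of_germ_eq (M : X.Modules) {U : X.Opens} (x : X) (hx : x ∈ U) (m m' : Γ(M, U))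
    (h : M.presheaf.germ U x hx m = M.presheaf.germ U x hx m') :
    ∃ (V : X.Opens) (hV : V ≤ U), x ∈ V ∧ resM M hV m = resM M hV m' := by
  obtain ⟨W, hxW, i, i', e⟩ := M.presheaf.germ_eq x hx hx m m' h
  exact ⟨W, leOfHom i, hxW, e⟩

/-- Sections that agree locally are equal. -/
lemma section_ext (M : X.Modules) {U : X.Opens} (m m' : Γ(M, U))
    (h : ∀ x ∈ U, ∃ (V : X.Opens) (hV : V ≤ U), x ∈ V ∧ resM M hV m = resM M hV m') : m = m' := by
  refine TopCat.Presheaf.section_ext ⟨M.presheaf, M.isSheaf⟩ U m m' fun x hx ↦ ?_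
  obtain ⟨V, hV, hxV, e⟩ := h x hx
  have := congrArg (M.presheaf.germ V x hxV) e
  rwa [germ_resM, germ_resM] at this

/-- An epimorphism of sheaves of modules is surjective on stalks: its cokernel on stalks at all
points would otherwise define a morphism to a product of skyscraper modules. -/
lemma stalkLinearMap_surjective {M N : X.Modules} (f : M ⟶ N) [Epi f] (x : X) :
    Function.Surjective (stalkLinearMap f x) := by
  let C : ∀ x : X, ModuleCat.{0} (X.presheaf.stalk x) := fun x ↦
    ModuleCat.of _ (N.presheaf.stalk x ⧸ LinearMap.range (stalkLinearMap f x))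
  let t : N ⟶ skyProd X Set.univ C := toSkyProd X Set.univ C N
    fun x ↦ (LinearMap.range (stalkLinearMap f x)).mkQ
  have ht : t = 0 := by
    rw [← cancel_epi f, Limits.comp_zero]
    ext U m
    funext x
    have e : stalkLinearMap f x.1 (M.presheaf.germ U x.1 x.2.1 m) ∈
        LinearMap.range (stalkLinearMap f x.1) := ⟨_, rfl⟩
    rw [stalkLinearMap_germ] at e
    exact (Submodule.Quotient.mk_eq_zero _).mpr e
  intro n
  obtain ⟨U, hx, n, rfl⟩ := N.presheaf.exists_germ_eq n
  have h1 : (t.app U n : SkyProd X Set.univ C U) ⟨x, hx, trivial⟩ = 0 := by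
    rw [ht]; rfl
  exact (Submodule.Quotient.mk_eq_zero _).mp h1

/-- Sections lift locally along an epimorphism of sheaves of modules. -/
lemma exists_local_lift {M N : X.Modules} (f : M ⟶ N) [Epi f] {U : X.Opens} (n : Γ(N, U))
    (x : X) (hx : x ∈ U) :
    ∃ (V : X.Opens) (hV : V ≤ U) (m : Γ(M, V)), x ∈ V ∧ f.app V m = resM N hV n := by
  obtain ⟨m, hm⟩ := stalkLinearMap_surjective f x (N.presheaf.germ U x hx n)
  obtain ⟨V, hV, hxV, m, rfl⟩ := M.presheaf.exists_le_germ_eq m hx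
  rw [stalkLinearMap_germ, ← germ_resM N hV x hxV] at hm
  obtain ⟨W, hW, hxW, e⟩ := resM_eq_of_germ_eq N x hxV _ _ hm
  exact ⟨W, hW.trans hV, resM M hW m, hxW, by rw [app_resM, e, resM_resM]⟩

lemma exact_app {S : ShortComplex X.Modules} (hS : S.ShortExact) (U : X.Opens)
    (m : Γ(S.X₂, U)) (hm : S.g.app U m = 0) : ∃ n : Γ(S.X₁, U), S.f.app U n = m := by
  have := hS.mono_f
  let E : TopCat.Presheaf Ab X ⥤ Ab := (evaluation (X.Opens)ᵒᵖ Ab).obj (op U)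
  have h1 : Limits.PreservesLimits E := inferInstanceAs
    (Limits.PreservesLimits ((evaluation (X.Opens)ᵒᵖ Ab).obj (op U)))
  let F : X.Modules ⥤ Ab := Scheme.Modules.toPresheaf X ⋙ E
  have h2 : Limits.PreservesLimits F := Limits.comp_preservesLimits _ _
  have h3 : Limits.PreservesFiniteLimits F := Limits.PreservesLimits.preservesFiniteLimits F
  have h4 : F.PreservesZeroMorphisms := ⟨fun _ _ ↦ rfl⟩
  have h := hS.exact.map_of_mono_of_preservesKernel F inferInstance inferInstance
  rw [ShortComplex.ab_exact_iff] at h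
  exact h m hm

end Sections

namespace InjRes

variable {X D : Scheme.{0}} {ι : D ⟶ X} (R : InjRes ι) {U V : X.Opens}

/-- The inclusion `𝒪 → I` on sections. -/
def jO (U : X.Opens) : Γ(X, U) →ₗ[Γ(X, U)] Γ(R.I, U) where
  toFun := R.j.app U
  map_add' := map_add (R.j.app U).hom
  map_smul' f g := R.j.app_smul f g

/-- The projection `I → J` on sections. -/
def qI (U : X.Opens) : Γ(R.I, U) →ₗ[Γ(X, U)] Γ(R.J, U) where
  toFun := R.q.app U
  map_add' := map_add (R.q.app U).hom
  map_smul' f g := R.q.app_smul f g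

lemma jO_injective (U : X.Opens) : Function.Injective (R.jO U) :=
  have : Mono R.j := R.shortExact.mono_f
  app_injective_of_mono R.j U

lemma jO_res (h : V ≤ U) (f : Γ(X, U)) : R.jO V (resO h f) = resM R.I h (R.jO U f) :=
  app_resM R.j h f

lemma qI_res (h : V ≤ U) (m : Γ(R.I, U)) : R.qI V (resM R.I h m) = resM R.J h (R.qI U m) :=
  app_resM R.q h m

lemma qI_jO (f : Γ(X, U)) : R.qI U (R.jO U f) = 0 :=
  ConcreteCategory.congr_hom (congrArg (fun t ↦ Scheme.Modules.Hom.app t U) R.w) f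

lemma exists_jO_eq (m : Γ(R.I, U)) (hm : R.qI U m = 0) : ∃ f, R.jO U f = m :=
  exact_app R.shortExact U m hm

lemma exists_local_qI_eq (s : Γ(R.J, U)) (x : X) (hx : x ∈ U) :
    ∃ (V : X.Opens) (hV : V ≤ U) (m : Γ(R.I, V)), x ∈ V ∧ R.qI V m = resM R.J hV s :=
  have : Epi R.q := R.shortExact.epi_g
  exists_local_lift R.q s x hx

end InjRes

/-! ### Infinitesimal thickenings -/

section Thickening

lemma surjective_and_ker_of_isPushout {B A S R : CommRingCat} {α : B ⟶ A} {s : B ⟶ S}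
    {r : A ⟶ R} {t : S ⟶ R} (h : IsPushout s α t r) (hα : Function.Surjective α) :
    Function.Surjective t ∧ RingHom.ker t.hom = (RingHom.ker α.hom).map s.hom := by
  let I := (RingHom.ker α.hom).map s.hom
  let mk : S ⟶ CommRingCat.of (S ⧸ I) := CommRingCat.ofHom (Ideal.Quotient.mk I)
  let g : S →+* S ⧸ I := Ideal.Quotient.mk I
  have hg : RingHom.ker α.hom ≤ RingHom.ker (g.comp s.hom) := fun b hb ↦ by
    rw [RingHom.mem_ker, RingHom.comp_apply]
    exact Ideal.Quotient.eq_zero_iff_mem.mpr (Ideal.mem_map_of_mem _ hb)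
  let l : A ⟶ CommRingCat.of (S ⧸ I) := CommRingCat.ofHom
    (RingHom.liftOfSurjective α.hom hα ⟨g.comp s.hom, hg⟩)
  have hl : s ≫ mk = α ≫ l := by
    ext b
    exact (RingHom.liftOfRightInverse_comp_apply α.hom _ (Function.rightInverse_surjInv hα)
      ⟨g.comp s.hom, hg⟩ b).symm
  let φ : R ⟶ CommRingCat.of (S ⧸ I) := h.desc mk l hl
  have hφ : t ≫ φ = mk := h.inl_desc _ _ _
  have hφ' : r ≫ φ = l := h.inr_desc _ _ _
  have hI : I ≤ RingHom.ker t.hom := by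
    rw [Ideal.map_le_iff_le_comap]
    intro b hb
    have hb : α b = 0 := hb
    have := ConcreteCategory.congr_hom h.w b
    rw [ConcreteCategory.comp_apply, ConcreteCategory.comp_apply, hb, map_zero] at this
    exact this
  let ψ : CommRingCat.of (S ⧸ I) ⟶ R := CommRingCat.ofHom (Ideal.Quotient.lift I t.hom hI)
  have hψ : mk ≫ ψ = t := by
    ext x; rfl
  have hφψ : φ ≫ ψ = 𝟙 R := by
    apply h.hom_ext
    · rw [← Category.assoc, hφ, hψ, Category.comp_id]
    · rw [← Category.assoc, hφ', Category.comp_id]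
      ext a
      obtain ⟨b, rfl⟩ := hα a
      have h1 := ConcreteCategory.congr_hom hl b
      have h2 := ConcreteCategory.congr_hom h.w b
      rw [ConcreteCategory.comp_apply, ConcreteCategory.comp_apply] at h1 h2
      change ψ (l (α b)) = r (α b)
      rw [← h1, ← h2]
      rfl
  refine ⟨fun x ↦ ?_, le_antisymm (fun x hx ↦ ?_) hI⟩
  · obtain ⟨y, hy⟩ := Ideal.Quotient.mk_surjective (φ x)
    refine ⟨y, ?_⟩
    have h1 := ConcreteCategory.congr_hom hφψ x
    rw [ConcreteCategory.comp_apply, ← hy] at h1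
    exact h1
  · have h1 := ConcreteCategory.congr_hom hφ x
    have hx : t x = 0 := hx
    rw [ConcreteCategory.comp_apply, hx, map_zero] at h1
    exact Ideal.Quotient.eq_zero_iff_mem.mp h1.symm

variable {A B : Type} [CommRing A] [CommRing B] {α : B →+* A} {X Z : Scheme.{0}} {i : X ⟶ Z}
  {πX : X ⟶ Spec (.of A)} {πZ : Z ⟶ Spec (.of B)}

lemma structHom_eq_appLE (πX : X ⟶ Spec (.of A)) (U : X.Opens) (hU : U ≤ πX ⁻¹ᵁ ⊤) :
    CommRingCat.ofHom (structHom πX U) =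
      (Scheme.ΓSpecIso (.of A)).inv ≫ πX.appLE ⊤ U hU := by
  rfl

lemma isPushout_sections (h : IsPullback i πX πZ (Spec.map (CommRingCat.ofHom α))) {V : Z.Opens}
    (hV : IsAffineOpen V) :
    IsPushout (CommRingCat.ofHom (structHom πZ V)) (CommRingCat.ofHom α) (i.app V)
      (CommRingCat.ofHom (structHom πX (i ⁻¹ᵁ V))) := by
  have hT : (⊤ : (Spec (.of A)).Opens) ≤ Spec.map (CommRingCat.ofHom α) ⁻¹ᵁ ⊤ := le_top
  have hV' : V ≤ πZ ⁻¹ᵁ ⊤ := le_top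
  have hU : i ⁻¹ᵁ V = i ⁻¹ᵁ V ⊓ πX ⁻¹ᵁ ⊤ := by simp
  have h1 := (isIso_pushoutSection_iff h hT hV' hU).mp
    (isIso_pushoutSection_of_isAffineOpen h hT hV' hU (isAffineOpen_top _) (isAffineOpen_top _) hV)
  refine h1.of_iso (Scheme.ΓSpecIso (.of B)) (Iso.refl _) (Scheme.ΓSpecIso (.of A)) (Iso.refl _)
    ?_ ?_ ?_ ?_
  · rw [structHom_eq_appLE πZ V hV']; simp
  · exact Scheme.ΓSpecIso_naturality (CommRingCat.ofHom α)
  · rw [Scheme.Hom.app_eq_appLE]; simp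
  · rw [structHom_eq_appLE πX (i ⁻¹ᵁ V) le_top]; simp

variable (h : IsPullback i πX πZ (Spec.map (CommRingCat.ofHom α)))
  (hα : Function.Surjective α) (hK : IsNilpotent (RingHom.ker α))

lemma app_structHom (h : i ≫ πZ = πX ≫ Spec.map (CommRingCat.ofHom α)) (V : Z.Opens) (b : B) :
    i.app V (structHom πZ V b) = structHom πX (i ⁻¹ᵁ V) (α b) := by
  have : CommRingCat.ofHom (structHom πZ V) ≫ i.app V =
      CommRingCat.ofHom α ≫ CommRingCat.ofHom (structHom πX (i ⁻¹ᵁ V)) := by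
    have e1 : V ≤ πZ ⁻¹ᵁ ⊤ := le_top
    have e2 : i ⁻¹ᵁ V ≤ πX ⁻¹ᵁ ⊤ := le_top
    have e3 : (⊤ : (Spec (.of A)).Opens) ≤ Spec.map (CommRingCat.ofHom α) ⁻¹ᵁ ⊤ := le_top
    rw [structHom_eq_appLE πZ V e1, structHom_eq_appLE πX _ e2, Scheme.Hom.app_eq_appLE,
      Category.assoc, Scheme.Hom.appLE_comp_appLE, Scheme.ΓSpecIso_inv_naturality_assoc]
    have h1 := Scheme.Hom.appLE_comp_appLE πX (Spec.map (CommRingCat.ofHom α)) ⊤ ⊤ (i ⁻¹ᵁ V)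
      e3 e2
    rw [Scheme.Hom.appTop, Scheme.Hom.app_eq_appLE]
    refine congrArg _ (Eq.trans ?_ h1.symm)
    congr 1
  exact ConcreteCategory.congr_hom this b

include h hα in
lemma app_surjective_of_isPullback {V : Z.Opens} (hV : IsAffineOpen V) :
    Function.Surjective (i.app V) :=
  (surjective_and_ker_of_isPushout (isPushout_sections h hV) hα).1

include h hα in
lemma ker_app_of_isPullback {V : Z.Opens} (hV : IsAffineOpen V) :
    RingHom.ker (i.app V).hom = (RingHom.ker α).map (structHom πZ V) :=
  (surjective_and_ker_of_isPushout (isPushout_sections h hV) hα).2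

include h hα in
lemma isClosedImmersion_of_isPullback : IsClosedImmersion i :=
  MorphismProperty.of_isPullback h.flip
    (IsClosedImmersion.spec_of_surjective _ hα)

include h hα hK in
lemma surjective_of_isPullback : Surjective i := by
  have : Surjective (Spec.map (CommRingCat.ofHom α)) := by
    refine ⟨(PrimeSpectrum.isHomeomorph_comap α (fun x ↦ ?_) (fun b hb ↦ ?_)).surjective⟩
    · obtain ⟨b, rfl⟩ := hα x
      exact ⟨1, one_pos, b, by simp⟩
    · obtain ⟨n, hn⟩ := hK
      exact ⟨n, by simpa [hn] using Ideal.pow_mem_pow hb n⟩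
  exact MorphismProperty.of_isPullback h.flip this

lemma flat_structHom [Flat πZ] {V : Z.Opens} (hV : IsAffineOpen V) :
    (structHom πZ V).Flat := by
  have h1 := HasRingHomProperty.appLE (P := @Flat) πZ inferInstance ⟨⊤, isAffineOpen_top _⟩ ⟨V, hV⟩
    le_top
  have h2 : (Scheme.ΓSpecIso (.of B)).inv.hom.Flat :=
    RingHom.Flat.of_bijective (ConcreteCategory.bijective_of_isIso (Scheme.ΓSpecIso (.of B)).inv)
  exact RingHom.Flat.comp (f := (Scheme.ΓSpecIso (.of B)).inv.hom)
    (g := (πZ.appLE ⊤ V le_top).hom) h2 h1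

include h hα hK in
lemma isHomeomorph_of_isPullback : IsHomeomorph i := by
  have := isClosedImmersion_of_isPullback h hα
  have := surjective_of_isPullback h hα hK
  exact isHomeomorph_iff_isEmbedding_surjective.mpr
    ⟨i.isClosedEmbedding.isEmbedding, i.surjective⟩

include h hα hK in
lemma exists_preimage_eq (U : X.Opens) : ∃ V : Z.Opens, i ⁻¹ᵁ V = U := by
  have hi := isHomeomorph_of_isPullback h hα hK
  refine ⟨⟨i '' U, hi.isOpenMap _ U.2⟩, ?_⟩
  ext x
  exact hi.injective.mem_set_image

include h hα hK in
lemma le_of_preimage_le {V V' : Z.Opens} (hV : i ⁻¹ᵁ V ≤ i ⁻¹ᵁ V') : V ≤ V' := by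
  intro z hz
  have := surjective_of_isPullback h hα hK
  obtain ⟨x, rfl⟩ := i.surjective z
  exact hV hz

include h hα hK in
/-- The preimages of the affine opens of a thickening form a basis. -/
lemma exists_isAffineOpen_preimage {U : X.Opens} {x : X} (hx : x ∈ U) :
    ∃ V : Z.Opens, IsAffineOpen V ∧ x ∈ i ⁻¹ᵁ V ∧ i ⁻¹ᵁ V ≤ U := by
  obtain ⟨V, rfl⟩ := exists_preimage_eq h hα hK U
  obtain ⟨_, ⟨W, hW, rfl⟩, hxW, hWV⟩ :=
    Z.isBasis_affineOpens.exists_subset_of_mem_open (show i x ∈ V from hx) V.2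
  exact ⟨W, hW, hxW, fun y hy ↦ hWV hy⟩

include h hα in
lemma isAffineOpen_preimage_of_isPullback {V : Z.Opens} (hV : IsAffineOpen V) :
    IsAffineOpen (i ⁻¹ᵁ V) :=
  have := isClosedImmersion_of_isPullback h hα
  hV.preimage i

lemma structHom_comp {E : Scheme.{0}} (ιE : E ⟶ Z) (V : Z.Opens) (b : B) :
    structHom (ιE ≫ πZ) (ιE ⁻¹ᵁ V) b = ιE.app V (structHom πZ V b) := by
  have := app_structHom (α := RingHom.id B) (i := ιE) (πX := ιE ≫ πZ) (πZ := πZ) (by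
    change _ = _ ≫ Spec.map (𝟙 _)
    rw [Spec.map_id, Category.comp_id]) V b
  exact this.symm

lemma app_eq_zero_congr {f g : X ⟶ Z} (e : f = g) {V : Z.Opens} (s : Γ(Z, V)) :
    f.app V s = 0 ↔ g.app V s = 0 := by
  subst e; rfl

section Divisor

variable {D E : Scheme.{0}} {ιD : D ⟶ X} {ιE : E ⟶ Z} {iD : D ⟶ E}
  (h' : IsPullback iD ιD ιE i)

include h' in
lemma app_app_eq_zero_iff {V : Z.Opens} (s : Γ(Z, V)) :
    iD.app _ (ιE.app V s) = 0 ↔ ιD.app _ (i.app V s) = 0 := by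
  have := app_eq_zero_congr h'.w s
  rwa [Scheme.Hom.comp_app, Scheme.Hom.comp_app] at this

include h h' hα in
/-- Equations of a subscheme lift to a flat thickening. -/
lemma exists_equation_lift [IsClosedImmersion ιE] {V : Z.Opens} (hV : IsAffineOpen V)
    (g : Γ(X, i ⁻¹ᵁ V)) (hg : ιD.app _ g = 0) :
    ∃ g' : Γ(Z, V), ιE.app V g' = 0 ∧ i.app V g' = g := by
  obtain ⟨s, rfl⟩ := app_surjective_of_isPullback h hα hV g
  have h1 : ιE.app V s ∈ RingHom.ker (iD.app (ιE ⁻¹ᵁ V)).hom :=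
    (app_app_eq_zero_iff h' s).mpr hg
  rw [ker_app_of_isPullback (h'.paste_vert h) hα (hV.preimage ιE)] at h1
  have e : structHom (ιE ≫ πZ) (ιE ⁻¹ᵁ V) = (ιE.app V).hom.comp (structHom πZ V) :=
    RingHom.ext fun b ↦ structHom_comp ιE V b
  rw [e, ← Ideal.map_map, Ideal.mem_map_iff_of_surjective _ (ιE.app_surjective V hV),
    ← ker_app_of_isPullback h hα hV] at h1
  obtain ⟨k, hk, hks⟩ := h1
  refine ⟨s - k, ?_, ?_⟩
  · rw [map_sub]
    exact sub_eq_zero.mpr hks.symm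
  · have hk : i.app V k = 0 := hk
    rw [map_sub, hk, sub_zero]

include h h' hα hK in
/-- A lift of a generator of the ideal of a subscheme generates the ideal of its flat
thickening. -/
lemma ker_app_eq_span [IsClosedImmersion ιE] [Flat (ιE ≫ πZ)] {V : Z.Opens} (hV : IsAffineOpen V)
    {g : Γ(Z, V)} (hg : ιE.app V g = 0)
    (hgen : ∀ s, ιD.app _ s = 0 → s ∈ Ideal.span {i.app V g}) :
    RingHom.ker (ιE.app V).hom = Ideal.span {g} := by
  letI : Algebra B Γ(Z, V) := (structHom πZ V).toAlgebra
  letI : Algebra B Γ(E, ιE ⁻¹ᵁ V) := (structHom (ιE ≫ πZ) (ιE ⁻¹ᵁ V)).toAlgebra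
  let f : Γ(Z, V) →ₐ[B] Γ(E, ιE ⁻¹ᵁ V) :=
    { (ιE.app V).hom with commutes' := fun b ↦ (structHom_comp ιE V b).symm }
  have : Module.Flat B Γ(E, ιE ⁻¹ᵁ V) := flat_structHom (πZ := ιE ≫ πZ) (hV.preimage ιE)
  refine ker_eq_span_of_flat hK f (ιE.app_surjective V hV) (i.app V).hom (fun s hs ↦ ?_) hg
    (fun s hs ↦ hgen _ ((app_app_eq_zero_iff h' s).mp ?_)) (app_surjective_of_isPullback h hα hV)
  · have hs : s ∈ RingHom.ker (i.app V).hom := hs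
    rw [ker_app_of_isPullback h hα hV] at hs
    rw [Ideal.smul_top_eq_map]
    exact hs
  · have hs : ιE.app V s = 0 := hs
    rw [hs, map_zero]

include h hα hK in
lemma mem_nonZeroDivisors_of_app [IsClosedImmersion ιE] [Flat πZ] [Flat (ιE ≫ πZ)]
    [IsLocalRing B] (hB : IsNilpotent (IsLocalRing.maximalIdeal B)) {V : Z.Opens}
    (hV : IsAffineOpen V) {g : Γ(Z, V)} (hg : RingHom.ker (ιE.app V).hom = Ideal.span {g})
    (hnz : i.app V g ∈ nonZeroDivisors Γ(X, i ⁻¹ᵁ V)) : g ∈ nonZeroDivisors Γ(Z, V) := by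
  letI : Algebra B Γ(Z, V) := (structHom πZ V).toAlgebra
  letI : Algebra B Γ(E, ιE ⁻¹ᵁ V) := (structHom (ιE ≫ πZ) (ιE ⁻¹ᵁ V)).toAlgebra
  let f : Γ(Z, V) →ₐ[B] Γ(E, ιE ⁻¹ᵁ V) :=
    { (ιE.app V).hom with commutes' := fun b ↦ (structHom_comp ιE V b).symm }
  have : Module.Flat B Γ(Z, V) := flat_structHom (πZ := πZ) hV
  have : Module.Flat B Γ(E, ιE ⁻¹ᵁ V) := flat_structHom (πZ := ιE ≫ πZ) (hV.preimage ιE)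
  have : Module.Free B Γ(E, ιE ⁻¹ᵁ V) := free_of_flat_of_isNilpotent_maximalIdeal hB _
  refine mem_nonZeroDivisors_of_flat hK f (ιE.app_surjective V hV) (i.app V).hom (fun s hs ↦ ?_)
    hg hnz
  have hs : s ∈ RingHom.ker (i.app V).hom := hs
  rw [ker_app_of_isPullback h hα hV] at hs
  rw [Ideal.smul_top_eq_map]
  exact hs

include h h' hα hK in
/-- An effective divisor stays one in a flat thickening. -/
lemma isEffectiveCartier_of_thickening [IsClosedImmersion ιE] [Flat πZ] [Flat (ιE ≫ πZ)]
    [IsLocalRing B] (hB : IsNilpotent (IsLocalRing.maximalIdeal B))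
    (hD : IsEffectiveCartier ιD) : IsEffectiveCartier ιE := by
  intro z
  have := surjective_of_isPullback h hα hK
  obtain ⟨x, rfl⟩ := i.surjective z
  obtain ⟨U, hx, g, hg⟩ := hD x
  obtain ⟨V, hV, hxV, hVU⟩ := exists_isAffineOpen_preimage h hα hK hx
  have hg1 := hg _ hVU (isAffineOpen_preimage_of_isPullback h hα hV)
  obtain ⟨g', hg', hgg'⟩ := exists_equation_lift h hα h' hV (X.presheaf.map (homOfLE hVU).op g) (by
    rw [← RingHom.mem_ker, hg1.1]
    exact Ideal.mem_span_singleton_self _)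
  refine ⟨V, hxV, g', fun W hWV hW ↦ ?_⟩
  have hg2 := hg (i ⁻¹ᵁ W) (le_trans (fun y hy ↦ hWV hy) hVU)
    (isAffineOpen_preimage_of_isPullback h hα hW)
  have e : i.app W (Z.presheaf.map (homOfLE hWV).op g') =
      X.presheaf.map (homOfLE (le_trans (fun y hy ↦ hWV hy) hVU : i ⁻¹ᵁ W ≤ U)).op g := by
    have h1 := ConcreteCategory.congr_hom (i.naturality (homOfLE hWV).op) g'
    rw [ConcreteCategory.comp_apply, ConcreteCategory.comp_apply, hgg'] at h1
    refine h1.trans ?_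
    rw [← ConcreteCategory.comp_apply, ← Functor.map_comp]
    rfl
  have e' : ιE.app W (Z.presheaf.map (homOfLE hWV).op g') = 0 := by
    have h1 := ConcreteCategory.congr_hom (ιE.naturality (homOfLE hWV).op) g'
    rw [ConcreteCategory.comp_apply, ConcreteCategory.comp_apply, hg', map_zero] at h1
    exact h1
  have h1 := ker_app_eq_span h hα hK h' hW e' (fun s hs ↦ by
    rw [e, ← hg2.1]; exact hs)
  exact ⟨h1, mem_nonZeroDivisors_of_app h hα hK hB hW h1 (by rw [e]; exact hg2.2)⟩

end Divisor

end Thickening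

/-! ### Morphisms from the presheaf of logarithmic differentials -/

section LogHom

variable {A : Type} [CommRing A] {X D : Scheme.{0}} {π : X ⟶ Spec (.of A)} {ι : D ⟶ X}
  {N N' : X.Modules}

/-- The value of a morphism `φ` from logarithmic differentials at a section of the presheaf. -/
def logApp (φ : logDifferentialsPresheaf π ι ⟶ N.val) (U : X.Opens) :
    LogSections π ι U →ₗ[Γ(X, U)] Γ(N, U) where
  toFun := φ.app (op U)
  map_add' := (φ.app (op U)).hom.map_add
  map_smul' r x := (φ.app (op U)).hom.map_smul r x

/-- The derivation `f ↦ φ(d f)` of a morphism `φ` from logarithmic differentials. -/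
def dHom (φ : logDifferentialsPresheaf π ι ⟶ N.val) (U : X.Opens) : Γ(X, U) →+ Γ(N, U) :=
  letI := sectionsAlgebra π U
  (logApp φ U).toAddMonoidHom.comp (LogKaehler.d A Γ(X, U) (localEquations ι U)).toLinearMap

/-- The logarithmic derivation `g ↦ φ(dlog g)` of a morphism `φ` from logarithmic
differentials. -/
def dlogHom (φ : logDifferentialsPresheaf π ι ⟶ N.val) (U : X.Opens) (g : localEquations ι U) :
    Γ(N, U) :=
  letI := sectionsAlgebra π U
  logApp φ U (LogKaehler.dlog A Γ(X, U) (localEquations ι U) g)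

variable (φ ψ : logDifferentialsPresheaf π ι ⟶ N.val) {U V : X.Opens}

lemma dHom_mul (f g : Γ(X, U)) : dHom φ U (f * g) = f • dHom φ U g + g • dHom φ U f := by
  letI := sectionsAlgebra π U
  change logApp φ U (LogKaehler.d A _ _ (f * g)) = f • logApp φ U (LogKaehler.d A _ _ g) +
    g • logApp φ U (LogKaehler.d A _ _ f)
  rw [Derivation.leibniz, map_add, map_smul, map_smul]

lemma dHom_structHom (a : A) : dHom φ U (structHom π U a) = 0 := by
  letI := sectionsAlgebra π U
  change logApp φ U (LogKaehler.d A _ _ (algebraMap A _ a)) = 0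
  rw [Derivation.map_algebraMap, map_zero]

lemma dHom_one : dHom φ U 1 = 0 := by
  have := dHom_structHom φ (U := U) 1
  rwa [map_one] at this

lemma smul_dlogHom (g : localEquations ι U) : g.1 • dlogHom φ U g = dHom φ U g.1 := by
  letI := sectionsAlgebra π U
  change g.1 • logApp φ U _ = logApp φ U _
  rw [← map_smul, LogKaehler.smul_dlog]
  rfl

lemma dlogHom_of_eq_mul (f g : localEquations ι U) (u : Γ(X, U)ˣ) (h : g.1 = u * f.1) :
    dlogHom φ U g = dlogHom φ U f + (↑u⁻¹ : Γ(X, U)) • dHom φ U u := by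
  letI := sectionsAlgebra π U
  change logApp φ U _ = logApp φ U _ + _ • logApp φ U _
  rw [← map_smul, ← map_add, LogKaehler.dlog_of_eq_mul f g u h]
  rfl

lemma logApp_restrict (h : V ≤ U) (x : LogSections π ι U) :
    logApp φ V (LogSections.restrict π ι h x) = resM N h (logApp φ U x) :=
  ConcreteCategory.congr_hom (φ.naturality (homOfLE h).op) x

lemma dHom_res (h : V ≤ U) (f : Γ(X, U)) : dHom φ V (resO h f) = resM N h (dHom φ U f) := by
  refine Eq.trans (congrArg (logApp φ V) ?_) (logApp_restrict φ h _)
  exact (@LogKaehler.map_d A Γ(X, U) _ _ (sectionsAlgebra π U) (localEquations ι U) Γ(X, V) _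
    (sectionsAlgebra π V) (localEquations ι V) (restrictAlgHom π h)
      (fun _ hf ↦ map_mem_localEquations ι h hf) f).symm

lemma resO_mem_localEquations (h : V ≤ U) {g : Γ(X, U)} (hg : g ∈ localEquations ι U) :
    resO h g ∈ localEquations ι V := map_mem_localEquations ι h hg

lemma dlogHom_res (h : V ≤ U) (g : localEquations ι U) :
    dlogHom φ V ⟨resO h g.1, resO_mem_localEquations h g.2⟩ = resM N h (dlogHom φ U g) := by
  refine Eq.trans (congrArg (logApp φ V) ?_) (logApp_restrict φ h _)
  exact (@LogKaehler.map_dlog A Γ(X, U) _ _ (sectionsAlgebra π U) (localEquations ι U) Γ(X, V) _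
    (sectionsAlgebra π V) (localEquations ι V) (restrictAlgHom π h)
      (fun _ hf ↦ map_mem_localEquations ι h hf) g).symm

lemma dHom_add (f : Γ(X, U)) : dHom (φ + ψ) U f = dHom φ U f + dHom ψ U f := rfl
lemma dlogHom_add (g : localEquations ι U) :
    dlogHom (φ + ψ) U g = dlogHom φ U g + dlogHom ψ U g := rfl
lemma dHom_comp (t : N ⟶ N') (f : Γ(X, U)) : dHom (φ ≫ t.val) U f = t.app U (dHom φ U f) := rfl
lemma dlogHom_comp (t : N ⟶ N') (g : localEquations ι U) :
    dlogHom (φ ≫ t.val) U g = t.app U (dlogHom φ U g) := rfl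

variable {φ ψ} in
lemma logHom_ext (h : ∀ U f, dHom φ U f = dHom ψ U f)
    (h' : ∀ U g, dlogHom φ U g = dlogHom ψ U g) : φ = ψ := by
  ext U x
  induction U using Opposite.rec with | op U
  letI := sectionsAlgebra π U
  suffices logApp φ U = logApp ψ U from LinearMap.congr_fun this x
  refine LinearMap.ext_on (LogKaehler.span_eq_top A Γ(X, U) (localEquations ι U)) ?_
  rintro _ (⟨f, rfl⟩ | ⟨g, rfl⟩)
  · exact h U f
  · exact h' U g

/-- Morphisms from logarithmic differentials that agree on a basis are equal. -/
lemma logHom_ext_of_basis (𝓑 : Set X.Opens)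
    (h𝓑 : ∀ (U : X.Opens), ∀ x ∈ U, ∃ V ∈ 𝓑, x ∈ V ∧ V ≤ U)
    (h : ∀ U ∈ 𝓑, ∀ f, dHom φ U f = dHom ψ U f)
    (h' : ∀ U ∈ 𝓑, ∀ g, dlogHom φ U g = dlogHom ψ U g) : φ = ψ := by
  refine logHom_ext (fun U f ↦ section_ext N _ _ fun x hx ↦ ?_)
    (fun U g ↦ section_ext N _ _ fun x hx ↦ ?_)
  · obtain ⟨V, hV, hxV, hVU⟩ := h𝓑 U x hx
    exact ⟨V, hVU, hxV, by rw [← dHom_res, ← dHom_res, h V hV]⟩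
  · obtain ⟨V, hV, hxV, hVU⟩ := h𝓑 U x hx
    exact ⟨V, hVU, hxV, by rw [← dlogHom_res, ← dlogHom_res, h' V hV]⟩

/-- A linear map on sections of logarithmic differentials from a derivation and a logarithmic
derivation. -/
lemma exists_linearMap_logSections (U : X.Opens) (δ : Γ(X, U) →+ Γ(N, U))
    (l : localEquations ι U → Γ(N, U))
    (hmul : ∀ f g, δ (f * g) = f • δ g + g • δ f) (hstr : ∀ a, δ (structHom π U a) = 0)
    (hl : ∀ (g : localEquations ι U), g.1 • l g = δ g.1)
    (hlm : ∀ (f g : localEquations ι U) (u : Γ(X, U)ˣ), g.1 = u * f.1 →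
      l g = l f + (↑u⁻¹ : Γ(X, U)) • δ u) :
    letI := sectionsAlgebra π U
    ∃ F : LogSections π ι U →ₗ[Γ(X, U)] Γ(N, U),
      (∀ f, F (LogKaehler.d A _ _ f) = δ f) ∧ ∀ g, F (LogKaehler.dlog A _ _ g) = l g := by
  letI := sectionsAlgebra π U
  letI : Module A Γ(N, U) := Module.compHom _ (structHom π U)
  have : IsScalarTower A Γ(X, U) Γ(N, U) := ⟨fun a s x ↦ by
    rw [Algebra.smul_def, mul_smul]; rfl⟩
  let δ' : Derivation A Γ(X, U) Γ(N, U) :=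
    { toFun := δ
      map_add' := δ.map_add
      map_smul' := fun a f ↦ by
        change δ (a • f) = structHom π U a • δ f
        rw [Algebra.smul_def]
        change δ (structHom π U a * f) = _
        rw [hmul, hstr, smul_zero, add_zero]
      map_one_eq_zero' := by
        have := hstr 1
        rwa [map_one] at this
      leibniz' := hmul }
  exact ⟨LogKaehler.lift δ' l hl hlm, LogKaehler.lift_d δ' l hl hlm,
    LogKaehler.lift_dlog δ' l hl hlm⟩

/-- A morphism from logarithmic differentials, from a derivation and a logarithmic derivation. -/
lemma exists_logHom (δ : ∀ U : X.Opens, Γ(X, U) →+ Γ(N, U))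
    (l : ∀ U : X.Opens, localEquations ι U → Γ(N, U))
    (hmul : ∀ U f g, δ U (f * g) = f • δ U g + g • δ U f)
    (hstr : ∀ U a, δ U (structHom π U a) = 0)
    (hl : ∀ U (g : localEquations ι U), g.1 • l U g = δ U g.1)
    (hlm : ∀ U (f g : localEquations ι U) (u : Γ(X, U)ˣ), g.1 = u * f.1 →
      l U g = l U f + (↑u⁻¹ : Γ(X, U)) • δ U u)
    (hres : ∀ U V (h : V ≤ U) f, δ V (resO h f) = resM N h (δ U f))
    (hlres : ∀ U V (h : V ≤ U) (g : localEquations ι U),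
      l V ⟨resO h g.1, resO_mem_localEquations h g.2⟩ = resM N h (l U g)) :
    ∃ φ : logDifferentialsPresheaf π ι ⟶ N.val, (∀ U f, dHom φ U f = δ U f) ∧
      ∀ U g, dlogHom φ U g = l U g := by
  choose F hF hF' using fun U ↦ exists_linearMap_logSections (π := π) U (δ U) (l U) (hmul U)
    (hstr U) (hl U) (hlm U)
  have hnat : ∀ (U V : X.Opens) (h : V ≤ U) (x : LogSections π ι U),
      F V (LogSections.restrict π ι h x) = resM N h (F U x) := by
    intro U V h x
    letI := sectionsAlgebra π U
    letI := sectionsAlgebra π V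
    have hx : x ∈ Submodule.span Γ(X, U) (Set.range (LogKaehler.d A Γ(X, U) (localEquations ι U)) ∪
        Set.range (LogKaehler.dlog A Γ(X, U) (localEquations ι U))) := by
      rw [LogKaehler.span_eq_top]; trivial
    induction hx using Submodule.span_induction with
    | mem x hx =>
      obtain ⟨f, rfl⟩ | ⟨g, rfl⟩ := hx
      · rw [hF, ← hres]
        refine Eq.trans (congrArg (F V) ?_) (hF V _)
        exact LogKaehler.map_d (restrictAlgHom π h) (fun _ hf ↦ map_mem_localEquations ι h hf) f
      · rw [hF', ← hlres]
        refine Eq.trans (congrArg (F V) ?_) (hF' V _)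
        exact LogKaehler.map_dlog (restrictAlgHom π h)
          (fun _ hf ↦ map_mem_localEquations ι h hf) g
    | zero => rw [map_zero, map_zero, map_zero, map_zero]
    | add x y _ _ hx hy => rw [map_add, map_add, map_add, map_add, hx, hy]
    | smul a x _ hx =>
      rw [map_smulₛₗ, map_smul, hx, map_smul, resM_smul]; rfl
  refine ⟨PresheafOfModules.homMk
    { app := fun U ↦ AddCommGrpCat.ofHom (X := LogSections π ι U.unop) (F U.unop).toAddMonoidHom
      naturality := fun U V i ↦ by
        ext x
        exact hnat U.unop V.unop (leOfHom i.unop) x } (fun U r x ↦ (F U.unop).map_smul r x),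
    hF, hF'⟩

end LogHom

/-! ### Derivations on a thickening -/

section Glue

variable {X : Scheme.{0}} (N : X.Modules)

/-- Local sections of a sheaf of modules that are characterised by a property glue. -/
lemma exists_glue {U : X.Opens} (P : ∀ V : X.Opens, V ≤ U → Γ(N, V) → Prop)
    (hex : ∀ x ∈ U, ∃ (V : X.Opens) (hV : V ≤ U) (s : Γ(N, V)), x ∈ V ∧ P V hV s)
    (huniq : ∀ V hV s s', P V hV s → P V hV s' → s = s')
    (hres : ∀ V hV s, P V hV s → ∀ W (h : W ≤ V), P W (h.trans hV) (resM N h s)) :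
    ∃ t : Γ(N, U), ∀ V hV s, P V hV s → resM N hV t = s := by
  choose V hV s hxV hs using fun x : U ↦ hex x.1 x.2
  obtain ⟨t, ht, -⟩ := TopCat.Sheaf.existsUnique_gluing' ⟨N.presheaf, N.isSheaf⟩ V U
    (fun x ↦ homOfLE (hV x)) (fun x hx ↦ TopologicalSpace.Opens.mem_iSup.mpr ⟨⟨x, hx⟩, hxV _⟩) s
    (fun x y ↦ huniq _ (inf_le_left.trans (hV x)) _ _ (hres _ _ _ (hs x) _ inf_le_left)
      (hres _ _ _ (hs y) _ inf_le_right))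
  have ht (x) : resM N (hV x) t = s x := ht x
  refine ⟨t, fun W hW s' hs' ↦ section_ext N _ _ fun x hx ↦ ?_⟩
  refine ⟨W ⊓ V ⟨x, hW hx⟩, inf_le_left, ⟨hx, hxV _⟩, ?_⟩
  rw [resM_resM]
  have e : resM N (inf_le_left.trans hW : W ⊓ V ⟨x, hW hx⟩ ≤ U) t =
      resM N inf_le_right (s ⟨x, hW hx⟩) := by
    rw [← ht, resM_resM]
  rw [e]
  exact huniq _ (inf_le_left.trans hW) _ _ (hres _ _ _ (hs _) _ inf_le_right)
    (hres _ _ _ hs' _ inf_le_left)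

end Glue

/-- A derivation along a morphism `i : X ⟶ Z` with values in a sheaf of modules `N` on `X`: a
compatible family of derivations `Γ(Z, V) → Γ(N, i⁻¹ V)`. -/
structure SheafDer {X Z : Scheme.{0}} (i : X ⟶ Z) (N : X.Modules) where
  toFun : ∀ V : Z.Opens, Γ(Z, V) →+ Γ(N, i ⁻¹ᵁ V)
  map_mul : ∀ V y z, toFun V (y * z) = i.app V y • toFun V z + i.app V z • toFun V y
  map_res : ∀ (V W : Z.Opens) (h : W ≤ V) (h' : i ⁻¹ᵁ W ≤ i ⁻¹ᵁ V) y,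
    toFun W (resO h y) = resM N h' (toFun V y)

lemma app_resO {X Z : Scheme.{0}} (i : X ⟶ Z) {V W : Z.Opens} (h : W ≤ V)
    (h' : i ⁻¹ᵁ W ≤ i ⁻¹ᵁ V) (y : Γ(Z, V)) : i.app W (resO h y) = resO h' (i.app V y) :=
  ConcreteCategory.congr_hom (i.naturality (homOfLE h).op) y

lemma preimage_comp_le {X Y Z : Scheme.{0}} {i : X ⟶ Y} {q : Y ⟶ Z} {i' : X ⟶ Z}
    (h : i ≫ q = i') (V : Z.Opens) : i' ⁻¹ᵁ V ≤ i ⁻¹ᵁ q ⁻¹ᵁ V := by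
  subst h; exact le_rfl

lemma app_comp_eq {X Y Z : Scheme.{0}} {i : X ⟶ Y} {q : Y ⟶ Z} {i' : X ⟶ Z}
    (h : i ≫ q = i') {V : Z.Opens} (y : Γ(Z, V)) :
    resO (preimage_comp_le h V) (i.app _ (q.app V y)) = i'.app V y := by
  subst h
  exact (resO_self _ _).trans (by rw [Scheme.Hom.comp_app]; rfl)

namespace SheafDer

variable {X Z : Scheme.{0}} {i : X ⟶ Z} {N N' : X.Modules}

lemma map_one (δ : SheafDer i N) (V : Z.Opens) : δ.toFun V 1 = 0 := by
  have e : i.app V 1 = 1 := _root_.map_one _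
  have := δ.map_mul V 1 1
  rw [mul_one, e, one_smul] at this
  simpa using this

/-- The composition of a derivation with a morphism of sheaves of modules. -/
def comp (δ : SheafDer i N) (f : N ⟶ N') : SheafDer i N' where
  toFun V := (f.app _).hom.comp (δ.toFun V)
  map_mul V y z := by
    change f.app _ (δ.toFun V _) = _ • f.app _ (δ.toFun V _) + _ • f.app _ (δ.toFun V _)
    rw [δ.map_mul, _root_.map_add]
    erw [f.app_smul, f.app_smul]
  map_res V W h h' y := by
    change f.app _ (δ.toFun W _) = resM N' h' (f.app _ (δ.toFun V _))
    rw [δ.map_res V W h h', app_resM]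

lemma comp_apply (δ : SheafDer i N) (f : N ⟶ N') (V : Z.Opens) (y : Γ(Z, V)) :
    (δ.comp f).toFun V y = f.app _ (δ.toFun V y) := rfl

instance : Add (SheafDer i N) where
  add δ δ' :=
    { toFun := fun V ↦ δ.toFun V + δ'.toFun V
      map_mul := fun V y z ↦ by
        simp only [AddMonoidHom.add_apply, δ.map_mul, δ'.map_mul, smul_add]
        abel
      map_res := fun V W h h' y ↦ by
        simp only [AddMonoidHom.add_apply, δ.map_res V W h h', δ'.map_res V W h h',
          _root_.map_add] }

lemma add_apply (δ δ' : SheafDer i N) (V : Z.Opens) (y : Γ(Z, V)) :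
    (δ + δ').toFun V y = δ.toFun V y + δ'.toFun V y := rfl

/-- The pullback of a derivation along a morphism. -/
def precomp {Y : Scheme.{0}} {i : X ⟶ Y} (δ : SheafDer i N) (q : Y ⟶ Z) (i' : X ⟶ Z)
    (h : i ≫ q = i') : SheafDer i' N where
  toFun V := (resM N (preimage_comp_le h V)).comp
    ((δ.toFun (q ⁻¹ᵁ V)).comp (q.app V).hom.toAddMonoidHom)
  map_mul V y z := by
    change resM N _ (δ.toFun (q ⁻¹ᵁ V) (q.app V (y * z))) =
      i'.app V y • resM N _ (δ.toFun (q ⁻¹ᵁ V) (q.app V z)) +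
      i'.app V z • resM N _ (δ.toFun (q ⁻¹ᵁ V) (q.app V y))
    have e : q.app V (y * z) = q.app V y * q.app V z := _root_.map_mul _ _ _
    rw [e, δ.map_mul, _root_.map_add, resM_smul, resM_smul, app_comp_eq h, app_comp_eq h]
  map_res V W h₁ h' y := by
    change resM N _ (δ.toFun (q ⁻¹ᵁ W) (q.app W (resO h₁ y))) =
      resM N h' (resM N _ (δ.toFun (q ⁻¹ᵁ V) (q.app V y)))
    have e : q.app W (resO h₁ y) = resO (q.preimage_mono h₁) (q.app V y) :=
      app_resO q h₁ _ y
    rw [e, δ.map_res (q ⁻¹ᵁ V) (q ⁻¹ᵁ W) (q.preimage_mono h₁)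
      (i.preimage_mono (q.preimage_mono h₁)), resM_resM, resM_resM]

lemma precomp_apply {Y : Scheme.{0}} {i : X ⟶ Y} (δ : SheafDer i N) (q : Y ⟶ Z) (i' : X ⟶ Z)
    (h : i ≫ q = i') (V : Z.Opens) (y : Γ(Z, V)) : (δ.precomp q i' h).toFun V y =
      resM N (preimage_comp_le h V) (δ.toFun (q ⁻¹ᵁ V) (q.app V y)) := rfl

end SheafDer

/-- The derivation of `𝒪_X` given by a morphism from logarithmic differentials. -/
def logDer {A : Type} [CommRing A] {X D Z : Scheme.{0}} {π : X ⟶ Spec (.of A)} {ι : D ⟶ X}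
    {N : X.Modules} (i : X ⟶ Z) (φ : logDifferentialsPresheaf π ι ⟶ N.val) : SheafDer i N where
  toFun V := (dHom φ (i ⁻¹ᵁ V)).comp (i.app V).hom.toAddMonoidHom
  map_mul V y z := by
    change dHom φ _ (i.app V (y * z)) = _ • dHom φ _ (i.app V z) + _ • dHom φ _ (i.app V y)
    rw [_root_.map_mul, dHom_mul]
  map_res V W h h' y := by
    change dHom φ _ (i.app W (resO h y)) = resM N h' (dHom φ _ (i.app V y))
    rw [app_resO i h h', dHom_res]

section Descent

variable {A B : Type} [CommRing A] [CommRing B] {α : B →+* A} {P : FlatPair A}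
  (Z : Deformation P α) (hα : Function.Surjective α) (hK : IsNilpotent (RingHom.ker α))

include hα in
/-- A derivation on a thickening that kills the scalars depends only on the reduction. -/
lemma SheafDer.eq_of_app_eq {N : P.X.Modules} (δ : SheafDer Z.iX N)
    (hδ : ∀ V b, δ.toFun V (structHom Z.total.π V b) = 0) {V : Z.total.X.Opens}
    (hV : IsAffineOpen V) {y y' : Γ(Z.total.X, V)} (h : Z.iX.app V y = Z.iX.app V y') :
    δ.toFun V y = δ.toFun V y' := by
  rw [← sub_eq_zero, ← map_sub]
  have h1 : y - y' ∈ RingHom.ker (Z.iX.app V).hom := by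
    rw [RingHom.mem_ker, map_sub]; exact sub_eq_zero.mpr h
  rw [ker_app_of_isPullback Z.isPullback_X hα hV] at h1
  generalize y - y' = z at h1 ⊢
  induction h1 using Submodule.span_induction with
  | mem x hx =>
    obtain ⟨b, -, rfl⟩ := hx
    exact hδ V b
  | zero => exact map_zero _
  | add x y _ _ hx hy => rw [map_add, hx, hy, add_zero]
  | smul a x hx' hx =>
    have hx' : x ∈ (RingHom.ker α).map (structHom Z.total.π V) := hx'
    rw [← ker_app_of_isPullback Z.isPullback_X hα hV] at hx'
    have hx' : Z.iX.app V x = 0 := hx'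
    rw [smul_eq_mul, δ.map_mul, hx, hx', smul_zero, zero_smul, add_zero]

lemma mem_localEquations_of_resO_eq {X D : Scheme.{0}} {ι : D ⟶ X} {U V : X.Opens} (h : V ≤ U)
    {g : Γ(X, U)} (hg : g ∈ localEquations ι U) {g' : Γ(X, V)} (e : g' = resO h g) :
    g' ∈ localEquations ι V := e ▸ resO_mem_localEquations h hg

lemma app_eq_zero_of_mem_localEquations {X D : Scheme.{0}} {ι : D ⟶ X} {U : X.Opens}
    (hU : IsAffineOpen U) {g : Γ(X, U)} (hg : g ∈ localEquations ι U) : ι.app U g = 0 := by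
  have h1 := (hg U le_rfl hU).1
  have h2 : X.presheaf.map (homOfLE le_rfl).op g = g := resO_self le_rfl g
  rw [h2] at h1
  rw [← RingHom.mem_ker, h1]
  exact Ideal.mem_span_singleton_self g

lemma mem_nonZeroDivisors_of_mem_localEquations {X D : Scheme.{0}} {ι : D ⟶ X} {U : X.Opens}
    (hU : IsAffineOpen U) {g : Γ(X, U)} (hg : g ∈ localEquations ι U) :
    g ∈ nonZeroDivisors Γ(X, U) := by
  have h1 := (hg U le_rfl hU).2
  have h2 : X.presheaf.map (homOfLE le_rfl).op g = g := resO_self le_rfl g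
  rwa [h2] at h1

lemma ker_app_eq_of_mem_localEquations {X D : Scheme.{0}} {ι : D ⟶ X} {U : X.Opens}
    (hU : IsAffineOpen U) {g : Γ(X, U)} (hg : g ∈ localEquations ι U) :
    RingHom.ker (ι.app U).hom = Ideal.span {g} := by
  have h1 := (hg U le_rfl hU).1
  have h2 : X.presheaf.map (homOfLE le_rfl).op g = g := resO_self le_rfl g
  rwa [h2] at h1

include hα hK in
/-- Two lifts of an equation differ by a unit that is `1` on the reduction. -/
lemma Deformation.exists_eq_mul {V : Z.total.X.Opens} (hV : IsAffineOpen V)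
    {g g' : Γ(Z.total.X, V)} (hg : Z.total.ι.app V g = 0) (hg' : Z.total.ι.app V g' = 0)
    (e : Z.iX.app V g' = Z.iX.app V g) (hgl : Z.iX.app V g ∈ localEquations P.ι (Z.iX ⁻¹ᵁ V)) :
    ∃ u : Γ(Z.total.X, V), g' = u * g ∧ Z.iX.app V u = 1 := by
  have := Z.total.isClosedImmersion
  have := Z.total.flat_divisor
  have hV' := isAffineOpen_preimage_of_isPullback Z.isPullback_X hα hV
  have h1 := ker_app_eq_span Z.isPullback_X hα hK Z.isPullback_D hV hg (fun s hs ↦ by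
    rw [← ker_app_eq_of_mem_localEquations hV' hgl]; exact hs)
  have h2 : g' ∈ RingHom.ker (Z.total.ι.app V).hom := hg'
  rw [h1, Ideal.mem_span_singleton'] at h2
  obtain ⟨u, rfl⟩ := h2
  refine ⟨u, rfl, ?_⟩
  rw [map_mul] at e
  exact (mul_cancel_right_mem_nonZeroDivisors
    (mem_nonZeroDivisors_of_mem_localEquations hV' hgl)).mp (e.trans (one_mul _).symm)

include hα hK in
/-- Local sections on the preimages of affine opens of a thickening glue. -/
lemma exists_glue_of_thickening (N : P.X.Modules) {U : P.X.Opens}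
    (T : ∀ W : Z.total.X.Opens, Z.iX ⁻¹ᵁ W ≤ U → Γ(N, Z.iX ⁻¹ᵁ W) → Prop)
    (hex : ∀ W h, IsAffineOpen W → ∃ s, T W h s)
    (huniq : ∀ W h s s', IsAffineOpen W → T W h s → T W h s' → s = s')
    (hres : ∀ W h s, T W h s → ∀ W' (h' : W' ≤ W), T W' ((Z.iX.preimage_mono h').trans h)
      (resM N (Z.iX.preimage_mono h') s)) :
    ∃ t : Γ(N, U), ∀ W h s, IsAffineOpen W → T W h s → resM N h t = s := by
  have key : ∀ W h s, IsAffineOpen W → T W h s → ∀ W' (h' : Z.iX ⁻¹ᵁ W' ≤ Z.iX ⁻¹ᵁ W) s',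
      IsAffineOpen W' → T W' (h'.trans h) s' → resM N h' s = s' :=
    fun W h s _ hs W' h' s' hW' hs' ↦
      huniq W' (h'.trans h) _ _ hW' (hres W h s hs W'
        (le_of_preimage_le Z.isPullback_X hα hK h')) hs'
  obtain ⟨t, ht⟩ := exists_glue N (U := U) (fun V hV s ↦ ∀ W (h : Z.iX ⁻¹ᵁ W ≤ V) s',
      IsAffineOpen W → T W (h.trans hV) s' → resM N h s = s') (fun x hx ↦ by
    obtain ⟨W, hW, hxW, hWU⟩ := exists_isAffineOpen_preimage Z.isPullback_X hα hK hx
    obtain ⟨s, hs⟩ := hex W hWU hW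
    exact ⟨_, hWU, s, hxW, key W hWU s hW hs⟩) (fun V hV s s' hs hs' ↦ by
    refine section_ext N _ _ fun x hx ↦ ?_
    obtain ⟨W, hW, hxW, hWV⟩ := exists_isAffineOpen_preimage Z.isPullback_X hα hK hx
    obtain ⟨s'', h''⟩ := hex W (hWV.trans hV) hW
    exact ⟨_, hWV, hxW, (hs W hWV s'' hW h'').trans (hs' W hWV s'' hW h'').symm⟩)
    (fun V hV s hs V' hV' W h s' hW hs' ↦ by
      rw [resM_resM]
      exact hs W (h.trans hV') s' hW hs')
  exact ⟨t, fun W h s hW hs ↦ ht _ h s (key W h s hW hs)⟩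

include hα hK in
lemma section_ext_of_thickening (N : P.X.Modules) {U : P.X.Opens} (t t' : Γ(N, U))
    (H : ∀ W (h : Z.iX ⁻¹ᵁ W ≤ U), IsAffineOpen W → resM N h t = resM N h t') : t = t' := by
  refine section_ext N _ _ fun x hx ↦ ?_
  obtain ⟨W, hW, hxW, hWU⟩ := exists_isAffineOpen_preimage Z.isPullback_X hα hK hx
  exact ⟨_, hWU, hxW, H W hWU hW⟩

variable (R : InjRes P.ι) {N : P.X.Modules} (δ : SheafDer Z.iX R.I) (f : R.I ⟶ N)
  (hδ : ∀ V b, f.app _ (δ.toFun V (structHom Z.total.π V b)) = 0)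

include hα hδ in
lemma app_sheafDer_eq {V : Z.total.X.Opens}
    (hV : IsAffineOpen V) {y y' : Γ(Z.total.X, V)} (h : Z.iX.app V y = Z.iX.app V y') :
    f.app _ (δ.toFun V y) = f.app _ (δ.toFun V y') :=
  SheafDer.eq_of_app_eq Z hα (δ.comp f) hδ hV h

include hα hK hδ in
/-- If `y` lifts an equation `g`, the image under `f` of the quotient of `δ y` by `g` does not
depend on the lift: two lifts differ by a unit `u ≡ 1`, and `f (δ u) = 0`. -/
lemma app_quotient_eq {V : Z.total.X.Opens}
    (hV : IsAffineOpen V) {y y' : Γ(Z.total.X, V)} (hy : Z.total.ι.app V y = 0)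
    (hy' : Z.total.ι.app V y' = 0) (h : Z.iX.app V y' = Z.iX.app V y)
    (hg : Z.iX.app V y ∈ localEquations P.ι (Z.iX ⁻¹ᵁ V)) {ℓ ℓ' : Γ(R.I, Z.iX ⁻¹ᵁ V)}
    (hℓ : Z.iX.app V y • ℓ = δ.toFun V y) (hℓ' : Z.iX.app V y • ℓ' = δ.toFun V y') :
    f.app _ ℓ = f.app _ ℓ' := by
  obtain ⟨u, rfl, hu⟩ := Deformation.exists_eq_mul Z hα hK hV hy hy' h hg
  have e : ℓ' = ℓ + δ.toFun V u := by
    refine (R.bijective_smul _ _ hg).1 ?_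
    change Z.iX.app V y • ℓ' = Z.iX.app V y • (ℓ + δ.toFun V u)
    rw [hℓ', smul_add, hℓ, δ.map_mul, hu, one_smul]
  have h1 : Z.iX.app V (1 : Γ(Z.total.X, V)) = 1 := map_one _
  rw [e, map_add, app_sheafDer_eq Z hα R δ f hδ hV (hu.trans h1.symm), δ.map_one, map_zero,
    add_zero]

include hα hK hδ in
lemma exists_descent_d {U : P.X.Opens} (a : Γ(P.X, U)) :
    ∃ t : Γ(N, U), ∀ W (h : Z.iX ⁻¹ᵁ W ≤ U), IsAffineOpen W → ∀ y, Z.iX.app W y = resO h a →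
      resM N h t = f.app _ (δ.toFun W y) := by
  refine (exists_glue_of_thickening Z hα hK N (U := U)
    (fun W h s ↦ ∃ y, Z.iX.app W y = resO h a ∧ s = f.app _ (δ.toFun W y)) ?_ ?_ ?_).imp
    fun t ht W h hW y hy ↦ ht W h _ hW ⟨y, hy, rfl⟩
  · intro W h hW
    obtain ⟨y, hy⟩ := app_surjective_of_isPullback Z.isPullback_X hα hW (resO h a)
    exact ⟨_, y, hy, rfl⟩
  · rintro W h _ _ hW ⟨y, hy, rfl⟩ ⟨y', hy', rfl⟩
    exact app_sheafDer_eq Z hα R δ f hδ hW (hy.trans hy'.symm)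
  · rintro W h _ ⟨y, hy, rfl⟩ W' h'
    refine ⟨resO h' y, ?_, ?_⟩
    · rw [app_resO _ h' (Z.iX.preimage_mono h'), hy, resO_resO]
    · rw [δ.map_res _ _ h' (Z.iX.preimage_mono h'), app_resM]

include hα hK hδ in
lemma exists_descent_dlog {U : P.X.Opens} (g : localEquations P.ι U) :
    ∃ t : Γ(N, U), ∀ W (h : Z.iX ⁻¹ᵁ W ≤ U), IsAffineOpen W → ∀ y ℓ, Z.total.ι.app W y = 0 →
      Z.iX.app W y = resO h g.1 → resO h g.1 • ℓ = δ.toFun W y → resM N h t = f.app _ ℓ := by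
  have := Z.total.isClosedImmersion
  refine (exists_glue_of_thickening Z hα hK N (U := U)
    (fun W h s ↦ ∃ y ℓ, Z.total.ι.app W y = 0 ∧ Z.iX.app W y = resO h g.1 ∧
      resO h g.1 • ℓ = δ.toFun W y ∧ s = f.app _ ℓ) ?_ ?_ ?_).imp
    fun t ht W h hW y ℓ hy hyg hℓ ↦ ht W h _ hW ⟨y, ℓ, hy, hyg, hℓ, rfl⟩
  · intro W h hW
    have hg := resO_mem_localEquations h g.2
    obtain ⟨y, hy, hyg⟩ := exists_equation_lift Z.isPullback_X hα Z.isPullback_D hW (resO h g.1)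
      (app_eq_zero_of_mem_localEquations
        (isAffineOpen_preimage_of_isPullback Z.isPullback_X hα hW) hg)
    obtain ⟨ℓ, hℓ⟩ := (R.bijective_smul _ _ hg).2 (δ.toFun W y)
    exact ⟨_, y, ℓ, hy, hyg, hℓ, rfl⟩
  · rintro W h _ _ hW ⟨y, ℓ, hy, hyg, hℓ, rfl⟩ ⟨y', ℓ', hy', hyg', hℓ', rfl⟩
    have hg := resO_mem_localEquations h g.2
    rw [← hyg] at hg hℓ hℓ' hyg'
    exact app_quotient_eq Z hα hK R δ f hδ hW hy hy' hyg' hg hℓ hℓ'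
  · rintro W h _ ⟨y, ℓ, hy, hyg, hℓ, rfl⟩ W' h'
    have h'' := Z.iX.preimage_mono h'
    refine ⟨resO h' y, resM _ h'' ℓ, ?_, ?_, ?_, ?_⟩
    · rw [app_resO _ h' (Z.total.ι.preimage_mono h'), hy, map_zero]
    · rw [app_resO _ h' h'', hyg, resO_resO]
    · rw [δ.map_res _ _ h' h'', ← hℓ, resM_smul, resO_resO]
    · rw [app_resM]

include hα hK hδ in
/-- A derivation on a thickening that kills the scalars after composition with `f : I ⟶ N`
descends to a morphism from logarithmic differentials. -/
lemma exists_logHom_of_sheafDer :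
    ∃ ψ : logDifferentialsPresheaf P.π P.ι ⟶ N.val,
      (∀ V y, dHom ψ _ (Z.iX.app V y) = f.app _ (δ.toFun V y)) ∧
      ∀ V g (hg : Z.iX.app V g ∈ localEquations P.ι (Z.iX ⁻¹ᵁ V)), Z.total.ι.app V g = 0 →
        ∀ ℓ, Z.iX.app V g • ℓ = δ.toFun V g → f.app _ ℓ = dlogHom ψ _ ⟨_, hg⟩ := by
  have := Z.total.isClosedImmersion
  choose d hd using fun U a ↦ exists_descent_d Z hα hK R δ f hδ (U := U) a
  choose l hl using fun U g ↦ exists_descent_dlog Z hα hK R δ f hδ (U := U) g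
  have hsurj : ∀ {U} W (h : Z.iX ⁻¹ᵁ W ≤ U), IsAffineOpen W → ∀ a : Γ(P.X, U),
      ∃ y, Z.iX.app W y = resO h a := fun W h hW a ↦
    app_surjective_of_isPullback Z.isPullback_X hα hW _
  have hlift : ∀ {U} W (h : Z.iX ⁻¹ᵁ W ≤ U), IsAffineOpen W → ∀ g : localEquations P.ι U,
      ∃ y ℓ, Z.total.ι.app W y = 0 ∧ Z.iX.app W y = resO h g.1 ∧
        resO h g.1 • ℓ = δ.toFun W y := fun W h hW g ↦ by
    have hg := resO_mem_localEquations h g.2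
    obtain ⟨y, hy, hyg⟩ := exists_equation_lift Z.isPullback_X hα Z.isPullback_D hW (resO h g.1)
      (app_eq_zero_of_mem_localEquations
        (isAffineOpen_preimage_of_isPullback Z.isPullback_X hα hW) hg)
    obtain ⟨ℓ, hℓ⟩ := (R.bijective_smul _ _ hg).2 (δ.toFun W y)
    exact ⟨y, ℓ, hy, hyg, hℓ⟩
  have hfs : ∀ {U} (a : Γ(P.X, U)) (m : Γ(R.I, U)), f.app U (a • m) = a • f.app U m :=
    fun a m ↦ f.app_smul a m
  have hdadd : ∀ U a b, d U (a + b) = d U a + d U b := fun U a b ↦ by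
    refine section_ext_of_thickening Z hα hK N _ _ fun W h hW ↦ ?_
    obtain ⟨y, hy⟩ := hsurj W h hW a
    obtain ⟨z, hz⟩ := hsurj W h hW b
    rw [map_add, hd U a W h hW y hy, hd U b W h hW z hz,
      hd U _ W h hW (y + z) (by rw [map_add, map_add, hy, hz]), map_add, map_add]
  have hdres : ∀ U V (h : V ≤ U) a, d V (resO h a) = resM N h (d U a) := fun U V h a ↦ by
    refine section_ext_of_thickening Z hα hK N _ _ fun W h' hW ↦ ?_
    obtain ⟨y, hy⟩ := hsurj W (h'.trans h) hW a
    rw [resM_resM, hd U a W (h'.trans h) hW y hy, hd V _ W h' hW y (by rw [resO_resO, hy])]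
  refine Exists.elim (exists_logHom (N := N) (π := P.π) (ι := P.ι)
    (fun U ↦ AddMonoidHom.mk' (d U) (hdadd U)) l (fun U a b ↦ ?_) (fun U a ↦ ?_)
    (fun U g ↦ ?_) (fun U g g' u e ↦ ?_) hdres (fun U V h g ↦ ?_)) fun ψ ⟨hψ, hψ'⟩ ↦ ?_
  rotate_left 5
  · refine ⟨ψ, fun V y ↦ ?_, fun V g hg hgE ℓ hℓ ↦ ?_⟩
    · rw [hψ]
      change d _ _ = _
      refine section_ext_of_thickening Z hα hK N _ _ fun W h hW ↦ ?_
      have hWV := le_of_preimage_le Z.isPullback_X hα hK h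
      rw [hd _ _ W h hW (resO hWV y) (app_resO _ _ _ _), ← app_resM, δ.map_res _ _ hWV h]
    · rw [hψ']
      refine (section_ext_of_thickening Z hα hK N _ _ fun W h hW ↦ ?_).symm
      have hWV := le_of_preimage_le Z.isPullback_X hα hK h
      rw [hl _ _ W h hW (resO hWV g) (resM _ h ℓ), app_resM]
      · rw [app_resO _ hWV (Z.total.ι.preimage_mono hWV), hgE, map_zero]
      · exact app_resO _ _ _ _
      · rw [δ.map_res _ _ hWV h, ← hℓ, resM_smul]
  · change d U (a * b) = a • d U b + b • d U a
    refine section_ext_of_thickening Z hα hK N _ _ fun W h hW ↦ ?_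
    obtain ⟨y, hy⟩ := hsurj W h hW a
    obtain ⟨z, hz⟩ := hsurj W h hW b
    rw [map_add, resM_smul, resM_smul, hd U a W h hW y hy, hd U b W h hW z hz,
      hd U _ W h hW (y * z) (by rw [map_mul, map_mul, hy, hz]), δ.map_mul, map_add, hfs, hfs,
      hy, hz]
  · change d U _ = 0
    refine section_ext_of_thickening Z hα hK N _ _ fun W h hW ↦ ?_
    obtain ⟨b, rfl⟩ := hα a
    rw [map_zero, hd U _ W h hW (structHom Z.total.π W b), hδ]
    rw [app_structHom Z.isPullback_X.w]
    exact (map_structHom P.π (homOfLE h) _).symm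
  · change g.1 • l U g = d U g.1
    refine section_ext_of_thickening Z hα hK N _ _ fun W h hW ↦ ?_
    obtain ⟨y, ℓ, hy, hyg, hℓ⟩ := hlift W h hW g
    rw [resM_smul, hl U g W h hW y ℓ hy hyg hℓ, hd U _ W h hW y hyg, ← hℓ, hfs]
  · change l U g' = l U g + (↑u⁻¹ : Γ(P.X, U)) • d U u
    refine section_ext_of_thickening Z hα hK N _ _ fun W h hW ↦ ?_
    obtain ⟨y, ℓ, hy, hyg, hℓ⟩ := hlift W h hW g
    obtain ⟨v, hv⟩ := hsurj W h hW u
    have hu : resO h (u : Γ(P.X, U)) * resO h (↑u⁻¹ : Γ(P.X, U)) = 1 := by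
      rw [← map_mul, Units.mul_inv, map_one]
    rw [map_add, resM_smul, hl U g W h hW y ℓ hy hyg hℓ, hd U _ W h hW v hv, ← hfs, ← map_add]
    refine hl U g' W h hW (v * y) _ ?_ ?_ ?_
    · rw [map_mul, hy, mul_zero]
    · rw [map_mul, hv, hyg, e, map_mul]
    · rw [δ.map_mul, ← hℓ, e, map_mul, hv, hyg, smul_add, smul_smul, smul_smul,
        mul_right_comm, hu, one_mul]
  · refine section_ext_of_thickening Z hα hK N _ _ fun W h' hW ↦ ?_
    obtain ⟨y, ℓ, hy, hyg, hℓ⟩ := hlift W (h'.trans h) hW g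
    rw [resM_resM, hl U g W (h'.trans h) hW y ℓ hy hyg hℓ]
    refine hl V _ W h' hW y ℓ hy ?_ ?_
    · rw [resO_resO, hyg]
    · rw [resO_resO, hℓ]

end Descent

/-! ### Derivations that represent a deformation -/

section Rel

variable {A M M' : Type} [CommRing A] {P : FlatPair A} [AddCommGroup M] [Module A M]
  [Module Aᵐᵒᵖ M] [IsCentralScalar A M] [AddCommGroup M'] [Module A M'] [Module Aᵐᵒᵖ M']
  [IsCentralScalar A M']

lemma augmentation_surjective : Function.Surjective (augmentation A M) := fun a ↦ ⟨.inl a, rfl⟩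

lemma isNilpotent_ker_augmentation : IsNilpotent (RingHom.ker (augmentation A M)) :=
  isNilpotent_ker_fstHom

variable (R : InjRes P.ι) (Y : Deformation P (augmentation A M))

/-- A derivation `δ : 𝒪_Y → I` on a deformation `Y` over `A ⊕ M` lies over the morphism
`φ : Ω¹(log D) ⟶ J = I / 𝒪` and the linear map `c : M → A` if it is `c` on the elements of `M`, if
it induces `φ ∘ d` modulo `𝒪`, and if for each lift `y` of an equation `g` of `D` to an equation of
the divisor of `Y`, `δ y / g` induces `φ (dlog g)`. -/
structure Represents (c : M →ₗ[A] A) (φ : logDifferentialsPresheaf P.π P.ι ⟶ R.J.val)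
    (δ : SheafDer Y.iX R.I) : Prop where
  structHom : ∀ V b, δ.toFun V (structHom Y.total.π V b) =
    R.jO _ (LogDef.structHom P.π (Y.iX ⁻¹ᵁ V) (c b.snd))
  d : ∀ V y, R.qI _ (δ.toFun V y) = dHom φ _ (Y.iX.app V y)
  dlog : ∀ V y (hy : Y.iX.app V y ∈ localEquations P.ι (Y.iX ⁻¹ᵁ V)), Y.total.ι.app V y = 0 →
    ∀ ℓ, Y.iX.app V y • ℓ = δ.toFun V y → R.qI _ ℓ = dlogHom φ _ ⟨_, hy⟩

/-- The morphism `φ : Ω¹(log D) ⟶ J` belongs to the deformation `Y` along `c : M → A`: there is a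
derivation on `Y` over `φ` and `c`. -/
def Rel (c : M →ₗ[A] A) (φ : logDifferentialsPresheaf P.π P.ι ⟶ R.J.val) : Prop :=
  ∃ δ, Represents R Y c φ δ

variable {R Y} {c c' : M →ₗ[A] A} {φ φ' : logDifferentialsPresheaf P.π P.ι ⟶ R.J.val}

/-- The morphism that belongs to a deformation is additive in `c`; this makes the bijection with
`Ext¹` additive. -/
lemma Rel.add (h : Rel R Y c φ) (h' : Rel R Y c' φ') : Rel R Y (c + c') (φ + φ') := by
  obtain ⟨δ, h⟩ := h
  obtain ⟨δ', h'⟩ := h'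
  refine ⟨δ + δ', fun V b ↦ ?_, fun V y ↦ ?_, fun V y hy hy' ℓ hℓ ↦ ?_⟩
  · rw [SheafDer.add_apply, h.structHom, h'.structHom, LinearMap.add_apply, map_add, map_add]
  · rw [SheafDer.add_apply, map_add, h.d, h'.d, dHom_add]
  · obtain ⟨ℓ₁, h₁⟩ := (R.bijective_smul _ _ hy).2 (δ.toFun V y)
    obtain ⟨ℓ₂, h₂⟩ := (R.bijective_smul _ _ hy).2 (δ'.toFun V y)
    have e : ℓ = ℓ₁ + ℓ₂ := by
      refine (R.bijective_smul _ _ hy).1 (hℓ.trans ?_)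
      rw [SheafDer.add_apply, ← h₁, ← h₂]
      exact (smul_add _ _ _).symm
    rw [e, map_add, h.dlog V y hy hy' ℓ₁ h₁, h'.dlog V y hy hy' ℓ₂ h₂, dlogHom_add]

lemma Rel.neg (h : Rel R Y c φ) : Rel R Y (-c) (-φ) := by
  obtain ⟨δ, h⟩ := h
  refine ⟨δ.comp (-𝟙 _), fun V b ↦ ?_, fun V y ↦ ?_, fun V y hy hy' ℓ hℓ ↦ ?_⟩
  · rw [SheafDer.comp_apply, h.structHom, LinearMap.neg_apply, map_neg, map_neg]
    rfl
  · exact (map_neg (R.qI _) (δ.toFun V y)).trans (congrArg Neg.neg (h.d V y))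
  · have h1 := h.dlog V y hy hy' (-ℓ) (by
      rw [smul_neg, hℓ]
      exact neg_neg (δ.toFun V y))
    rw [map_neg] at h1
    exact (neg_eq_iff_eq_neg.mp h1)

lemma Rel.smul (h : Rel R Y c φ) (a : A) :
    Rel R Y (a • c) (φ ≫ (mulEnd P.π R.J a).val) := by
  obtain ⟨δ, h⟩ := h
  refine ⟨δ.comp (mulEnd P.π _ a), fun V b ↦ ?_, fun V y ↦ ?_, fun V y hy hy' ℓ hℓ ↦ ?_⟩
  · rw [SheafDer.comp_apply, h.structHom, mulEnd_app, LinearMap.smul_apply, smul_eq_mul, map_mul,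
      ← map_smul, smul_eq_mul]
  · rw [SheafDer.comp_apply, mulEnd_app, map_smul, h.d, dHom_comp, mulEnd_app]
  · obtain ⟨ℓ₁, h₁⟩ := (R.bijective_smul _ _ hy).2 (δ.toFun V y)
    have e : ℓ = LogDef.structHom P.π (Y.iX ⁻¹ᵁ V) a • ℓ₁ := by
      refine (R.bijective_smul _ _ hy).1 (hℓ.trans ?_)
      rw [SheafDer.comp_apply, mulEnd_app, ← h₁]
      exact smul_comm (LogDef.structHom P.π (Y.iX ⁻¹ᵁ V) a) (Y.iX.app V y) ℓ₁
    rw [e, map_smul, h.dlog V y hy hy' ℓ₁ h₁, dlogHom_comp, mulEnd_app]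

variable (R Y) in
/-- A derivation of `𝒪_X` with values in `I` is a derivation on every deformation of `X` that
vanishes on the scalars, so `φ` matters only modulo morphisms that lift to `I`. -/
lemma Rel.of_hom (θ : logDifferentialsPresheaf P.π P.ι ⟶ R.I.val) :
    Rel R Y 0 (θ ≫ R.q.val) := by
  refine ⟨logDer Y.iX θ, fun V b ↦ ?_, fun V y ↦ rfl, fun V y hy hy' ℓ hℓ ↦ ?_⟩
  · change dHom θ _ (Y.iX.app V _) = _
    rw [app_structHom Y.isPullback_X.w, dHom_structHom, LinearMap.zero_apply, map_zero, map_zero]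
  · have e : ℓ = dlogHom θ _ ⟨_, hy⟩ :=
      (R.bijective_smul _ _ hy).1 (hℓ.trans (smul_dlogHom θ ⟨_, hy⟩).symm)
    rw [e]
    rfl

lemma le_preimage_comp {X Y Z : Scheme.{0}} {i : X ⟶ Y} {q : Y ⟶ Z} {i' : X ⟶ Z}
    (h : i ≫ q = i') (V : Z.Opens) : i ⁻¹ᵁ q ⁻¹ᵁ V ≤ i' ⁻¹ᵁ V := by
  subst h; exact le_rfl

/-- A derivation on a base change of `Z` pulls back to `Z`, where `c` is replaced by its composition
with the map of square-zero ideals. -/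
lemma Rel.of_isBaseChange {f : M →ₗ[A] M'} {Z : Deformation P (augmentation A M)}
    {Y : Deformation P (augmentation A M')} {c : M' →ₗ[A] A} (hZ : Z.IsBaseChange (mapHom f) Y)
    (h : Rel R Y c φ) : Rel R Z (c ∘ₗ f) φ := by
  obtain ⟨qX, qD, hX, hD, ei, -⟩ := hZ
  obtain ⟨δ, h⟩ := h
  refine ⟨δ.precomp qX Z.iX ei, fun V b ↦ ?_, fun V y ↦ ?_, fun V y hy hy' ℓ hℓ ↦ ?_⟩
  · rw [SheafDer.precomp_apply, app_structHom hX.w, h.structHom, ← R.jO_res]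
    congr 1
    refine (map_structHom P.π (homOfLE (preimage_comp_le ei V)) _).trans ?_
    simp
  · rw [SheafDer.precomp_apply, R.qI_res, h.d, ← dHom_res, app_comp_eq ei]
  · have h1 := preimage_comp_le ei V
    have h2 := le_preimage_comp ei V
    have e : Y.iX.app _ (qX.app V y) = resO h2 (Z.iX.app V y) := by
      rw [← app_comp_eq ei, resO_resO, resO_self]
    have hy₂ : Y.iX.app _ (qX.app V y) ∈ localEquations P.ι (Y.iX ⁻¹ᵁ qX ⁻¹ᵁ V) :=
      mem_localEquations_of_resO_eq h2 hy e
    have hE : Y.total.ι.app _ (qX.app V y) = 0 := by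
      have h3 := app_eq_zero_congr hD.w y
      rw [Scheme.Hom.comp_app, Scheme.Hom.comp_app] at h3
      refine h3.mp ?_
      change qD.app _ (Z.total.ι.app V y) = 0
      rw [hy', map_zero]
    have h3 := h.dlog _ _ hy₂ hE (resM R.I h2 ℓ) (by
      rw [e, ← resM_smul, hℓ, SheafDer.precomp_apply, resM_resM, resM_self])
    have h4 := congrArg (resM R.J h1) h3
    rw [R.qI_res, resM_resM, resM_self, ← dlogHom_res] at h4
    rw [h4]
    congr 2
    exact app_comp_eq ei y

/-- A derivation on a deformation that is `c` on the scalars lies over a morphism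
`φ : Ω¹(log D) ⟶ J`. -/
lemma Rel.exists_of_sheafDer (δ : SheafDer Y.iX R.I)
    (hδ : ∀ V b, δ.toFun V (structHom Y.total.π V b) =
      R.jO _ (LogDef.structHom P.π (Y.iX ⁻¹ᵁ V) (c b.snd))) : ∃ φ, Rel R Y c φ := by
  obtain ⟨φ, h1, h2⟩ := exists_logHom_of_sheafDer Y augmentation_surjective
    isNilpotent_ker_augmentation R δ R.q (fun V b ↦ by rw [hδ]; exact R.qI_jO _)
  exact ⟨φ, δ, hδ, fun V y ↦ (h1 V y).symm, fun V y hy hy' ℓ hℓ ↦ h2 V y hy hy' ℓ hℓ⟩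

/-- A derivation that vanishes on the scalars comes from a morphism `Ω¹(log D) ⟶ I`. -/
lemma Rel.exists_hom (h : Rel R Y 0 φ) :
    ∃ θ : logDifferentialsPresheaf P.π P.ι ⟶ R.I.val, φ = θ ≫ R.q.val := by
  obtain ⟨δ, h⟩ := h
  have hα := augmentation_surjective (A := A) (M := M)
  have hK := isNilpotent_ker_augmentation (A := A) (M := M)
  have := Y.total.isClosedImmersion
  obtain ⟨θ, h1, h2⟩ := exists_logHom_of_sheafDer Y hα hK R δ (𝟙 _) (fun V b ↦ by
    rw [h.structHom, LinearMap.zero_apply, map_zero, map_zero, map_zero])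
  refine ⟨θ, logHom_ext_of_basis _ _ {U | ∃ V, IsAffineOpen V ∧ U = Y.iX ⁻¹ᵁ V}
    (fun U x hx ↦ ?_) ?_ ?_⟩
  · obtain ⟨V, hV, hxV, hVU⟩ := exists_isAffineOpen_preimage Y.isPullback_X hα hK hx
    exact ⟨_, ⟨V, hV, rfl⟩, hxV, hVU⟩
  · rintro _ ⟨V, hV, rfl⟩ f
    obtain ⟨y, rfl⟩ := app_surjective_of_isPullback Y.isPullback_X hα hV f
    rw [← h.d, dHom_comp, h1]
    rfl
  · rintro _ ⟨V, hV, rfl⟩ ⟨g, hg⟩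
    obtain ⟨y, hy, rfl⟩ := exists_equation_lift Y.isPullback_X hα Y.isPullback_D hV g
      (app_eq_zero_of_mem_localEquations
        (isAffineOpen_preimage_of_isPullback Y.isPullback_X hα hV) hg)
    obtain ⟨ℓ, hℓ⟩ := (R.bijective_smul _ _ hg).2 (δ.toFun V y)
    rw [← h.dlog V y hg hy ℓ hℓ, dlogHom_comp, ← h2 V y hg hy ℓ hℓ]
    rfl

end Rel

/-! ### Thickenings from sheaves of rings -/

/-- A sheaf of rings on a scheme `X`, with a homomorphism `ρ` to the structure sheaf that is
a nilpotent thickening on affine opens and compatible with localization. -/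
structure RingThickening (X : Scheme.{0}) where
  F : TopCat.Presheaf CommRingCat.{0} X
  isSheaf : F.IsSheaf
  ρ : F ⟶ X.presheaf
  isUnit : ∀ (U : X.Opens) (s : F.obj (op U)), IsUnit (ρ.app (op U) s) → IsUnit s
  isNilpotent : ∀ (U : X.Opens) (s : F.obj (op U)), ρ.app (op U) s = 0 → IsNilpotent s
  surjective : ∀ (U : X.Opens), IsAffineOpen U → Function.Surjective (ρ.app (op U))
  exists_eq : ∀ (U : X.Opens), IsAffineOpen U → ∀ (s : F.obj (op U)) (V : X.Opens) (h : V ≤ U),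
    V = X.basicOpen (ρ.app (op U) s) → ∀ t : F.obj (op V), ∃ (n : ℕ) (t' : F.obj (op U)),
      F.map (homOfLE h).op t' = F.map (homOfLE h).op s ^ n * t
  eq_zero : ∀ (U : X.Opens), IsAffineOpen U → ∀ (s : F.obj (op U)) (V : X.Opens) (h : V ≤ U),
    V = X.basicOpen (ρ.app (op U) s) → ∀ t : F.obj (op U), F.map (homOfLE h).op t = 0 →
      ∃ n : ℕ, s ^ n * t = 0

namespace RingThickening

variable {X : Scheme.{0}} (D : RingThickening X)

/-- The thickening as a space with a sheaf of rings. -/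
def sheafedSpace : SheafedSpace CommRingCat.{0} where
  carrier := X.carrier
  presheaf := D.F
  IsSheaf := D.isSheaf

/-- The inclusion of `X` in its thickening, as a morphism of presheafed spaces. -/
def incl : X.toPresheafedSpace ⟶ D.sheafedSpace.toPresheafedSpace where
  base := 𝟙 _
  c := D.ρ

lemma isLocalHom_stalkMap (x : X) :
    IsLocalHom ((PresheafedSpace.Hom.stalkMap D.incl x).hom) where
  map_nonunit := fun t ht ↦ by
    obtain ⟨U, hx, s, rfl⟩ := TopCat.Presheaf.exists_germ_eq (F := D.F) (x := (x : X)) t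
    have e : (PresheafedSpace.Hom.stalkMap D.incl x) (D.F.germ U x hx s) =
        X.presheaf.germ U x hx (D.ρ.app (op U) s) :=
      ConcreteCategory.congr_hom (PresheafedSpace.stalkMap_germ D.incl U x hx) s
    have ht : IsUnit (X.presheaf.germ U x hx (D.ρ.app (op U) s)) := by
      rw [← e]; exact ht
    obtain ⟨V, i, hxV, hu⟩ :=
      X.toLocallyRingedSpace.toRingedSpace.isUnit_res_of_isUnit_germ U _ x hx ht
    have h1 : IsUnit (D.ρ.app (op V) (D.F.map i.op s)) := by
      have := ConcreteCategory.congr_hom (D.ρ.naturality i.op) s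
      exact this ▸ hu
    have h2 := (D.isUnit V _ h1).map (D.F.germ V x hxV).hom
    have h3 : D.F.germ V x hxV (D.F.map i.op s) = D.F.germ U x hx s :=
      TopCat.Presheaf.germ_res_apply D.F i x hxV s
    exact h3 ▸ h2

/-- The thickening as a locally ringed space. -/
def locallyRingedSpace : LocallyRingedSpace.{0} where
  toSheafedSpace := D.sheafedSpace
  isLocalRing x :=
    have : IsLocalRing (X.presheaf.stalk x) := X.toLocallyRingedSpace.isLocalRing x
    have := D.isLocalHom_stalkMap x
    (PresheafedSpace.Hom.stalkMap D.incl x).hom.domain_isLocalRing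

/-- The inclusion of `X` in its thickening, as a morphism of locally ringed spaces. -/
def inclLRS : X.toLocallyRingedSpace ⟶ D.locallyRingedSpace where
  toHom := D.incl
  prop x := D.isLocalHom_stalkMap x

lemma isUnit_germ_iff (U : X.Opens) (x : X) (hx : x ∈ U) (s : D.F.obj (op U)) :
    IsUnit (D.F.germ U x hx s) ↔ IsUnit (X.presheaf.germ U x hx (D.ρ.app (op U) s)) := by
  have e : (PresheafedSpace.Hom.stalkMap D.incl x) (D.F.germ U x hx s) =
      X.presheaf.germ U x hx (D.ρ.app (op U) s) :=
    ConcreteCategory.congr_hom (PresheafedSpace.stalkMap_germ D.incl U x hx) s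
  rw [← e]
  exact (@isUnit_map_iff _ _ _ _ _ _ _ (PresheafedSpace.Hom.stalkMap D.incl x).hom
    (D.isLocalHom_stalkMap x) (D.F.germ U x hx s)).symm

lemma toΓSpecFun_eq (x : X) : D.locallyRingedSpace.toΓSpecFun x =
    PrimeSpectrum.comap (D.ρ.app (op ⊤)).hom (X.toLocallyRingedSpace.toΓSpecFun x) := by
  ext s
  rw [← not_iff_not]
  exact (D.locallyRingedSpace.notMem_prime_iff_unit_in_stalk s x).trans
    ((D.isUnit_germ_iff ⊤ x trivial s).trans
      (X.toLocallyRingedSpace.notMem_prime_iff_unit_in_stalk (D.ρ.app (op ⊤) s) x).symm)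

lemma toΓSpecMapBasicOpen_eq (s : D.F.obj (op ⊤)) :
    D.locallyRingedSpace.toΓSpecMapBasicOpen s = X.basicOpen (D.ρ.app (op ⊤) s) := by
  ext x
  exact (D.locallyRingedSpace.notMem_prime_iff_unit_in_stalk s x).trans
    ((D.isUnit_germ_iff ⊤ x trivial s).trans
      (X.mem_basicOpen _ x (TopologicalSpace.Opens.mem_top x)).symm)

lemma isHomeomorph_toΓSpecFun [IsAffine X] : IsHomeomorph D.locallyRingedSpace.toΓSpecFun := by
  have h1 : IsHomeomorph X.toLocallyRingedSpace.toΓSpecFun :=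
    (Scheme.homeoOfIso (asIso X.toSpecΓ)).isHomeomorph
  have h2 : IsHomeomorph (PrimeSpectrum.comap (D.ρ.app (op ⊤)).hom) := by
    refine PrimeSpectrum.isHomeomorph_comap _ (fun x ↦ ?_) (fun b hb ↦ ?_)
    · obtain ⟨b, rfl⟩ := D.surjective ⊤ (isAffineOpen_top X) x
      exact ⟨1, one_pos, b, by simp⟩
    · exact mem_nilradical.mpr (D.isNilpotent ⊤ b hb)
  have e : D.locallyRingedSpace.toΓSpecFun =
    PrimeSpectrum.comap (D.ρ.app (op ⊤)).hom ∘ X.toLocallyRingedSpace.toΓSpecFun :=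
    funext D.toΓSpecFun_eq
  rw [e]
  exact h2.comp h1

lemma bijective_of_away {R : CommRingCat.{0}} (s : R) {B : CommRingCat.{0}}
    (f : (Spec.structureSheaf R).obj.obj (op (PrimeSpectrum.basicOpen s)) ⟶ B) (g : R →+* B)
    (hf : ∀ a : R, f (algebraMap R ((structureSheafInType R R).obj.obj
      (op (PrimeSpectrum.basicOpen s))) a) = g a)
    (h1 : ∀ a, g a = 0 → ∃ n : ℕ, s ^ n * a = 0) (h2 : ∀ b, ∃ (n : ℕ) (a : R), g a = g s ^ n * b) :
    Function.Bijective f := by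
  have hL := StructureSheaf.IsLocalization.to_basicOpen R s
  let alg : R →+* (Spec.structureSheaf R).obj.obj (op (PrimeSpectrum.basicOpen s)) :=
    algebraMap R ((structureSheafInType R R).obj.obj (op (PrimeSpectrum.basicOpen s)))
  have hf : ∀ a, f (alg a) = g a := hf
  have hu : IsUnit (alg s) :=
    IsLocalization.Away.algebraMap_isUnit
      (S := (structureSheafInType R R).obj.obj (op (PrimeSpectrum.basicOpen s))) s
  have hu' : IsUnit (g s) := hf s ▸ hu.map f.hom
  constructor
  · refine (injective_iff_map_eq_zero f.hom).mpr fun l hl ↦ ?_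
    have hl : f l = 0 := hl
    obtain ⟨n, a, ha⟩ := IsLocalization.Away.surj
      (S := (structureSheafInType R R).obj.obj (op (PrimeSpectrum.basicOpen s))) s l
    have ha : l * alg s ^ n = alg a := ha
    have h3 : f (alg a) = 0 := by
      rw [← ha, map_mul, hl, zero_mul]
    rw [hf] at h3
    obtain ⟨k, hk⟩ := h1 a h3
    have h2 : alg s ^ k * alg a = 0 := by
      rw [← map_pow, ← map_mul, hk, map_zero]
    rw [← ha] at h2
    exact ((hu.pow n).mul_left_eq_zero).mp (((hu.pow k).mul_right_eq_zero).mp h2)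
  · intro t
    obtain ⟨n, a, ha⟩ := h2 t
    obtain ⟨l, hl⟩ := (hu.pow n).dvd (a := alg a)
    refine ⟨l, (hu'.pow n).mul_left_cancel ?_⟩
    rw [← ha, ← hf s, ← map_pow, ← map_mul, ← hl, hf]

lemma bijective_toΓSpecCApp [IsAffine X] (s : D.F.obj (op ⊤)) :
    Function.Bijective (D.locallyRingedSpace.toΓSpecCApp s) := by
  have hV := D.toΓSpecMapBasicOpen_eq s
  refine bijective_of_away s _ (D.F.map (homOfLE le_top).op).hom (fun a ↦
    ConcreteCategory.congr_hom (D.locallyRingedSpace.toΓSpecCApp_spec s) a) (fun a ha ↦ ?_)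
    (fun t ↦ ?_)
  · exact D.eq_zero ⊤ (isAffineOpen_top X) s _ le_top hV a ha
  · exact D.exists_eq ⊤ (isAffineOpen_top X) s _ le_top hV t

lemma isIso_toΓSpec [IsAffine X] : IsIso D.locallyRingedSpace.toΓSpec := by
  let S := Spec.toSheafedSpace.obj (op (LocallyRingedSpace.Γ.obj (op D.locallyRingedSpace)))
  let φ : D.sheafedSpace ⟶ S := D.locallyRingedSpace.toΓSpecSheafedSpace
  have hb : IsIso φ.hom.base :=
    TopCat.isIso_of_bijective_of_isOpenMap _ D.isHomeomorph_toΓSpecFun.bijective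
      D.isHomeomorph_toΓSpecFun.isOpenMap
  have hc : IsIso φ.hom.c := by
    let c : S.sheaf ⟶ (TopCat.Sheaf.pushforward _ φ.hom.base).obj D.sheafedSpace.sheaf := ⟨φ.hom.c⟩
    have : IsIso c := TopCat.Sheaf.isIso_iff_isIso_basis
      (B := fun r : LocallyRingedSpace.Γ.obj (op D.locallyRingedSpace) ↦ PrimeSpectrum.basicOpen r)
      PrimeSpectrum.isBasis_basic_opens (fun s ↦ by
        have e := D.locallyRingedSpace.toΓSpecSheafedSpace_app_eq s
        change IsIso (φ.hom.c.app (op (PrimeSpectrum.basicOpen s)))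
        rw [e]
        exact (ConcreteCategory.isIso_iff_bijective _).mpr (D.bijective_toΓSpecCApp s))
    exact Functor.map_isIso (TopCat.Sheaf.forget _ _) c
  have h1 : IsIso φ.hom := PresheafedSpace.isIso_of_components _
  have h1' : IsIso (SheafedSpace.forgetToPresheafedSpace.map φ) := h1
  have h2 : IsIso φ := isIso_of_reflects_iso φ SheafedSpace.forgetToPresheafedSpace
  have h3 : IsIso (LocallyRingedSpace.forgetToSheafedSpace.map D.locallyRingedSpace.toΓSpec) := h2
  exact isIso_of_reflects_iso _ LocallyRingedSpace.forgetToSheafedSpace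

/-- The restriction of a thickening to an open. -/
def restrict (U : X.Opens) : RingThickening U.toScheme where
  F := U.isOpenEmbedding.functor.op ⋙ D.F
  isSheaf := (D.sheafedSpace.restrict U.isOpenEmbedding).IsSheaf
  ρ := U.isOpenEmbedding.functor.op.whiskerLeft D.ρ
  isUnit V s hs := D.isUnit (U.ι ''ᵁ V) s hs
  isNilpotent V s hs := D.isNilpotent (U.ι ''ᵁ V) s hs
  surjective V hV := D.surjective (U.ι ''ᵁ V) (hV.image_of_isOpenImmersion U.ι)
  exists_eq V hV s W h e t := D.exists_eq (U.ι ''ᵁ V) (hV.image_of_isOpenImmersion U.ι) s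
    (U.ι ''ᵁ W) (U.ι.image_mono h) (by rw [e, Scheme.image_basicOpen, Scheme.Opens.ι_appIso]; rfl) t
  eq_zero V hV s W h e t := D.eq_zero (U.ι ''ᵁ V) (hV.image_of_isOpenImmersion U.ι) s
    (U.ι ''ᵁ W) (U.ι.image_mono h) (by rw [e, Scheme.image_basicOpen, Scheme.Opens.ι_appIso]; rfl) t

/-- The thickening as a scheme. -/
def scheme : Scheme.{0} where
  toLocallyRingedSpace := D.locallyRingedSpace
  local_affine x := by
    obtain ⟨W', ⟨(W : X.Opens), hW, rfl⟩, hxW, -⟩ :=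
      X.isBasis_affineOpens.exists_subset_of_mem_open (a := x) (Set.mem_univ _) isOpen_univ
    have : IsAffine (Scheme.Opens.toScheme W) := hW
    have := @isIso_toΓSpec _ (D.restrict W) this
    exact ⟨⟨W, hxW⟩, _, ⟨@asIso _ _ _ _ (D.restrict W).locallyRingedSpace.toΓSpec this⟩⟩

/-- The inclusion of `X` in its thickening. -/
def inclusion : X ⟶ D.scheme := ⟨D.inclLRS⟩

lemma isAffineOpen_scheme {W : X.Opens} (hW : IsAffineOpen W) :
    IsAffineOpen (X := D.scheme) W := by
  have : IsAffine (Scheme.Opens.toScheme W) := hW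
  have := (D.restrict W).isIso_toΓSpec
  constructor
  exact @isIso_of_reflects_iso _ _ _ _ _ _ (Scheme.Opens.toScheme (X := D.scheme) W).toSpecΓ
    Scheme.forgetToLocallyRingedSpace this _

end RingThickening

/-! ### Lifting sections over affine opens -/

section Affine

variable {X : Scheme.{0}} {W V : X.Opens} (hW : IsAffineOpen W) (f : Γ(X, W)) (h : V ≤ W)
  (hV : V = X.basicOpen f)

include hW hV in
lemma exists_resO_eq_pow_mul (x : Γ(X, V)) :
    ∃ n : ℕ, ∀ N ≥ n, ∃ y, resO h y = resO h f ^ N * x := by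
  subst hV
  have := hW.isLocalization_basicOpen f
  obtain ⟨n, y, hy⟩ := IsLocalization.Away.surj f x
  refine ⟨n, fun N hN ↦ ⟨f ^ (N - n) * y, ?_⟩⟩
  have hy : x * resO h f ^ n = resO h y := hy
  rw [map_mul, ← hy, map_pow, mul_left_comm, mul_comm _ x, ← pow_add, Nat.sub_add_cancel hN,
    mul_comm]

include hW hV in
lemma exists_pow_mul_eq_zero (y : Γ(X, W)) (hy : resO h y = 0) :
    ∃ n : ℕ, ∀ N ≥ n, f ^ N * y = 0 := by
  subst hV
  have := hW.isLocalization_basicOpen f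
  have hy : algebraMap Γ(X, W) Γ(X, X.basicOpen f) y = 0 := hy
  obtain ⟨⟨_, n, rfl⟩, hn⟩ := (IsLocalization.map_eq_zero_iff (Submonoid.powers f) _ y).mp hy
  refine ⟨n, fun N hN ↦ ?_⟩
  rw [← Nat.sub_add_cancel hN, pow_add, mul_assoc, hn, mul_zero]

lemma exists_nat_forall_mem {α : Type*} (s : Finset α) (p : α → ℕ → Prop)
    (hp : ∀ a ∈ s, ∃ n, ∀ N ≥ n, p a N) : ∃ n, ∀ N ≥ n, ∀ a ∈ s, p a N := by
  choose! n hn using hp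
  exact ⟨s.sup n, fun N hN a ha ↦ hn a ha N ((Finset.le_sup ha).trans hN)⟩

lemma eq_inf_basicOpen {W V : X.Opens} (f : Γ(X, W)) (h : V ≤ W) :
    V ⊓ X.basicOpen f = X.basicOpen (resO h f) :=
  (X.basicOpen_res f (homOfLE h).op).symm

end Affine

namespace InjRes

variable {X D : Scheme.{0}} {ι : D ⟶ X} (R : InjRes ι) {W : X.Opens}

/-- The first cohomology of `𝒪` vanishes on affine opens: the ideal of the `a` such that `a • s`
lifts contains powers of the elements of a finite family without common zeros. -/
lemma exists_qI_eq (hW : IsAffineOpen W) (s : Γ(R.J, W)) : ∃ m, R.qI W m = s := by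
  let G : Set Γ(X, W) := {g | ∃ m, R.qI (X.basicOpen g) m = resM R.J (X.basicOpen_le g) s}
  have hG : Ideal.span G = ⊤ := by
    rw [← hW.iSup_basicOpen_eq_self_iff]
    refine le_antisymm (iSup_le fun g ↦ X.basicOpen_le _) fun x hx ↦ ?_
    obtain ⟨V, hV, m, hxV, hm⟩ := R.exists_local_qI_eq s x hx
    obtain ⟨g, hg, hxg⟩ := hW.exists_basicOpen_le ⟨x, hxV⟩ hx
    refine TopologicalSpace.Opens.mem_iSup.mpr ⟨⟨g, resM R.I hg m, ?_⟩, hxg⟩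
    rw [R.qI_res, hm, resM_resM]
  obtain ⟨t, htG, ht⟩ := (Ideal.span_eq_top_iff_finite G).mp hG
  have hle : ∀ g : Γ(X, W), X.basicOpen g ≤ W := X.basicOpen_le
  have hlift : ∀ g : Γ(X, W), g ∈ t → ∃ m, R.qI (X.basicOpen g) m = resM R.J (hle g) s :=
    fun g hg ↦ htG hg
  choose! m hm using hlift
  have hcov : ∀ x ∈ W, ∃ g ∈ t, x ∈ X.basicOpen g := fun x hx ↦ by
    rw [← hW.iSup_basicOpen_eq_self_iff] at ht
    rw [← ht] at hx
    obtain ⟨g, hg⟩ := TopologicalSpace.Opens.mem_iSup.mp hx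
    exact ⟨g.1, g.2, hg⟩
  let 𝔞 : Ideal Γ(X, W) :=
    { carrier := {a | ∃ m, R.qI W m = a • s}
      add_mem' := by
        rintro a b ⟨x, hx⟩ ⟨y, hy⟩
        exact ⟨x + y, by rw [map_add, hx, hy, add_smul]⟩
      zero_mem' := ⟨0, by rw [map_zero, zero_smul]⟩
      smul_mem' := by
        rintro a b ⟨x, hx⟩
        exact ⟨a • x, by rw [map_smul, hx, smul_eq_mul, mul_smul]⟩ }
  suffices hpow : ∀ g ∈ t, ∃ N : ℕ, g ^ N ∈ 𝔞 by
    choose! N hN using hpow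
    have h1 : Ideal.span ((fun g ↦ g ^ N g) '' (t : Set Γ(X, W))) ≤ 𝔞 := by
      rw [Ideal.span_le]
      rintro _ ⟨g, hg, rfl⟩
      exact hN g hg
    have h2 : Ideal.span ((fun g ↦ g ^ N g) '' (t : Set Γ(X, W))) = ⊤ := by
      have := Ideal.span_range_pow_eq_top (t : Set Γ(X, W)) ht (fun g ↦ N g)
      rwa [Set.image_eq_range]
    rw [h2] at h1
    obtain ⟨m, hm⟩ := h1 (show (1 : Γ(X, W)) ∈ _ from trivial)
    exact ⟨m, hm.trans (one_smul _ s)⟩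
  intro g hg
  have hll : ∀ a b : Γ(X, W), X.basicOpen a ⊓ X.basicOpen b ≤ X.basicOpen a := fun a b ↦ inf_le_left
  have hlr : ∀ a b : Γ(X, W), X.basicOpen a ⊓ X.basicOpen b ≤ X.basicOpen b :=
    fun a b ↦ inf_le_right
  have hiW : ∀ a b : Γ(X, W), X.basicOpen a ⊓ X.basicOpen b ≤ W := fun a b ↦ (hll a b).trans (hle a)
  have hx : ∀ a b : Γ(X, W), a ∈ t → b ∈ t → ∃ x, R.jO (X.basicOpen a ⊓ X.basicOpen b) x =
      resM R.I (hll a b) (m a) - resM R.I (hlr a b) (m b) := fun a b ha hb ↦ by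
    refine R.exists_jO_eq _ ?_
    rw [map_sub, R.qI_res, R.qI_res, hm a ha, hm b hb, resM_resM, resM_resM, sub_self]
  choose! x hx using hx
  -- the differences of the local lifts extend, after multiplication by a power of `g`
  obtain ⟨N, hN⟩ := exists_nat_forall_mem t (fun a N ↦ ∃ y, resO (hll a g) y =
      resO (hiW a g) g ^ N * x a g) (fun a ha ↦ by
    obtain ⟨n, hn⟩ := exists_resO_eq_pow_mul (hW.basicOpen a) (resO (hle a) g) (hll a g)
      (eq_inf_basicOpen g (hle a)) (x a g)
    refine ⟨n, fun N hN ↦ ?_⟩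
    obtain ⟨y, hy⟩ := hn N hN
    exact ⟨y, by rw [hy, resO_resO]⟩)
  have hN := hN N le_rfl
  choose! y hy using hN
  let n : ∀ a : Γ(X, W), Γ(R.I, X.basicOpen a) := fun a ↦
    resO (hle a) g ^ N • m a - R.jO _ (y a)
  have hn : ∀ a ∈ t, ∀ (V : X.Opens) (h : V ≤ X.basicOpen a) (h' : V ≤ X.basicOpen g),
      resM R.I h (n a) = resO (h.trans (hle a)) g ^ N • resM R.I h' (m g) := fun a ha V h h' ↦ by
    have h3 : V ≤ X.basicOpen a ⊓ X.basicOpen g := le_inf h h'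
    have h1 : resM R.I h (R.jO _ (y a)) = resO (h.trans (hle a)) g ^ N •
        (resM R.I h (m a) - resM R.I h' (m g)) := by
      rw [← R.jO_res, ← resO_resO (hll a g) h3, hy a ha, map_mul, map_pow, resO_resO,
        ← smul_eq_mul, map_smul, R.jO_res h3, hx a g ha hg, map_sub, resM_resM, resM_resM]
    change resM R.I h (_ - _) = _
    rw [map_sub, h1, resM_smul, map_pow, resO_resO, ← smul_sub, sub_sub_cancel]
  have hz : ∀ a b : Γ(X, W), a ∈ t → b ∈ t → ∃ z, R.jO (X.basicOpen a ⊓ X.basicOpen b) z =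
      resM R.I (hll a b) (n a) - resM R.I (hlr a b) (n b) := fun a b ha hb ↦ by
    refine R.exists_jO_eq _ ?_
    change R.qI _ (resM R.I _ (_ - _) - resM R.I _ (_ - _)) = 0
    simp only [map_sub, R.qI_res, map_smul, R.qI_jO, hm a ha, hm b hb, resM_smul, map_pow,
      resO_resO, resM_resM, map_zero, sub_zero, sub_self]
  choose! z hz using hz
  obtain ⟨M, hM⟩ := exists_nat_forall_mem (t ×ˢ t) (fun a M ↦
      resO (hiW a.1 a.2) g ^ M * z a.1 a.2 = 0) (fun a ha ↦ by
    obtain ⟨ha1, ha2⟩ := Finset.mem_product.mp ha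
    have haff : IsAffineOpen (X.basicOpen a.1 ⊓ X.basicOpen a.2) := by
      rw [eq_inf_basicOpen a.2 (hle a.1)]
      exact (hW.basicOpen a.1).basicOpen _
    refine exists_pow_mul_eq_zero haff _ (inf_le_left :
      X.basicOpen a.1 ⊓ X.basicOpen a.2 ⊓ X.basicOpen g ≤ _) (eq_inf_basicOpen g (hiW a.1 a.2)) _ ?_
    refine R.jO_injective _ ?_
    rw [map_zero, R.jO_res, hz _ _ ha1 ha2, map_sub, resM_resM, resM_resM,
      hn _ ha1 _ _ inf_le_right, hn _ ha2 _ _ inf_le_right, sub_self])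
  have hM := hM M le_rfl
  obtain ⟨t', ht', -⟩ := TopCat.Sheaf.existsUnique_gluing' ⟨R.I.presheaf, R.I.isSheaf⟩
    (fun a : t ↦ X.basicOpen a.1) W (fun a ↦ homOfLE (hle a.1)) (fun x hx ↦ by
      obtain ⟨g, hg, hxg⟩ := hcov x hx
      exact TopologicalSpace.Opens.mem_iSup.mpr ⟨⟨g, hg⟩, hxg⟩)
    (fun a ↦ resO (hle a.1) g ^ M • n a.1) (fun a b ↦ by
      change resM R.I (hll a.1 b.1) _ = resM R.I (hlr a.1 b.1) _
      rw [← sub_eq_zero, resM_smul, resM_smul, map_pow, map_pow, resO_resO, resO_resO, ← smul_sub,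
        ← hz _ _ a.2 b.2, ← map_smul, smul_eq_mul,
        hM (a.1, b.1) (Finset.mem_product.mpr ⟨a.2, b.2⟩), map_zero])
  have ht' : ∀ a : t, resM R.I (hle a.1) t' = resO (hle a.1) g ^ M • n a.1 := ht'
  refine ⟨M + N, t', section_ext _ _ _ fun x hx ↦ ?_⟩
  obtain ⟨a, ha, hxa⟩ := hcov x hx
  refine ⟨X.basicOpen a, hle a, hxa, ?_⟩
  rw [← R.qI_res, ht' ⟨a, ha⟩, map_smul, resM_smul, pow_add, map_mul, mul_smul, map_pow, map_pow]
  change _ • R.qI _ (_ - _) = _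
  rw [map_sub, R.qI_jO, sub_zero, map_smul, hm a ha]

end InjRes

/-! ### The thickening defined by homomorphisms from logarithmic differentials -/

section Model

variable {A : Type} [CommRing A] {X D : Scheme.{0}} {π : X ⟶ Spec (.of A)} {ι : D ⟶ X}
  (R : InjRes ι) {κ : Type} (φ : κ → (logDifferentialsPresheaf π ι ⟶ R.J.val))

/-- The sections over `U` of the structure sheaf of the thickening defined by a family of morphisms
`φ k : Ω¹(log D) ⟶ J`: a section `f` of `𝒪` with lifts to `I` of the sections `φ k (d f)` of
`J = I / 𝒪`. -/
@[ext]
structure ModelSection (U : X.Opens) where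
  fst : Γ(X, U)
  snd : κ → Γ(R.I, U)
  qI_snd : ∀ k, R.qI U (snd k) = dHom (φ k) U fst

namespace ModelSection

variable {R φ} {U V W : X.Opens}

instance : Zero (ModelSection R φ U) := ⟨⟨0, 0, fun k ↦ by simp⟩⟩
instance : Add (ModelSection R φ U) :=
  ⟨fun s t ↦ ⟨s.fst + t.fst, s.snd + t.snd, fun k ↦ by simp [s.qI_snd, t.qI_snd]⟩⟩
instance : Neg (ModelSection R φ U) :=
  ⟨fun s ↦ ⟨-s.fst, -s.snd, fun k ↦ by simp [s.qI_snd]⟩⟩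
instance : One (ModelSection R φ U) := ⟨⟨1, 0, fun k ↦ by simp [dHom_one]⟩⟩
instance : Mul (ModelSection R φ U) :=
  ⟨fun s t ↦ ⟨s.fst * t.fst, fun k ↦ s.fst • t.snd k + t.fst • s.snd k, fun k ↦ by
    rw [map_add, map_smul, map_smul, s.qI_snd, t.qI_snd, dHom_mul]⟩⟩

@[simp] lemma zero_fst : (0 : ModelSection R φ U).fst = 0 := rfl
@[simp] lemma zero_snd : (0 : ModelSection R φ U).snd = 0 := rfl
@[simp] lemma one_fst : (1 : ModelSection R φ U).fst = 1 := rfl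
@[simp] lemma one_snd : (1 : ModelSection R φ U).snd = 0 := rfl
@[simp] lemma add_fst (s t : ModelSection R φ U) : (s + t).fst = s.fst + t.fst := rfl
@[simp] lemma add_snd (s t : ModelSection R φ U) : (s + t).snd = s.snd + t.snd := rfl
@[simp] lemma neg_fst (s : ModelSection R φ U) : (-s).fst = -s.fst := rfl
@[simp] lemma neg_snd (s : ModelSection R φ U) : (-s).snd = -s.snd := rfl
@[simp] lemma mul_fst (s t : ModelSection R φ U) : (s * t).fst = s.fst * t.fst := rfl
@[simp] lemma mul_snd (s t : ModelSection R φ U) (k : κ) :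
    (s * t).snd k = s.fst • t.snd k + t.fst • s.snd k := rfl

instance : CommRing (ModelSection R φ U) :=
  CommRing.ofMinimalAxioms
    (fun a b c ↦ ModelSection.ext (by simp [add_assoc]) (by simp [add_assoc]))
    (fun a ↦ ModelSection.ext (by simp) (by simp))
    (fun a ↦ ModelSection.ext (by simp) (by simp))
    (fun a b c ↦ ModelSection.ext (by simp [mul_assoc]) (by
      funext k
      simp only [mul_snd, mul_fst]
      module))
    (fun a b ↦ ModelSection.ext (by simp [mul_comm]) (by
      funext k
      simp only [mul_snd]
      module))
    (fun a ↦ ModelSection.ext (by simp) (by funext k; simp))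
    (fun a b c ↦ ModelSection.ext (by simp [mul_add]) (by
      funext k
      simp only [mul_snd, add_fst, add_snd, Pi.add_apply]
      module))

@[simp] lemma sub_fst (s t : ModelSection R φ U) : (s - t).fst = s.fst - t.fst := by
  rw [sub_eq_add_neg, sub_eq_add_neg]; rfl

variable (R φ U) in
/-- The projection to the structure sheaf. -/
def fstHom : ModelSection R φ U →+* Γ(X, U) where
  toFun := fst
  map_one' := rfl
  map_mul' _ _ := rfl
  map_zero' := rfl
  map_add' _ _ := rfl

@[simp] lemma pow_fst (s : ModelSection R φ U) (n : ℕ) : (s ^ n).fst = s.fst ^ n :=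
  map_pow (fstHom R φ U) s n

/-- Restriction of sections. -/
def res (h : V ≤ U) : ModelSection R φ U →+* ModelSection R φ V where
  toFun s := ⟨resO h s.fst, fun k ↦ resM R.I h (s.snd k), fun k ↦ by
    rw [R.qI_res, s.qI_snd, dHom_res]⟩
  map_one' := ModelSection.ext (map_one _) (funext fun _ ↦ map_zero _)
  map_mul' s t := ModelSection.ext (map_mul _ _ _) (by
    funext k
    change resM R.I h (_ • _ + _ • _) = _ • resM R.I h _ + _ • resM R.I h _
    rw [map_add, resM_smul, resM_smul])
  map_zero' := ModelSection.ext (map_zero _) (funext fun _ ↦ map_zero _)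
  map_add' s t := ModelSection.ext (map_add _ _ _) (funext fun _ ↦ map_add _ _ _)

@[simp] lemma res_fst (h : V ≤ U) (s : ModelSection R φ U) : (res h s).fst = resO h s.fst := rfl
@[simp] lemma res_snd (h : V ≤ U) (s : ModelSection R φ U) (k : κ) :
    (res h s).snd k = resM R.I h (s.snd k) := rfl

variable (R φ) in
/-- The section with zero image in `𝒪` given by a family of sections of `𝒪`. -/
def inr (x : κ → Γ(X, U)) : ModelSection R φ U :=
  ⟨0, fun k ↦ R.jO U (x k), fun k ↦ by rw [R.qI_jO, map_zero]⟩

lemma inr_injective : Function.Injective (inr R φ (U := U)) := fun _ _ h ↦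
  funext fun k ↦ R.jO_injective U (congrFun (congrArg snd h) k)

lemma inr_add (x y : κ → Γ(X, U)) : inr R φ (x + y) = inr R φ x + inr R φ y :=
  ModelSection.ext (by simp [inr]) (by funext k; simp [inr])

lemma mul_inr (s : ModelSection R φ U) (x : κ → Γ(X, U)) :
    s * inr R φ x = inr R φ (s.fst • x) :=
  ModelSection.ext (by simp [inr]) (by
    funext k
    rw [mul_snd]
    change s.fst • R.jO U (x k) + (0 : Γ(X, U)) • s.snd k = R.jO U (s.fst • x k)
    rw [zero_smul, add_zero, map_smul])

lemma res_inr (h : V ≤ U) (x : κ → Γ(X, U)) :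
    res h (inr R φ x) = inr R φ (fun k ↦ resO h (x k)) :=
  ModelSection.ext (map_zero _) (by funext k; simp [inr, R.jO_res])

lemma exists_eq_inr (s : ModelSection R φ U) (hs : s.fst = 0) : ∃ x, s = inr R φ x := by
  have := fun k ↦ R.exists_jO_eq (s.snd k) (by rw [s.qI_snd, hs, map_zero])
  choose x hx using this
  exact ⟨x, ModelSection.ext hs (funext fun k ↦ (hx k).symm)⟩

lemma isUnit_of_isUnit_fst (s : ModelSection R φ U) (hs : IsUnit s.fst) : IsUnit s := by
  obtain ⟨v, hv⟩ := hs.exists_right_inv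
  refine IsUnit.of_mul_eq_one ⟨v, fun k ↦ -(v * v) • s.snd k, fun k ↦ ?_⟩
    (ModelSection.ext hv ?_)
  · have h1 := dHom_mul (φ k) s.fst v
    rw [hv, dHom_one] at h1
    have h2 : dHom (φ k) U v = v • s.fst • dHom (φ k) U v := by
      rw [smul_smul, mul_comm v, hv, one_smul]
    rw [h2, eq_neg_of_add_eq_zero_left h1.symm, map_smul, s.qI_snd, smul_neg, smul_smul, neg_smul]
  · funext k
    change s.fst • (-(v * v) • s.snd k) + v • s.snd k = 0
    rw [smul_smul, ← add_smul, mul_neg, ← mul_assoc, hv, one_mul, neg_add_cancel, zero_smul]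

lemma exists_fst_eq (hW : IsAffineOpen W) (f : Γ(X, W)) : ∃ s : ModelSection R φ W, s.fst = f := by
  have := fun k ↦ R.exists_qI_eq hW (dHom (φ k) W f)
  choose m hm using this
  exact ⟨⟨f, m, hm⟩, rfl⟩

lemma exists_nat_forall [Finite κ] (p : κ → ℕ → Prop) (hp : ∀ k, ∃ n, ∀ N ≥ n, p k N) :
    ∃ n, ∀ k, p k n := by
  have := Fintype.ofFinite κ
  obtain ⟨n, hn⟩ := exists_nat_forall_mem Finset.univ p (fun k _ ↦ hp k)
  exact ⟨n, fun k ↦ hn n le_rfl k (Finset.mem_univ k)⟩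

variable [Finite κ]

lemma exists_pow_mul_eq_zero_of_res (hW : IsAffineOpen W) (s : ModelSection R φ W) (h : V ≤ W)
    (hV : V = X.basicOpen s.fst) (t : ModelSection R φ W) (ht : res h t = 0) :
    ∃ n : ℕ, s ^ n * t = 0 := by
  obtain ⟨n, hn⟩ := exists_pow_mul_eq_zero hW s.fst h hV t.fst (congrArg fst ht)
  obtain ⟨x, hx⟩ := exists_eq_inr (s ^ n * t) (by rw [mul_fst, pow_fst, hn n le_rfl])
  have h1 : inr R φ (fun k ↦ resO h (x k)) = inr R φ 0 := by
    rw [← res_inr, ← hx, map_mul, ht, mul_zero]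
    exact ModelSection.ext rfl (funext fun _ ↦ (map_zero (R.jO V)).symm)
  have h2 := congrFun (inr_injective h1)
  obtain ⟨m, hm⟩ := exists_nat_forall (fun k N ↦ s.fst ^ N * x k = 0)
    (fun k ↦ exists_pow_mul_eq_zero hW s.fst h hV (x k) (h2 k))
  refine ⟨m + n, ?_⟩
  rw [pow_add, mul_assoc, hx, mul_inr, pow_fst]
  have h3 : s.fst ^ m • x = 0 := funext hm
  rw [h3]
  exact ModelSection.ext rfl (funext fun _ ↦ map_zero (R.jO W))

lemma exists_res_eq_pow_mul (hW : IsAffineOpen W) (s : ModelSection R φ W) (h : V ≤ W)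
    (hV : V = X.basicOpen s.fst) (t : ModelSection R φ V) :
    ∃ (n : ℕ) (t' : ModelSection R φ W), res h t' = res h s ^ n * t := by
  obtain ⟨n, hn⟩ := exists_resO_eq_pow_mul hW s.fst h hV t.fst
  obtain ⟨a, ha⟩ := hn n le_rfl
  obtain ⟨t₀, rfl⟩ := exists_fst_eq (R := R) (φ := φ) hW a
  obtain ⟨x, hx⟩ := exists_eq_inr (res h s ^ n * t - res h t₀) (by
    rw [sub_fst, mul_fst, pow_fst, res_fst, res_fst, ha, sub_self])
  obtain ⟨m, hm⟩ := exists_nat_forall (fun k N ↦ ∃ y, resO h y = resO h s.fst ^ N * x k)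
    (fun k ↦ exists_resO_eq_pow_mul hW s.fst h hV (x k))
  choose y hy using hm
  refine ⟨m + n, s ^ m * t₀ + inr R φ y, ?_⟩
  have h1 : res h (inr R φ y) = res h s ^ m * inr R φ x := by
    rw [res_inr, mul_inr]
    congr 1
    funext k
    rw [hy, pow_fst, res_fst]
    rfl
  rw [map_add, h1, map_mul, map_pow, ← hx]
  ring

end ModelSection

/-- The sheaf of rings of the thickening, as a presheaf. -/
def modelPresheaf : TopCat.Presheaf CommRingCat.{0} X where
  obj U := .of (ModelSection R φ U.unop)
  map i := CommRingCat.ofHom (ModelSection.res (leOfHom i.unop))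
  map_id _ := CommRingCat.hom_ext (RingHom.ext fun _ ↦
    ModelSection.ext (resO_self _ _) (funext fun _ ↦ resM_self _ _ _))
  map_comp _ _ := CommRingCat.hom_ext (RingHom.ext fun _ ↦
    ModelSection.ext (resO_resO _ _ _).symm (funext fun _ ↦ (resM_resM _ _ _ _).symm))

lemma isSheaf_modelPresheaf : (modelPresheaf R φ).IsSheaf := by
  rw [TopCat.Presheaf.isSheaf_iff_isSheafUniqueGluing]
  intro α U s hs
  have hs : ∀ i j, ModelSection.res inf_le_left (s i : ModelSection R φ (U i)) =
      ModelSection.res (V := U i ⊓ U j) inf_le_right (s j : ModelSection R φ (U j)) := hs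
  let s' : ∀ i, ModelSection R φ (U i) := s
  have hle : ∀ i, U i ≤ iSup U := le_iSup U
  obtain ⟨f, hf, hf'⟩ := X.sheaf.existsUnique_gluing' U (iSup U) (fun i ↦ homOfLE (hle i)) le_rfl
    (fun i ↦ (s' i).fst) (fun i j ↦ congrArg ModelSection.fst (hs i j))
  have hm := fun k ↦ TopCat.Sheaf.existsUnique_gluing' ⟨R.I.presheaf, R.I.isSheaf⟩ U (iSup U)
    (fun i ↦ homOfLE (hle i)) le_rfl (fun i ↦ (s' i).snd k)
    (fun i j ↦ congrFun (congrArg ModelSection.snd (hs i j)) k)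
  choose m hm hm' using hm
  let f : Γ(X, iSup U) := f
  have hf : ∀ i, resO (hle i) f = (s' i).fst := hf
  have hm : ∀ k i, resM R.I (hle i) (m k) = (s' i).snd k := hm
  refine ⟨(⟨f, m, fun k ↦ section_ext _ _ _ fun x hx ↦ ?_⟩ : ModelSection R φ (iSup U)),
    fun i ↦ ModelSection.ext (hf i) (funext fun k ↦ hm k i), fun t ht ↦ ?_⟩
  · obtain ⟨i, hi⟩ := TopologicalSpace.Opens.mem_iSup.mp hx
    exact ⟨U i, hle i, hi, by rw [← R.qI_res, hm, (s' i).qI_snd, ← dHom_res, hf]⟩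
  · exact ModelSection.ext (hf' _ fun i ↦ congrArg ModelSection.fst (ht i))
      (funext fun k ↦ hm' k _ fun i ↦ congrFun (congrArg ModelSection.snd (ht i)) k)

/-- The thickening defined by a finite family of morphisms `φ k : Ω¹(log D) ⟶ J`. -/
def modelThickening [Finite κ] : RingThickening X where
  F := modelPresheaf R φ
  isSheaf := isSheaf_modelPresheaf R φ
  ρ := { app := fun U ↦ CommRingCat.ofHom (ModelSection.fstHom R φ U.unop) }
  isUnit _ s hs := ModelSection.isUnit_of_isUnit_fst s hs
  isNilpotent U s hs := by
    obtain ⟨x, hx⟩ := ModelSection.exists_eq_inr (s : ModelSection R φ U) hs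
    refine ⟨2, ?_⟩
    rw [pow_two]
    refine (congrArg (s * ·) hx).trans ((ModelSection.mul_inr s x).trans ?_)
    have hs : ModelSection.fst s = 0 := hs
    rw [hs, zero_smul]
    exact ModelSection.ext rfl (funext fun _ ↦ map_zero (R.jO U))
  surjective _ hU f := ModelSection.exists_fst_eq hU f
  exists_eq _ hU s _ h e t := ModelSection.exists_res_eq_pow_mul hU s h e t
  eq_zero _ hU s _ h e t ht := ModelSection.exists_pow_mul_eq_zero_of_res hU s h e t ht

end Model

/-! ### Closed subschemes and morphisms to affine schemes -/

section Closed

variable {X Z T : Scheme.{0}} {A B : Type} [CommRing A] [CommRing B] {α : B →+* A}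

/-- The morphism to `Spec B` given by a ring homomorphism from `B` to the global sections. -/
def specHom (g : B →+* Γ(Z, ⊤)) : Z ⟶ Spec (.of B) := Z.toSpecΓ ≫ Spec.map (CommRingCat.ofHom g)

lemma structHom_specHom (g : B →+* Γ(Z, ⊤)) (V : Z.Opens) (b : B) :
    structHom (specHom g) V b = resO le_top (g b) := by
  have h1 : (Scheme.ΓSpecIso (.of B)).inv ≫ (specHom g).appTop = CommRingCat.ofHom g := by
    rw [specHom, Scheme.Hom.comp_appTop, ← Scheme.ΓSpecIso_inv_naturality_assoc,
      Scheme.toSpecΓ_appTop, Iso.inv_hom_id, Category.comp_id]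
  exact congrArg (resO le_top) (ConcreteCategory.congr_hom h1 b)

lemma hom_ext_of_structHom {a b : Z ⟶ Spec (.of B)}
    (h : ∀ x, structHom a ⊤ x = structHom b ⊤ x) : a = b := by
  refine ext_to_Spec (CommRingCat.hom_ext (RingHom.ext fun x ↦ ?_))
  have h1 := h x
  change resO _ _ = resO _ _ at h1
  rw [resO_self, resO_self] at h1
  exact h1

lemma app_eq_zero_of_locally (a : T ⟶ Z) {V : Z.Opens} (s : Γ(Z, V))
    (h : ∀ z ∈ V, ∃ (W : Z.Opens) (hW : W ≤ V), z ∈ W ∧ a.app W (resO hW s) = 0) :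
    a.app V s = 0 := by
  refine TopCat.Presheaf.section_ext T.sheaf (a ⁻¹ᵁ V) _ _ fun t ht ↦ ?_
  obtain ⟨W, hW, htW, e⟩ := h (a t) ht
  rw [app_resO a hW (a.preimage_mono hW)] at e
  have h1 := T.presheaf.germ_res_apply (homOfLE (a.preimage_mono hW)) t htW (a.app V s)
  refine Eq.trans h1.symm (Eq.trans (congrArg _ e) ?_)
  exact (map_zero _).trans (map_zero _).symm

lemma ker_le_ker {f : X ⟶ Z} [QuasiCompact f] {a : T ⟶ Z}
    (h : ∀ V, IsAffineOpen V → ∀ s, f.app V s = 0 → a.app V s = 0) : f.ker ≤ a.ker := by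
  refine Scheme.IdealSheafData.le_ofIdeals_iff.mpr fun V s hs ↦ ?_
  rw [Scheme.Hom.ker_apply] at hs
  exact h V.1 V.2 s hs

/-- A morphism to a scheme factors through a closed subscheme if it kills its equations. -/
lemma exists_lift_of_isClosedImmersion (f : X ⟶ Z) [IsClosedImmersion f] (a : T ⟶ Z)
    (h : ∀ V, IsAffineOpen V → ∀ s, f.app V s = 0 → a.app V s = 0) : ∃ l : T ⟶ X, l ≫ f = a :=
  ⟨IsClosedImmersion.lift f a (ker_le_ker h), IsClosedImmersion.lift_fac _ _ _⟩

lemma isPullback_of_ker_le {i : X ⟶ Z} [IsClosedImmersion i] {πX : X ⟶ Spec (.of A)}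
    {πZ : Z ⟶ Spec (.of B)} (hα : Function.Surjective α)
    (h : i ≫ πZ = πX ≫ Spec.map (CommRingCat.ofHom α))
    (hker : ∀ V, IsAffineOpen V → RingHom.ker (i.app V).hom ≤
      (RingHom.ker α).map (structHom πZ V)) :
    IsPullback i πX πZ (Spec.map (CommRingCat.ofHom α)) := by
  have : IsClosedImmersion (Spec.map (CommRingCat.ofHom α)) :=
    IsClosedImmersion.spec_of_surjective _ hα
  have key (s : Limits.PullbackCone πZ (Spec.map (CommRingCat.ofHom α))) :
      ∃ l : s.pt ⟶ X, l ≫ i = s.fst := by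
    refine exists_lift_of_isClosedImmersion i s.fst fun V hV x hx ↦ ?_
    have h1 : (RingHom.ker α).map (structHom πZ V) ≤ RingHom.ker (s.fst.app V).hom := by
      rw [Ideal.map_le_iff_le_comap]
      intro b hb
      have hb : α b = 0 := hb
      change s.fst.app V (structHom πZ V b) = 0
      rw [app_structHom s.condition, hb, map_zero]
    exact h1 (hker V hV hx)
  choose l hl using key
  refine ⟨⟨h⟩, ⟨Limits.PullbackCone.IsLimit.mk _ l hl (fun s ↦ ?_) (fun s m hm _ ↦ ?_)⟩⟩
  · rw [← cancel_mono (Spec.map (CommRingCat.ofHom α)), Category.assoc, ← h, reassoc_of% hl,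
      s.condition]
  · rw [← cancel_mono i, hl, hm]

lemma flat_of_structHom {π : Z ⟶ Spec (.of B)}
    (h : ∀ z : Z, ∃ V : Z.Opens, IsAffineOpen V ∧ z ∈ V ∧ (structHom π V).Flat) : Flat π := by
  choose V hV hzV hF using h
  refine HasRingHomProperty.of_iSup_eq_top (P := @Flat) (fun z ↦ ⟨V z, hV z⟩)
    (top_le_iff.mp fun z _ ↦ TopologicalSpace.Opens.mem_iSup.mpr ⟨z, hzV z⟩) fun z ↦ ?_
  have h2 : (Scheme.ΓSpecIso (.of B)).hom.hom.Flat :=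
    RingHom.Flat.of_bijective (ConcreteCategory.bijective_of_isIso (Scheme.ΓSpecIso (.of B)).hom)
  have h3 := RingHom.Flat.comp h2 (hF z)
  have e : π.appLE ⊤ (V z) le_top =
      (Scheme.ΓSpecIso (.of B)).hom ≫ CommRingCat.ofHom (structHom π (V z)) := by
    rw [structHom_eq_appLE π (V z) le_top, Iso.hom_inv_id_assoc]
  rw [e]
  exact h3

end Closed

/-! ### The divisor of the thickening -/

section ModelDivisor

variable {A : Type} [CommRing A] {X D : Scheme.{0}} {π : X ⟶ Spec (.of A)} {ι : D ⟶ X}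
  {R : InjRes ι} {κ : Type} {φ : κ → (logDifferentialsPresheaf π ι ⟶ R.J.val)}
  {U V W : X.Opens}

lemma exists_unit_of_mem_localEquations (hU : IsAffineOpen U) {g g' : Γ(X, U)}
    (hg : g ∈ localEquations ι U) (hg' : g' ∈ localEquations ι U) :
    ∃ u : Γ(X, U)ˣ, g' = u * g := by
  have h1 := ker_app_eq_of_mem_localEquations hU hg
  rw [ker_app_eq_of_mem_localEquations hU hg'] at h1
  have h2 : g' ∈ Ideal.span {g} := h1 ▸ Ideal.mem_span_singleton_self g'
  have h3 : g ∈ Ideal.span {g'} := h1 ▸ Ideal.mem_span_singleton_self g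
  obtain ⟨u, hu⟩ := Ideal.mem_span_singleton'.mp h2
  obtain ⟨v, hv⟩ := Ideal.mem_span_singleton'.mp h3
  have h4 : v * u = 1 := by
    refine (mul_cancel_right_mem_nonZeroDivisors
      (mem_nonZeroDivisors_of_mem_localEquations hU hg)).mp ?_
    rw [mul_assoc, hu, hv, one_mul]
  exact ⟨⟨u, v, by rw [mul_comm, h4], h4⟩, hu.symm⟩

lemma exists_isAffineOpen_le {x : X} (hx : x ∈ U) : ∃ V, IsAffineOpen V ∧ x ∈ V ∧ V ≤ U := by
  obtain ⟨_, ⟨W, hW, rfl⟩, hxW, hWV⟩ := X.isBasis_affineOpens.exists_subset_of_mem_open hx U.2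
  exact ⟨W, hW, hxW, hWV⟩

lemma eq_zero_of_mul_eq_zero_of_mem_localEquations (R : InjRes ι) {g a : Γ(X, U)}
    (hg : g ∈ localEquations ι U) (h : g * a = 0) : a = 0 := by
  refine R.jO_injective U ((R.bijective_smul U g hg).1 ?_)
  change g • R.jO U a = g • R.jO U 0
  rw [← map_smul, smul_eq_mul, h, map_zero, smul_zero]

namespace ModelSection

/-- The equations of the divisor of the thickening: sections `(g, g ℓ)`, where `g` is an equation
of `D` and `ℓ` lifts `dlog g`. -/
def IsEquation (e : ModelSection R φ U) : Prop :=
  ∃ (hg : e.fst ∈ localEquations ι U) (ℓ : κ → Γ(R.I, U)), ∀ k, e.fst • ℓ k = e.snd k ∧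
    R.qI U (ℓ k) = dlogHom (φ k) U ⟨e.fst, hg⟩

lemma IsEquation.res {e : ModelSection R φ U} (he : e.IsEquation) (h : V ≤ U) :
    (res h e).IsEquation := by
  obtain ⟨hg, ℓ, hℓ⟩ := he
  refine ⟨resO_mem_localEquations h hg, fun k ↦ resM R.I h (ℓ k), fun k ↦ ⟨?_, ?_⟩⟩
  · rw [res_fst, ← resM_smul, (hℓ k).1, res_snd]
  · rw [R.qI_res, (hℓ k).2, ← dlogHom_res]
    rfl

variable (R φ) in
lemma exists_isEquation (hU : IsAffineOpen U) {g : Γ(X, U)} (hg : g ∈ localEquations ι U) :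
    ∃ e : ModelSection R φ U, e.IsEquation ∧ e.fst = g := by
  choose ℓ hℓ using fun k ↦ R.exists_qI_eq hU (dlogHom (φ k) U ⟨g, hg⟩)
  exact ⟨⟨g, fun k ↦ g • ℓ k, fun k ↦ by rw [map_smul, hℓ]; exact smul_dlogHom (φ k) ⟨g, hg⟩⟩,
    ⟨hg, ℓ, fun k ↦ ⟨rfl, hℓ k⟩⟩, rfl⟩

lemma IsEquation.eq_zero {e : ModelSection R φ U} (he : e.IsEquation) {s : ModelSection R φ U}
    (h : e * s = 0) : s = 0 := by
  obtain ⟨hg, ℓ, hℓ⟩ := he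
  have h1 : s.fst = 0 := eq_zero_of_mul_eq_zero_of_mem_localEquations R hg (congrArg fst h)
  refine ModelSection.ext h1 (funext fun k ↦ (R.bijective_smul U _ hg).1 ?_)
  have h2 := congrFun (congrArg snd h) k
  rw [mul_snd, h1, zero_smul, add_zero] at h2
  exact h2.trans (smul_zero _).symm

/-- Over an affine open an equation `(g, g ℓ)` divides `(u g, u g ℓ')`: the quotient is
`(u, u (ℓ' - ℓ))`, where `ℓ' - ℓ` lifts `u⁻¹ du` because `dlog (u g) = dlog g + u⁻¹ du`. -/
lemma IsEquation.dvd_of_isAffineOpen {e e' : ModelSection R φ U} (he : e.IsEquation)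
    (he' : e'.IsEquation) (hU : IsAffineOpen U) : e ∣ e' := by
  obtain ⟨hg, ℓ, hℓ⟩ := he
  obtain ⟨hg', ℓ', hℓ'⟩ := he'
  obtain ⟨u, hu⟩ := exists_unit_of_mem_localEquations hU hg hg'
  refine ⟨⟨u, fun k ↦ u.1 • (ℓ' k - ℓ k), fun k ↦ ?_⟩, ModelSection.ext ?_ (funext fun k ↦ ?_)⟩
  · rw [map_smul, map_sub, (hℓ k).2, (hℓ' k).2, dlogHom_of_eq_mul (φ k) ⟨_, hg⟩ ⟨_, hg'⟩ u hu,
      add_sub_cancel_left, smul_smul, Units.mul_inv, one_smul]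
  · exact hu.trans (mul_comm _ _)
  · rw [mul_snd, ← (hℓ k).1]
    refine (hℓ' k).1.symm.trans ((congrArg (· • ℓ' k) hu).trans ?_)
    change (u.1 * e.fst) • ℓ' k = e.fst • u.1 • (ℓ' k - ℓ k) + u.1 • e.fst • ℓ k
    module

lemma res_res (h : V ≤ U) (h' : W ≤ V) (s : ModelSection R φ U) :
    ModelSection.res h' (ModelSection.res h s) = ModelSection.res (h'.trans h) s :=
  ModelSection.ext (resO_resO _ _ _) (funext fun _ ↦ resM_resM _ _ _ _)

lemma res_self (h : U ≤ U) (s : ModelSection R φ U) : ModelSection.res h s = s :=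
  ModelSection.ext (resO_self _ _) (funext fun _ ↦ resM_self _ _ _)

lemma ext_of_locally {s t : ModelSection R φ U}
    (h : ∀ x ∈ U, ∃ (V : X.Opens) (hV : V ≤ U), x ∈ V ∧
      ModelSection.res hV s = ModelSection.res hV t) : s = t := by
  refine TopCat.Presheaf.section_ext ⟨modelPresheaf R φ, isSheaf_modelPresheaf R φ⟩ U _ _
    fun x hx ↦ ?_
  obtain ⟨V, hV, hxV, e⟩ := h x hx
  have h1 := fun s : ModelSection R φ U ↦
    TopCat.Presheaf.germ_res_apply (modelPresheaf R φ) (homOfLE hV) x hxV s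
  exact (h1 s).symm.trans ((congrArg _ e).trans (h1 t))

/-- Divisibility by an equation is a local property, as the quotient is unique. -/
lemma IsEquation.dvd_of_locally {e : ModelSection R φ U} (he : e.IsEquation)
    {s : ModelSection R φ U} (h : ∀ x ∈ U, ∃ (V : X.Opens) (hV : V ≤ U), x ∈ V ∧
      ModelSection.res hV e ∣ ModelSection.res hV s) : e ∣ s := by
  choose V hV hxV t ht using fun x : U ↦ h x.1 x.2
  obtain ⟨t', ht', -⟩ := TopCat.Sheaf.existsUnique_gluing'
    ⟨modelPresheaf R φ, isSheaf_modelPresheaf R φ⟩ V U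
    (fun x ↦ homOfLE (hV x)) (fun x hx ↦ TopologicalSpace.Opens.mem_iSup.mpr ⟨⟨x, hx⟩, hxV _⟩) t
    (fun x y ↦ by
      have h1 := congrArg (ModelSection.res (inf_le_left : V x ⊓ V y ≤ V x)) (ht x)
      have h2 := congrArg (ModelSection.res (inf_le_right : V x ⊓ V y ≤ V y)) (ht y)
      rw [map_mul, res_res, res_res] at h1 h2
      rw [h1] at h2
      change ModelSection.res (inf_le_left : V x ⊓ V y ≤ V x) (t x) =
        ModelSection.res (inf_le_right : V x ⊓ V y ≤ V y) (t y)
      refine sub_eq_zero.mp ((he.res (inf_le_left.trans (hV x))).eq_zero ?_)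
      rw [mul_sub, h2]
      exact sub_self _)
  let t' : ModelSection R φ U := t'
  have ht' : ∀ x, ModelSection.res (hV x) t' = t x := ht'
  refine ⟨t', ext_of_locally fun x hx ↦ ⟨V ⟨x, hx⟩, hV _, hxV _, ?_⟩⟩
  rw [map_mul, ht, ht']

lemma IsEquation.dvd {e e' : ModelSection R φ U} (he : e.IsEquation) (he' : e'.IsEquation) :
    e ∣ e' :=
  he.dvd_of_locally fun _ hx ↦ by
    obtain ⟨V, hV, hxV, h⟩ := exists_isAffineOpen_le hx
    exact ⟨V, h, hxV, (he.res h).dvd_of_isAffineOpen (he'.res h) hV⟩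

variable (R φ U) in
/-- The ideal of the divisor of the thickening: the sections that are divisible by all equations
wherever these are defined. -/
def ideal : Ideal (ModelSection R φ U) where
  carrier := {s | ∀ (V : X.Opens) (h : V ≤ U) (e : ModelSection R φ V), e.IsEquation →
    e ∣ ModelSection.res h s}
  add_mem' hs ht V h e he := by
    rw [map_add]; exact dvd_add (hs V h e he) (ht V h e he)
  zero_mem' V h e he := by rw [map_zero]; exact dvd_zero _
  smul_mem' a s hs V h e he := by
    rw [smul_eq_mul, map_mul]; exact (hs V h e he).mul_left _

lemma mem_ideal_iff_dvd {e : ModelSection R φ U} (he : e.IsEquation) {s : ModelSection R φ U} :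
    s ∈ ideal R φ U ↔ e ∣ s := by
  refine ⟨fun h ↦ ?_, fun h V hV e' he' ↦ ?_⟩
  · have := h U le_rfl e he
    rwa [res_self] at this
  · exact (he'.dvd (he.res hV)).trans (map_dvd _ h)

lemma res_mem_ideal {s : ModelSection R φ U} (hs : s ∈ ideal R φ U) (h : V ≤ U) :
    ModelSection.res h s ∈ ideal R φ V := fun W hW e he ↦ by
  rw [res_res]; exact hs W _ e he

lemma mem_ideal_of_locally {s : ModelSection R φ U} (h : ∀ x ∈ U, ∃ (V : X.Opens) (hV : V ≤ U),
    x ∈ V ∧ ModelSection.res hV s ∈ ideal R φ V) : s ∈ ideal R φ U := fun W hW e he ↦ by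
  refine he.dvd_of_locally fun x hx ↦ ?_
  obtain ⟨V, hV, hxV, hs⟩ := h x (hW hx)
  refine ⟨W ⊓ V, inf_le_left, ⟨hx, hxV⟩, ?_⟩
  have := hs (W ⊓ V) inf_le_right _ (he.res inf_le_left)
  rw [res_res] at this ⊢
  exact this

lemma exists_affine_equation_cover (hD : IsEffectiveCartier ι) (hU : IsAffineOpen U) :
    ∃ t : Finset Γ(X, U), (∀ x ∈ U, ∃ f ∈ t, x ∈ X.basicOpen f) ∧
      ∀ f ∈ t, (localEquations ι (X.basicOpen f)).Nonempty := by
  let G : Set Γ(X, U) := {f | (localEquations ι (X.basicOpen f)).Nonempty}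
  have hG : Ideal.span G = ⊤ := by
    rw [← hU.iSup_basicOpen_eq_self_iff]
    refine le_antisymm (iSup_le fun f ↦ X.basicOpen_le _) fun x hx ↦ ?_
    obtain ⟨V, hxV, g, hg⟩ := hD x
    obtain ⟨f, hf, hxf⟩ := hU.exists_basicOpen_le ⟨x, hxV⟩ hx
    exact TopologicalSpace.Opens.mem_iSup.mpr ⟨⟨f, _, resO_mem_localEquations hf hg⟩, hxf⟩
  obtain ⟨t, htG, ht⟩ := (Ideal.span_eq_top_iff_finite G).mp hG
  refine ⟨t, fun x hx ↦ ?_, fun f hf ↦ htG hf⟩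
  rw [← hU.iSup_basicOpen_eq_self_iff] at ht
  rw [← ht] at hx
  obtain ⟨g, hg⟩ := TopologicalSpace.Opens.mem_iSup.mp hx
  exact ⟨g.1, g.2, hg⟩

/-- The ideal of the divisor is quasi-coherent: up to a power of `s`, its sections over a basic open
of `s` extend. -/
lemma exists_mem_ideal_res_eq [Finite κ] (hD : IsEffectiveCartier ι) (hU : IsAffineOpen U)
    (s : ModelSection R φ U) (h : V ≤ U) (hV : V = X.basicOpen s.fst) (t : ModelSection R φ V)
    (ht : t ∈ ideal R φ V) :
    ∃ (n : ℕ) (t' : ModelSection R φ U), t' ∈ ideal R φ U ∧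
      ModelSection.res h t' = ModelSection.res h s ^ n * t := by
  obtain ⟨n, t₀, ht₀⟩ := exists_res_eq_pow_mul hU s h hV t
  obtain ⟨C, hC, hC'⟩ := exists_affine_equation_cover hD hU
  obtain ⟨N, hN⟩ := exists_nat_forall_mem C (fun f N ↦
    ModelSection.res (X.basicOpen_le f) (s ^ N * t₀) ∈ ideal R φ (X.basicOpen f)) (fun f hf ↦ by
      obtain ⟨g, hg⟩ := hC' f hf
      have hle := X.basicOpen_le f
      have haff := hU.basicOpen f
      obtain ⟨e, he, -⟩ := exists_isEquation R φ haff hg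
      have hl : X.basicOpen f ⊓ V ≤ X.basicOpen f := inf_le_left
      have hr : X.basicOpen f ⊓ V ≤ V := inf_le_right
      have hb : X.basicOpen f ⊓ V = X.basicOpen (ModelSection.res hle s).fst := by
        rw [hV]
        exact eq_inf_basicOpen s.fst hle
      have h1 : ModelSection.res (hl.trans hle) t₀ ∈ ideal R φ (X.basicOpen f ⊓ V) := by
        rw [← res_res h hr, ht₀, map_mul]
        exact Ideal.mul_mem_left _ _ (res_mem_ideal ht hr)
      obtain ⟨r, hr⟩ := (mem_ideal_iff_dvd (he.res hl)).mp h1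
      obtain ⟨m, r', hr'⟩ := exists_res_eq_pow_mul haff (ModelSection.res hle s) hl hb r
      obtain ⟨m', hm'⟩ := exists_pow_mul_eq_zero_of_res haff (ModelSection.res hle s) hl hb
        (ModelSection.res hle s ^ m * ModelSection.res hle t₀ - e * r') (by
          rw [map_sub, map_mul, map_pow, map_mul, hr', res_res, res_res, hr]
          ring)
      refine ⟨m + m', fun N hN ↦ (mem_ideal_iff_dvd he).mpr ?_⟩
      obtain ⟨d, rfl⟩ := Nat.exists_eq_add_of_le hN
      refine ⟨ModelSection.res hle s ^ (m' + d) * r', ?_⟩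
      rw [map_mul, map_pow]
      linear_combination (ModelSection.res hle s ^ d) * hm')
  refine ⟨N + n, s ^ N * t₀, mem_ideal_of_locally fun x hx ↦ ?_, ?_⟩
  · obtain ⟨f, hf, hxf⟩ := hC x hx
    exact ⟨_, X.basicOpen_le f, hxf, hN N le_rfl f hf⟩
  · rw [map_mul, map_pow, ht₀, pow_add, mul_assoc]

end ModelSection

end ModelDivisor

/-! ### The deformation defined by homomorphisms from logarithmic differentials -/

namespace RingThickening

variable {X : Scheme.{0}} (D : RingThickening X)

instance : IsClosedImmersion D.inclusion where
  stalkMap_surjective x t := by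
    obtain ⟨U, hx, f, rfl⟩ := TopCat.Presheaf.exists_germ_eq (F := X.presheaf) (x := (x : X)) t
    obtain ⟨V, hV, hxV, h⟩ := exists_isAffineOpen_le hx
    obtain ⟨s, hs⟩ := D.surjective V hV (resO h f)
    refine ⟨D.F.germ V x hxV s, ?_⟩
    refine (ConcreteCategory.congr_hom (PresheafedSpace.stalkMap_germ D.incl V x hxV) s).trans ?_
    refine (congrArg (X.presheaf.germ V x hxV) hs).trans ?_
    exact TopCat.Presheaf.germ_res_apply X.presheaf (homOfLE h) x hxV f
  isClosedEmbedding := Topology.IsClosedEmbedding.id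

lemma isAffineOpen_of_scheme {W : X.Opens} (hW : IsAffineOpen (X := D.scheme) W) :
    IsAffineOpen W :=
  IsAffineOpen.preimage hW D.inclusion

lemma basicOpen_scheme (W : X.Opens) (s : Γ(D.scheme, W)) :
    D.scheme.basicOpen s = X.basicOpen (D.ρ.app (op W) s) :=
  Scheme.preimage_basicOpen D.inclusion s

end RingThickening

section ModelDeformation

variable {A M : Type} [CommRing A] {P : FlatPair A} [AddCommGroup M] [Module A M]
  [Module Aᵐᵒᵖ M] [IsCentralScalar A M] (R : InjRes P.ι) {κ : Type} [Finite κ]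
  (φ : κ → (logDifferentialsPresheaf P.π P.ι ⟶ R.J.val))

/-- The scalars of the thickening defined by a family `φ k`. -/
def ModelSection.scalar (c : M →ₗ[A] (κ → A)) (U : P.X.Opens) :
    TrivSqZeroExt A M →+* ModelSection R φ U where
  toFun b := ⟨structHom P.π U b.fst, fun k ↦ R.jO U (structHom P.π U (c b.snd k)), fun k ↦ by
    rw [R.qI_jO, dHom_structHom]⟩
  map_one' := ModelSection.ext (map_one _) (by funext k; simp)
  map_mul' a b := ModelSection.ext (map_mul _ _ _) (by
    funext k
    rw [ModelSection.mul_snd]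
    change R.jO U _ = structHom P.π U a.fst • R.jO U _ + structHom P.π U b.fst • R.jO U _
    have h (r x : Γ(P.X, U)) : r • R.jO U x = R.jO U (r * x) := (map_smul (R.jO U) r x).symm
    rw [h, h, ← map_mul, ← map_mul, ← map_add, ← map_add, TrivSqZeroExt.snd_mul]
    simp)
  map_zero' := ModelSection.ext (map_zero _) (by funext k; simp)
  map_add' a b := ModelSection.ext (map_add _ _ _) (by funext k; simp)

/-- The ideal sheaf of the divisor of the thickening. -/
def modelIdeal (hD : IsEffectiveCartier P.ι) : (modelThickening R φ).scheme.IdealSheafData where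
  ideal U := ModelSection.ideal R φ U.1
  map_ideal_basicOpen U f := by
    let D := modelThickening R φ
    have hU := D.isAffineOpen_of_scheme U.2
    let W : P.X.Opens := U.1
    let V : P.X.Opens := D.scheme.basicOpen f
    let f' : ModelSection R φ W := f
    have hle : V ≤ W := D.scheme.basicOpen_le f
    refine le_antisymm (Ideal.map_le_iff_le_comap.mpr fun s hs ↦
      ModelSection.res_mem_ideal hs hle) fun (t : ModelSection R φ V) ht ↦ ?_
    obtain ⟨n, t', ht', e⟩ := ModelSection.exists_mem_ideal_res_eq hD hU f' hle
      (D.basicOpen_scheme W f) t ht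
    have hu : IsUnit (ModelSection.res hle f') :=
      RingedSpace.isUnit_res_basicOpen D.scheme.toLocallyRingedSpace.toRingedSpace f
    obtain ⟨v, hv⟩ := (hu.pow n).exists_left_inv
    have e' : t = v * ModelSection.res hle t' := by
      rw [e, ← mul_assoc, hv, one_mul]
    have h1 := Ideal.mem_map_of_mem (D.scheme.presheaf.map (homOfLE hle).op).hom ht'
    exact e' ▸ Ideal.mul_mem_left _ v h1

variable (c : M ≃ₗ[A] (κ → A))

/-- The structure morphism of the thickening, over the square-zero extension of `A` by `M ≃ κ → A`.
-/
def modelπ : (modelThickening R φ).scheme ⟶ Spec (.of (TrivSqZeroExt A M)) :=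
  specHom (Z := (modelThickening R φ).scheme) (ModelSection.scalar R φ c.toLinearMap ⊤)

lemma structHom_modelπ (V : P.X.Opens) (b : TrivSqZeroExt A M) :
    structHom (modelπ R φ c) V b = ModelSection.scalar R φ c.toLinearMap V b := by
  refine (structHom_specHom (Z := (modelThickening R φ).scheme) _ V b).trans
    (ModelSection.ext (map_structHom P.π (homOfLE le_top) _) (funext fun k ↦ ?_))
  refine (R.jO_res le_top _).symm.trans (congrArg (R.jO V) ?_)
  exact map_structHom P.π (homOfLE le_top) _

lemma inclusion_modelπ : (modelThickening R φ).inclusion ≫ modelπ R φ c =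
    P.π ≫ Spec.map (CommRingCat.ofHom (augmentation A M)) := by
  refine hom_ext_of_structHom fun b ↦ ?_
  have h1 := app_structHom (i := 𝟙 P.X) (πX := P.π) (α := augmentation A M) (Category.id_comp _) ⊤ b
  refine (structHom_comp (modelThickening R φ).inclusion ⊤ b).trans (Eq.trans ?_ h1.symm)
  exact congrArg ((modelThickening R φ).inclusion.app ⊤) (structHom_modelπ R φ c ⊤ b)

omit [Finite κ] in
open Classical in
lemma ModelSection.scalar_inr_mul {U : P.X.Opens} (k : κ) (s : ModelSection R φ U) :
    scalar R φ c.toLinearMap U (.inr (c.symm (Pi.single k 1))) * s =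
      inr R φ (Pi.single k s.fst) := by
  refine ModelSection.ext ?_ (funext fun l ↦ ?_)
  · change structHom P.π U 0 * s.fst = 0
    rw [map_zero, zero_mul]
  · rw [mul_snd]
    change structHom P.π U 0 • s.snd l + s.fst • R.jO U (structHom P.π U (c (c.symm _) l)) =
      R.jO U ((Pi.single k s.fst : κ → Γ(P.X, U)) l)
    have h (r x : Γ(P.X, U)) : r • R.jO U x = R.jO U (r * x) := (map_smul (R.jO U) r x).symm
    rw [map_zero, zero_smul, zero_add, h, c.apply_symm_apply]
    by_cases hl : l = k
    · subst hl; simp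
    · simp [hl]

omit [Finite κ] in
open Classical in
lemma ModelSection.sum_scalar_inr_mul [Fintype κ] {U : P.X.Opens} (s : κ → ModelSection R φ U) :
    ∑ k, scalar R φ c.toLinearMap U (.inr (c.symm (Pi.single k 1))) * s k =
      inr R φ fun k ↦ (s k).fst := by
  have h : inr R φ (fun k ↦ (s k).fst) = ∑ k, inr R φ (Pi.single k (s k).fst) := by
    let f : (κ → Γ(P.X, U)) →+ ModelSection R φ U :=
      AddMonoidHom.mk' (inr R φ) inr_add
    change f _ = ∑ k, f _
    rw [← map_sum, Finset.univ_sum_single]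
  rw [h]
  exact Finset.sum_congr rfl fun k _ ↦ scalar_inr_mul R φ c k (s k)

open Classical in
lemma sum_structHom_mul [Fintype κ] (V : P.X.Opens)
    (t : κ → Γ((modelThickening R φ).scheme, V)) :
    ∑ k, structHom (modelπ R φ c) V (.inr (c.symm (Pi.single k 1))) * t k =
      ModelSection.inr R φ fun k ↦ (modelThickening R φ).inclusion.app V (t k) := by
  refine Eq.trans (Finset.sum_congr rfl fun k _ ↦ ?_) (ModelSection.sum_scalar_inr_mul R φ c t)
  exact congrArg (· * t k) (structHom_modelπ R φ c V _)

/-- The thickening is a thickening of `X` over `A ⊕ M`: the sections over an affine open with zero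
image in `𝒪` are multiples of the elements of `M`. -/
lemma isPullback_modelπ : IsPullback (modelThickening R φ).inclusion P.π (modelπ R φ c)
    (Spec.map (CommRingCat.ofHom (augmentation A M))) := by
  refine isPullback_of_ker_le augmentation_surjective (inclusion_modelπ R φ c) fun V hV s hs ↦ ?_
  let V : P.X.Opens := V
  have hV := (modelThickening R φ).isAffineOpen_of_scheme hV
  have := Fintype.ofFinite κ
  classical
  obtain ⟨x, hx⟩ := ModelSection.exists_eq_inr (s : ModelSection R φ V) hs
  choose t ht using fun k ↦ ModelSection.exists_fst_eq (R := R) (φ := φ) hV (x k)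
  have h1 := sum_structHom_mul R φ c V t
  have h2 : s = _ := (hx.trans (congrArg _ (funext fun k ↦ (ht k).symm))).trans h1.symm
  rw [h2]
  exact Ideal.sum_mem _ fun k _ ↦ Ideal.mul_mem_right _ _ (Ideal.mem_map_of_mem _ rfl)

lemma eq_zero_of_sum_structHom_mul [Fintype κ] [DecidableEq κ] (V : P.X.Opens)
    (t : κ → Γ((modelThickening R φ).scheme, V))
    (ht : ∑ k, structHom (modelπ R φ c) V (.inr (c.symm (Pi.single k 1))) * t k = 0) (k : κ) :
    (modelThickening R φ).inclusion.app V (t k) = 0 := by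
  have h1 := sum_structHom_mul R φ c V t
  have h4 : ModelSection.inr R φ (0 : κ → Γ(P.X, V)) = 0 :=
    ModelSection.ext rfl (funext fun _ ↦ map_zero (R.jO V))
  have h2 : ModelSection.inr R φ (fun k ↦ (modelThickening R φ).inclusion.app V (t k)) =
      (0 : ModelSection R φ V) := by
    refine h1.symm.trans (Eq.trans ?_ ht)
    congr!
  exact congrFun (ModelSection.inr_injective (h2.trans h4.symm)) k

omit [Finite κ] in
/-- Flatness over `A ⊕ M`, for a scheme whose base change to `A` is flat. -/
lemma flat_of_isPullback_augmentation [IsLocalRing A]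
    (hA : IsNilpotent (IsLocalRing.maximalIdeal A)) [Fintype κ] [DecidableEq κ] {X Z : Scheme.{0}}
    {i : X ⟶ Z} {πX : X ⟶ Spec (.of A)} {πZ : Z ⟶ Spec (.of (TrivSqZeroExt A M))} [Flat πX]
    (h : IsPullback i πX πZ (Spec.map (CommRingCat.ofHom (augmentation A M))))
    (hi : ∀ z : Z, ∃ V : Z.Opens, z ∈ V ∧ IsAffineOpen V ∧ ∀ t : κ → Γ(Z, V),
      ∑ k, structHom πZ V (.inr (c.symm (Pi.single k 1))) * t k = 0 → ∀ k, i.app V (t k) = 0) :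
    Flat πZ := by
  refine flat_of_structHom fun z ↦ ?_
  obtain ⟨V, hz, hV, hi⟩ := hi z
  refine ⟨V, hV, hz, ?_⟩
  have hα := augmentation_surjective (A := A) (M := M)
  letI : Module (TrivSqZeroExt A M) Γ(Z, V) := (structHom πZ V).toModule
  letI : Module A Γ(X, i ⁻¹ᵁ V) := (structHom πX (i ⁻¹ᵁ V)).toModule
  have : Module.Flat A Γ(X, i ⁻¹ᵁ V) :=
    flat_structHom (isAffineOpen_preimage_of_isPullback h hα hV)
  have := free_of_flat_of_isNilpotent_maximalIdeal hA Γ(X, i ⁻¹ᵁ V)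
  refine flat_of_squareZero c (i.app V).hom.toAddMonoidHom
    (fun b t ↦ ?_) (app_surjective_of_isPullback h hα hV) (fun t ht ↦ ?_) hi
  · refine (map_mul (i.app V).hom (structHom πZ V b) t).trans (congrArg (· * (i.app V).hom t) ?_)
    exact app_structHom h.w V b
  · have ht : t ∈ RingHom.ker (i.app V).hom := ht
    rw [ker_app_of_isPullback h hα hV] at ht
    refine Submodule.span_induction ?_ (zero_mem _) (fun x y _ _ hx hy ↦ add_mem hx hy) ?_ ht
    · rintro _ ⟨b, hb, rfl⟩
      have := Submodule.smul_mem_smul hb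
        (Submodule.mem_top (R := TrivSqZeroExt A M) (x := (1 : Γ(Z, V))))
      exact (mul_one (structHom πZ V b)) ▸ this
    · intro a x _ hx
      refine Submodule.smul_induction_on hx (fun b hb n _ ↦ ?_) (fun x y hx hy ↦ ?_)
      · have := Submodule.smul_mem_smul hb
          (Submodule.mem_top (R := TrivSqZeroExt A M) (x := a * n))
        have e : a • b • n = b • (a * n) := mul_left_comm a (structHom πZ V b) n
        rwa [e]
      · rw [smul_add]; exact add_mem hx hy

lemma flat_modelπ [IsLocalRing A] (hA : IsNilpotent (IsLocalRing.maximalIdeal A)) :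
    Flat (modelπ R φ c) := by
  have := Fintype.ofFinite κ
  classical
  have := P.flat
  refine flat_of_isPullback_augmentation c hA (isPullback_modelπ R φ c) fun z ↦ ?_
  obtain ⟨V, hV, hz, -⟩ := exists_isAffineOpen_le (X := (modelThickening R φ).scheme)
    (U := ⊤) (x := z) trivial
  exact ⟨V, hz, hV, eq_zero_of_sum_structHom_mul R φ c V⟩

lemma app_app_eq_zero_of_comp_eq {S T X Z : Scheme.{0}} {a : T ⟶ S} {i : S ⟶ Z} {b : T ⟶ X}
    {j : X ⟶ Z} (e : a ≫ i = b ≫ j) {V : Z.Opens} {s : Γ(Z, V)} (hs : i.app V s = 0) :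
    b.app _ (j.app V s) = 0 := by
  have h := app_eq_zero_congr e s
  rw [Scheme.Hom.comp_app, Scheme.Hom.comp_app] at h
  refine h.mp ?_
  exact (congrArg (a.app _) hs).trans (map_zero (a.app _).hom)

section

variable {R φ} (hD : IsEffectiveCartier P.ι)

lemma modelIdeal_ker (V : (modelThickening R φ).scheme.Opens) (hV : IsAffineOpen V) :
    RingHom.ker ((modelIdeal R φ hD).subschemeι.app V).hom = ModelSection.ideal R φ V :=
  (modelIdeal R φ hD).ker_subschemeι_app ⟨V, hV⟩

lemma app_subschemeι_eq_zero_of_isEquation {U : P.X.Opens} (hU : IsAffineOpen U)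
    {e : ModelSection R φ U} (he : e.IsEquation) :
    (modelIdeal R φ hD).subschemeι.app U e = 0 := by
  have h : e ∈ ModelSection.ideal R φ U := (ModelSection.mem_ideal_iff_dvd he).mpr dvd_rfl
  rw [← modelIdeal_ker hD U ((modelThickening R φ).isAffineOpen_scheme hU)] at h
  exact h

omit [Finite κ] in
include hD in
lemma exists_affine_isEquation {U : P.X.Opens} {x : P.X} (hx : x ∈ U) :
    ∃ (V : P.X.Opens) (_ : V ≤ U) (_ : IsAffineOpen V) (e : ModelSection R φ V),
      x ∈ V ∧ e.IsEquation := by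
  obtain ⟨W, hxW, g, hg⟩ := hD x
  obtain ⟨V, hV, hxV, h⟩ := exists_isAffineOpen_le (U := U ⊓ W) ⟨hx, hxW⟩
  have hg := resO_mem_localEquations (h.trans inf_le_right) hg
  obtain ⟨e, he, -⟩ := ModelSection.exists_isEquation R φ hV hg
  exact ⟨V, h.trans inf_le_left, hV, e, hxV, he⟩

include hD in
lemma app_inclusion_eq_zero (V : (modelThickening R φ).scheme.Opens)
    (s : Γ((modelThickening R φ).scheme, V)) (hs : s ∈ ModelSection.ideal R φ V) :
    (P.ι ≫ (modelThickening R φ).inclusion).app V s = 0 := by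
  refine app_eq_zero_of_locally _ s fun z hz ↦ ?_
  obtain ⟨W, hW, hW', e, hzW, he⟩ := exists_affine_isEquation (R := R) (φ := φ) hD
    (U := (V : P.X.Opens)) (x := z) hz
  refine ⟨W, hW, hzW, ?_⟩
  have h1 := ModelSection.res_mem_ideal hs hW
  obtain ⟨t, ht⟩ := (ModelSection.mem_ideal_iff_dvd he).mp h1
  change P.ι.app W (ModelSection.fst (ModelSection.res hW s)) = 0
  rw [ht, ModelSection.mul_fst, map_mul]
  refine (congrArg (· * _) (app_eq_zero_of_mem_localEquations hW' he.1)).trans (zero_mul _)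

lemma exists_modelιD : ∃ l : P.D ⟶ (modelIdeal R φ hD).subscheme,
    l ≫ (modelIdeal R φ hD).subschemeι = P.ι ≫ (modelThickening R φ).inclusion := by
  refine exists_lift_of_isClosedImmersion _ _ fun V hV s hs ↦ ?_
  refine app_inclusion_eq_zero hD V s (modelIdeal_ker hD V hV ▸ hs)

/-- The inclusion of the divisor `D` in the divisor of the thickening. -/
def modelιD : P.D ⟶ (modelIdeal R φ hD).subscheme := (exists_modelιD hD).choose

lemma modelιD_subschemeι : modelιD hD ≫ (modelIdeal R φ hD).subschemeι =
    P.ι ≫ (modelThickening R φ).inclusion := (exists_modelιD hD).choose_spec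

/-- The divisor of the thickening restricts to `D`: both have the equations `g`, the first
components of the equations `(g, g ℓ)`. -/
lemma isPullback_modelιD : IsPullback (modelιD hD) P.ι (modelIdeal R φ hD).subschemeι
    (modelThickening R φ).inclusion := by
  have := P.isClosedImmersion
  have key (s : Limits.PullbackCone (modelIdeal R φ hD).subschemeι
      (modelThickening R φ).inclusion) : ∃ l : s.pt ⟶ P.D, l ≫ P.ι = s.snd := by
    refine exists_lift_of_isClosedImmersion _ _ fun V hV f hf ↦ ?_
    refine app_eq_zero_of_locally _ f fun z hz ↦ ?_
    obtain ⟨W, hxW, g, hg⟩ := hD z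
    obtain ⟨W', hW', hzW', h⟩ := exists_isAffineOpen_le (U := V ⊓ W) ⟨hz, hxW⟩
    have hg := resO_mem_localEquations (h.trans inf_le_right) hg
    refine ⟨W', h.trans inf_le_left, hzW', ?_⟩
    have h0 : P.ι.app W' (resO (h.trans inf_le_left) f) = 0 := by
      rw [app_resO P.ι (h.trans inf_le_left) (P.ι.preimage_mono (h.trans inf_le_left)), hf,
        map_zero]
    have h1 : resO (h.trans inf_le_left) f ∈ Ideal.span {resO (h.trans inf_le_right) g} := by
      rw [← ker_app_eq_of_mem_localEquations hW' hg]
      exact h0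
    obtain ⟨u, hu⟩ := Ideal.mem_span_singleton'.mp h1
    rw [← hu, map_mul]
    obtain ⟨e, he, hge⟩ := ModelSection.exists_isEquation R φ hW' hg
    have h2 := app_subschemeι_eq_zero_of_isEquation hD hW' he
    have h4 : s.snd.app W' e.fst = 0 := app_app_eq_zero_of_comp_eq s.condition h2
    rw [hge] at h4
    exact (congrArg (_ * ·) h4).trans (mul_zero _)
  choose l hl using key
  refine ⟨⟨modelιD_subschemeι hD⟩, ⟨Limits.PullbackCone.IsLimit.mk _ l (fun s ↦ ?_) hl
    (fun s m _ hm ↦ ?_)⟩⟩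
  · rw [← cancel_mono (modelIdeal R φ hD).subschemeι, Category.assoc, modelιD_subschemeι,
      reassoc_of% hl, s.condition]
  · rw [← cancel_mono P.ι, hl, hm]

lemma flat_subschemeι_modelπ [IsLocalRing A] (hA : IsNilpotent (IsLocalRing.maximalIdeal A)) :
    Flat ((modelIdeal R φ hD).subschemeι ≫ modelπ R φ c) := by
  have := Fintype.ofFinite κ
  classical
  have := P.flat_divisor
  have hP := isPullback_modelιD (R := R) (φ := φ) hD
  refine flat_of_isPullback_augmentation c hA
    (hP.paste_vert (isPullback_modelπ R φ c)) fun z ↦ ?_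
  obtain ⟨V, -, hV, e, hzV, he⟩ := exists_affine_isEquation (R := R) (φ := φ) hD
    (U := ⊤) (x := (modelIdeal R φ hD).subschemeι z) trivial
  have hV' := (modelThickening R φ).isAffineOpen_scheme hV
  refine ⟨(modelIdeal R φ hD).subschemeι ⁻¹ᵁ V, hzV, hV'.preimage _, fun t ht k ↦ ?_⟩
  choose s hs using fun k ↦ (modelIdeal R φ hD).subschemeι.app_surjective V hV' (t k)
  rw [← hs]
  refine (app_app_eq_zero_iff hP (s k)).mpr ?_
  have h1 : (modelIdeal R φ hD).subschemeι.app V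
      (∑ k, structHom (modelπ R φ c) V (.inr (c.symm (Pi.single k 1))) * s k) = 0 := by
    rw [map_sum, ← ht]
    refine Finset.sum_congr rfl fun k _ ↦ ?_
    rw [map_mul, hs]
    exact congrArg (· * t k)
      (structHom_comp (πZ := modelπ R φ c) (modelIdeal R φ hD).subschemeι V _).symm
  have h2 : (∑ k, structHom (modelπ R φ c) V (.inr (c.symm (Pi.single k 1))) * s k) ∈
      ModelSection.ideal R φ V := by
    rw [← modelIdeal_ker hD V hV']; exact h1
  obtain ⟨r, hr⟩ := (ModelSection.mem_ideal_iff_dvd he).mp h2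
  have h3 : ModelSection.inr R φ (fun k ↦ (modelThickening R φ).inclusion.app V (s k)) =
      e * r := by
    refine (Eq.trans ?_ hr)
    refine (sum_structHom_mul R φ c V s).symm.trans ?_
    congr!
  have h4 : r.fst = 0 := eq_zero_of_mul_eq_zero_of_mem_localEquations R he.1
    (congrArg ModelSection.fst h3).symm
  obtain ⟨x, rfl⟩ := ModelSection.exists_eq_inr r h4
  rw [ModelSection.mul_inr] at h3
  have h5 := congrFun (ModelSection.inr_injective h3) k
  refine (congrArg (P.ι.app V) h5).trans ?_
  refine (map_mul (P.ι.app V).hom e.fst (x k)).trans ?_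
  exact (congrArg (· * _) (app_eq_zero_of_mem_localEquations hV he.1)).trans (zero_mul _)

end

/-- The deformation over `A ⊕ M`, `M ≃ κ → A`, defined by a family of morphisms
`φ k : Ω¹(log D) ⟶ J`. -/
def modelDeformation [IsLocalRing A] (hA : IsNilpotent (IsLocalRing.maximalIdeal A))
    (hD : IsEffectiveCartier P.ι) : Deformation P (augmentation A M) where
  total :=
    { X := (modelThickening R φ).scheme
      D := (modelIdeal R φ hD).subscheme
      ι := (modelIdeal R φ hD).subschemeι
      π := modelπ R φ c
      isClosedImmersion := inferInstance
      flat := flat_modelπ R φ c hA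
      flat_divisor := flat_subschemeι_modelπ c hD hA }
  iX := (modelThickening R φ).inclusion
  iD := modelιD hD
  isPullback_X := isPullback_modelπ R φ c
  isPullback_D := isPullback_modelιD hD

/-- The `k`-th derivation of the thickening. -/
def modelDer (k : κ) : SheafDer (modelThickening R φ).inclusion R.I where
  toFun V :=
    { toFun := fun y ↦ ModelSection.snd (y : ModelSection R φ V) k
      map_zero' := rfl
      map_add' := fun _ _ ↦ rfl }
  map_mul _ _ _ := rfl
  map_res _ _ _ _ _ := rfl

omit [Finite κ] in
/-- A section that is divisible by an equation and lies over an equation of `D` is an equation. -/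
lemma ModelSection.IsEquation.qI_eq {U : P.X.Opens} (hU : IsAffineOpen U) {e y : ModelSection R φ U}
    (he : e.IsEquation) (hy : y.fst ∈ localEquations P.ι U) (h : e ∣ y) (k : κ) (ℓ : Γ(R.I, U))
    (hℓ : y.fst • ℓ = y.snd k) : R.qI U ℓ = dlogHom (φ k) U ⟨_, hy⟩ := by
  obtain ⟨t, rfl⟩ := h
  obtain ⟨hg, ℓ', hℓ'⟩ := he
  obtain ⟨u, hu⟩ := exists_unit_of_mem_localEquations hU hg hy
  have ht : t.fst = u := by
    refine (mul_cancel_left_mem_nonZeroDivisors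
      (mem_nonZeroDivisors_of_mem_localEquations hU hg)).mp ?_
    exact hu.trans (mul_comm _ _)
  have h1 : t.snd k + t.fst • ℓ' k = t.fst • ℓ := by
    refine (R.bijective_smul U _ hg).1 ?_
    change e.fst • (t.snd k + t.fst • ℓ' k) = e.fst • t.fst • ℓ
    rw [smul_smul]
    refine Eq.trans ?_ hℓ.symm
    rw [mul_snd, ← (hℓ' k).1]
    module
  have h2 := congrArg (R.qI U) h1
  rw [map_add, map_smul, map_smul, t.qI_snd, (hℓ' k).2] at h2
  rw [dlogHom_of_eq_mul (φ k) ⟨_, hg⟩ ⟨_, hy⟩ u hu, ← ht]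
  have h3 : (↑u⁻¹ : Γ(P.X, U)) * t.fst = 1 := by rw [ht, Units.inv_mul]
  have h4 := congrArg ((↑u⁻¹ : Γ(P.X, U)) • ·) h2
  simp only [smul_add, smul_smul, h3, one_smul] at h4
  rw [← h4, add_comm]

omit [Finite κ] in
lemma ModelSection.qI_eq_of_mem_ideal (hD : IsEffectiveCartier P.ι) {U : P.X.Opens}
    {y : ModelSection R φ U} (hy : y.fst ∈ localEquations P.ι U) (h : y ∈ ideal R φ U) (k : κ)
    (ℓ : Γ(R.I, U)) (hℓ : y.fst • ℓ = y.snd k) : R.qI U ℓ = dlogHom (φ k) U ⟨_, hy⟩ := by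
  refine section_ext _ _ _ fun x hx ↦ ?_
  obtain ⟨W, hW, hWa, e, hxW, he⟩ := exists_affine_isEquation (R := R) (φ := φ) hD hx
  refine ⟨W, hW, hxW, ?_⟩
  obtain ⟨ℓ', hℓ'⟩ : ∃ ℓ', ℓ' = resM R.I hW ℓ := ⟨_, rfl⟩
  have h1 : (res hW y).fst • ℓ' = (res hW y).snd k :=
    hℓ' ▸ (resM_smul R.I hW y.fst ℓ).symm.trans (congrArg (resM R.I hW) hℓ)
  have hy' : (res hW y).fst ∈ localEquations P.ι W := resO_mem_localEquations hW hy
  have hd : e ∣ res hW y := (mem_ideal_iff_dvd he).mp (res_mem_ideal h hW)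
  have h2 := IsEquation.qI_eq R φ hWa he hy' hd k ℓ' h1
  exact (R.qI_res hW ℓ).symm.trans ((congrArg (R.qI W) hℓ').symm.trans
    (h2.trans (dlogHom_res (φ k) hW ⟨_, hy⟩)))

lemma mem_ideal_of_app_subschemeι (hD : IsEffectiveCartier P.ι)
    (V : (modelThickening R φ).scheme.Opens) (y : Γ((modelThickening R φ).scheme, V))
    (hy : (modelIdeal R φ hD).subschemeι.app V y = 0) : y ∈ ModelSection.ideal R φ V := by
  refine ModelSection.mem_ideal_of_locally fun x hx ↦ ?_
  obtain ⟨W, hW, hxW, h⟩ := exists_isAffineOpen_le (X := (modelThickening R φ).scheme) hx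
  refine ⟨W, h, hxW, ?_⟩
  have h1 : (modelIdeal R φ hD).subschemeι.app W (resO h y) = 0 := by
    rw [app_resO (modelIdeal R φ hD).subschemeι h ((modelIdeal R φ hD).subschemeι.preimage_mono h),
      hy, map_zero]
  exact modelIdeal_ker hD W hW ▸ h1

/-- The deformation defined by a family belongs to its members, by the second components of the
sections of its structure sheaf. -/
lemma rel_modelDeformation [IsLocalRing A] (hA : IsNilpotent (IsLocalRing.maximalIdeal A))
    (hD : IsEffectiveCartier P.ι) (k : κ) :
    Rel R (modelDeformation R φ c hA hD) (LinearMap.proj k ∘ₗ c.toLinearMap) (φ k) := by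
  refine ⟨modelDer R φ k, fun V b ↦ ?_, fun V y ↦ ModelSection.qI_snd _ k,
    fun V y hy hy' ℓ hℓ ↦ ?_⟩
  · exact congrArg (fun s ↦ ModelSection.snd s k) (structHom_modelπ R φ c V b)
  · exact ModelSection.qI_eq_of_mem_ideal R φ hD (U := V) (y := y) hy
      (mem_ideal_of_app_subschemeι R φ hD V y hy') k ℓ hℓ

end ModelDeformation

/-! ### Isomorphisms of flat thickenings -/

section Stalk

variable {A B : Type} [CommRing A] [CommRing B] {α : B →+* A} {X Z Z' : Scheme.{0}} {i : X ⟶ Z}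
  {πX : X ⟶ Spec (.of A)} {πZ : Z ⟶ Spec (.of B)}

/-- The structure homomorphism `B → 𝒪_{Z, z}` of a scheme over `Spec B`. -/
def stalkHom (πZ : Z ⟶ Spec (.of B)) (z : Z) : B →+* Z.presheaf.stalk z :=
  (Z.presheaf.germ ⊤ z trivial).hom.comp (structHom πZ ⊤)

lemma germ_structHom (πZ : Z ⟶ Spec (.of B)) {z : Z} {V : Z.Opens} (hz : z ∈ V) (b : B) :
    Z.presheaf.germ V z hz (structHom πZ V b) = stalkHom πZ z b := by
  have h1 := Z.presheaf.germ_res_apply (homOfLE le_top : V ⟶ ⊤) z hz (structHom πZ ⊤ b)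
  rw [map_structHom] at h1
  exact h1

lemma exists_germ_eq_of_isAffineOpen {z : Z} {U : Z.Opens} (hz : z ∈ U) (t : Z.presheaf.stalk z) :
    ∃ (V : Z.Opens) (hzV : z ∈ V) (s : Γ(Z, V)), V ≤ U ∧ IsAffineOpen V ∧
      Z.presheaf.germ V z hzV s = t := by
  obtain ⟨W, hzW, s, rfl⟩ := Z.presheaf.exists_germ_eq (x := z) t
  obtain ⟨V, hV, hzV, h⟩ := exists_isAffineOpen_le (U := U ⊓ W) ⟨hz, hzW⟩
  exact ⟨V, hzV, resO (h.trans inf_le_right) s, h.trans inf_le_left, hV,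
    Z.presheaf.germ_res_apply (homOfLE (h.trans inf_le_right)) z hzV s⟩

lemma flat_stalkHom [Flat πZ] (z : Z) : (stalkHom πZ z).Flat := by
  obtain ⟨V, hV, hzV, -⟩ := exists_isAffineOpen_le (U := ⊤) (x := z) trivial
  have h1 := flat_structHom (πZ := πZ) hV
  letI := TopCat.Presheaf.algebra_section_stalk Z.presheaf ⟨z, hzV⟩
  have := hV.isLocalization_stalk ⟨z, hzV⟩
  have h2 : (Z.presheaf.germ V z hzV).hom.Flat :=
    @IsLocalization.flat Γ(Z, V) (Z.presheaf.stalk z) _ _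
      (TopCat.Presheaf.algebra_section_stalk Z.presheaf ⟨z, hzV⟩)
      (hV.primeIdealOf ⟨z, hzV⟩).asIdeal.primeCompl this
  have h3 : stalkHom πZ z = (Z.presheaf.germ V z hzV).hom.comp (structHom πZ V) :=
    RingHom.ext fun b ↦ (germ_structHom πZ hzV b).symm
  rw [h3]
  exact RingHom.Flat.comp h1 h2

lemma stalkMap_stalkHom (h : i ≫ πZ = πX ≫ Spec.map (CommRingCat.ofHom α)) (x : X) (b : B) :
    i.stalkMap x (stalkHom πZ (i x) b) = stalkHom πX x (α b) := by
  refine (i.germ_stalkMap_apply ⊤ x trivial _).trans ?_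
  exact congrArg _ (app_structHom h ⊤ b)

lemma stalkMap_stalkHom_of_comp {πZ' : Z' ⟶ Spec (.of B)} {f : Z ⟶ Z'} (h : f ≫ πZ' = πZ) (z : Z)
    (b : B) : f.stalkMap z (stalkHom πZ' (f z) b) = stalkHom πZ z b :=
  stalkMap_stalkHom (α := RingHom.id B) (by
    change _ = _ ≫ Spec.map (𝟙 _)
    rw [Spec.map_id, Category.comp_id, h]) z b

lemma ker_stalkMap_of_isPullback (h : IsPullback i πX πZ (Spec.map (CommRingCat.ofHom α)))
    (hα : Function.Surjective α) (x : X) :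
    RingHom.ker (i.stalkMap x).hom = (RingHom.ker α).map (stalkHom πZ (i x)) := by
  refine le_antisymm (fun t ht ↦ ?_) (Ideal.map_le_iff_le_comap.mpr fun b hb ↦ ?_)
  · have ht : i.stalkMap x t = 0 := ht
    obtain ⟨V, hV, s, -, -, rfl⟩ := exists_germ_eq_of_isAffineOpen (U := ⊤) trivial t
    have h1 := i.germ_stalkMap_apply V x hV s
    rw [ht] at h1
    obtain ⟨U', hxU', e₁, e₂, h2⟩ :=
      X.presheaf.germ_eq x (U := i ⁻¹ᵁ V) (V := i ⁻¹ᵁ V) hV hV (i.app V s) 0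
        (h1.symm.trans (map_zero _).symm)
    have hi := (isClosedImmersion_of_isPullback h hα).isClosedEmbedding
    obtain ⟨W, hW⟩ := hi.isInducing.isOpen_iff.mp U'.2
    let W : Z.Opens := ⟨W, hW.1⟩
    have hWU : i ⁻¹ᵁ W = U' := TopologicalSpace.Opens.ext hW.2
    obtain ⟨V', hV', hxV', hle⟩ := exists_isAffineOpen_le (U := V ⊓ W) (x := i x)
      ⟨hV, by change x ∈ i ⁻¹ᵁ W; rw [hWU]; exact hxU'⟩
    have hle' : i ⁻¹ᵁ V' ≤ U' := hWU ▸ i.preimage_mono (hle.trans inf_le_right)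
    have h3 : i.app V' (resO (hle.trans inf_le_left) s) = 0 := by
      rw [app_resO i (hle.trans inf_le_left) (i.preimage_mono (hle.trans inf_le_left)),
        ← resO_resO (leOfHom e₁) hle']
      exact (congrArg (resO hle') h2).trans ((congrArg _ (map_zero _)).trans (map_zero _))
    have h4 : resO (hle.trans inf_le_left) s ∈ RingHom.ker (i.app V').hom := h3
    rw [ker_app_of_isPullback h hα hV'] at h4
    have h5 := Ideal.mem_map_of_mem (Z.presheaf.germ V' (i x) hxV').hom h4
    have h6 : (Z.presheaf.germ V' (i x) hxV').hom.comp (structHom πZ V') = stalkHom πZ (i x) :=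
      RingHom.ext fun b ↦ germ_structHom πZ hxV' b
    rw [Ideal.map_map, h6] at h5
    exact (Z.presheaf.germ_res_apply (homOfLE (hle.trans inf_le_left)) (i x) hxV' s) ▸ h5
  · have hb : α b = 0 := hb
    change i.stalkMap x (stalkHom πZ (i x) b) = 0
    rw [stalkMap_stalkHom h.w, hb, map_zero]

lemma mem_smul_top_iff {B S : Type} [CommRing B] [CommRing S] (f : B →+* S) (K : Ideal B) (s : S) :
    letI := f.toModule
    s ∈ K • (⊤ : Submodule B S) ↔ s ∈ K.map f := by
  letI := f.toAlgebra
  refine Iff.trans ?_ (Submodule.restrictScalars_mem B (K.map f) s)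
  change _ ↔ s ∈ Submodule.restrictScalars B (K.map (algebraMap B S))
  rw [← Ideal.smul_top_eq_map]

/-- A morphism from a flat thickening of `X` to another thickening is an isomorphism. -/
lemma isIso_of_isPullback {πZ' : Z' ⟶ Spec (.of B)} {i' : X ⟶ Z'}
    (hα : Function.Surjective α) (hK : IsNilpotent (RingHom.ker α))
    (h : IsPullback i πX πZ (Spec.map (CommRingCat.ofHom α)))
    (h' : IsPullback i' πX πZ' (Spec.map (CommRingCat.ofHom α))) [Flat πZ]
    (f : Z ⟶ Z') (hi : i ≫ f = i') (hf : f ≫ πZ' = πZ) : IsIso f := by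
  subst hi
  have h1 := isHomeomorph_of_isPullback h hα hK
  have h2 := isHomeomorph_of_isPullback h' hα hK
  have hci := isClosedImmersion_of_isPullback h hα
  have hci' := isClosedImmersion_of_isPullback h' hα
  refine (isIso_iff_isIso_stalkMap f).mpr ⟨?_, fun z ↦ ?_⟩
  · have := TopCat.isIso_of_bijective_of_isOpenMap i.base h1.bijective h1.isOpenMap
    have := TopCat.isIso_of_bijective_of_isOpenMap (i ≫ f).base h2.bijective h2.isOpenMap
    have : IsIso (i.base ≫ f.base) := this
    exact IsIso.of_isIso_comp_left i.base f.base
  · obtain ⟨x, rfl⟩ := h1.surjective z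
    refine (ConcreteCategory.isIso_iff_bijective _).mpr ?_
    letI : Module B (Z'.presheaf.stalk (f (i x))) := (stalkHom πZ' (f (i x))).toModule
    letI : Module B (Z.presheaf.stalk (i x)) := (stalkHom πZ (i x)).toModule
    have : Module.Flat B (Z.presheaf.stalk (i x)) := flat_stalkHom (i x)
    let g : Z'.presheaf.stalk (f (i x)) →ₗ[B] Z.presheaf.stalk (i x) :=
      { toFun := f.stalkMap (i x)
        map_add' := map_add (f.stalkMap (i x)).hom
        map_smul' := fun b s ↦ (map_mul (f.stalkMap (i x)).hom (stalkHom πZ' (f (i x)) b) s).trans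
          (congrArg (· * (f.stalkMap (i x)).hom s) (stalkMap_stalkHom_of_comp hf (i x) b)) }
    have hc : ∀ s, (i ≫ f).stalkMap x s = i.stalkMap x (g s) := fun s ↦ by
      rw [Scheme.Hom.stalkMap_comp]; rfl
    have k1 := ker_stalkMap_of_isPullback h hα x
    have k2 := ker_stalkMap_of_isPullback h' hα x
    refine bijective_of_flat_of_isNilpotent hK g (fun t ↦ ?_) (fun s hs ↦ ?_)
    · obtain ⟨s, hs⟩ := (i ≫ f).stalkMap_surjective x (i.stalkMap x t)
      refine ⟨s, (mem_smul_top_iff (stalkHom πZ (i x)) _ _).mpr ?_⟩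
      rw [← k1, RingHom.mem_ker, map_sub, sub_eq_zero]
      exact hs.symm.trans (hc s)
    · have hs := (mem_smul_top_iff (stalkHom πZ (i x)) _ _).mp hs
      rw [← k1] at hs
      refine (mem_smul_top_iff (stalkHom πZ' (f (i x))) _ _).mpr ?_
      have h3 : s ∈ RingHom.ker ((i ≫ f).stalkMap x).hom := (hc s).trans hs
      rw [k2] at h3
      exact h3

end Stalk

/-! ### Deformations are determined by their morphisms from logarithmic differentials -/

section Compare

variable {A M : Type} [CommRing A] {P : FlatPair A} [AddCommGroup M] [Module A M]
  [Module Aᵐᵒᵖ M] [IsCentralScalar A M] {R : InjRes P.ι} {κ : Type}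
  {φ : κ → (logDifferentialsPresheaf P.π P.ι ⟶ R.J.val)} (c : M ≃ₗ[A] (κ → A))
  {Y : Deformation P (augmentation A M)} {δ : κ → SheafDer Y.iX R.I}
  (hδ : ∀ k, Represents R Y (LinearMap.proj k ∘ₗ c.toLinearMap) (φ k) (δ k))

/-- The homomorphism from the sections of a deformation to those of the thickening that is defined
by its derivations. -/
def compareApp (V : Y.total.X.Opens) : Γ(Y.total.X, V) →+* ModelSection R φ (Y.iX ⁻¹ᵁ V) where
  toFun y := ⟨Y.iX.app V y, fun k ↦ (δ k).toFun V y, fun k ↦ (hδ k).d V y⟩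
  map_one' := ModelSection.ext (map_one _) (funext fun k ↦ (δ k).map_one V)
  map_mul' y z := ModelSection.ext (map_mul _ _ _) (funext fun k ↦ (δ k).map_mul V y z)
  map_zero' := ModelSection.ext (map_zero _) (funext fun k ↦ map_zero _)
  map_add' y z := ModelSection.ext (map_add _ _ _) (funext fun k ↦ map_add _ _ _)

variable [Finite κ]

/-- The morphism from the thickening to a deformation, on the underlying presheafed spaces. -/
def comparePresheafed :
    (modelThickening R φ).sheafedSpace.toPresheafedSpace ⟶ Y.total.X.toPresheafedSpace where
  base := Y.iX.base
  c :=
    { app := fun V ↦ CommRingCat.ofHom (compareApp c hδ V.unop)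
      naturality := fun V W h ↦ CommRingCat.hom_ext (RingHom.ext fun y ↦
        ModelSection.ext (app_resO Y.iX (leOfHom h.unop) (Y.iX.preimage_mono (leOfHom h.unop)) y)
          (funext fun k ↦ (δ k).map_res _ _ (leOfHom h.unop)
            (Y.iX.preimage_mono (leOfHom h.unop)) y)) }

lemma isLocalHom_stalkMap_comparePresheafed (x : P.X) :
    IsLocalHom (PresheafedSpace.Hom.stalkMap (comparePresheafed c hδ) x).hom := by
  have h1 : (modelThickening R φ).incl ≫ comparePresheafed c hδ = Y.iX.toPshHom := rfl
  have h2 := PresheafedSpace.stalkMap.comp (modelThickening R φ).incl (comparePresheafed c hδ) x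
  have h3 : IsLocalHom (Y.iX.toPshHom.stalkMap x).hom := Y.iX.toLRSHom.prop x
  have h4 : (Y.iX.toPshHom.stalkMap x).hom = RingHom.comp
    (PresheafedSpace.Hom.stalkMap (modelThickening R φ).incl x).hom
    (PresheafedSpace.Hom.stalkMap (comparePresheafed c hδ) x).hom := congrArg CommRingCat.Hom.hom h2
  rw [h4] at h3
  exact ⟨fun a ha ↦ h3.map_nonunit a
    (ha.map (PresheafedSpace.Hom.stalkMap (modelThickening R φ).incl x).hom)⟩

/-- The morphism from the thickening to a deformation that is defined by its derivations. -/
def compare : (modelThickening R φ).scheme ⟶ Y.total.X :=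
  ⟨{ toHom := comparePresheafed c hδ
     prop := isLocalHom_stalkMap_comparePresheafed c hδ }⟩

lemma inclusion_compare : (modelThickening R φ).inclusion ≫ compare c hδ = Y.iX := rfl

lemma compare_π : compare c hδ ≫ Y.total.π = modelπ R φ c := by
  refine hom_ext_of_structHom fun b ↦ ?_
  refine (structHom_comp (compare c hδ) ⊤ b).trans (Eq.trans ?_ (structHom_modelπ R φ c ⊤ b).symm)
  exact ModelSection.ext (app_structHom Y.isPullback_X.w ⊤ b)
    (funext fun k ↦ (hδ k).structHom ⊤ b)

/-- A morphism of flat thickenings of `X` is an isomorphism. -/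
lemma isIso_compare [IsLocalRing A] (hA : IsNilpotent (IsLocalRing.maximalIdeal A)) :
    IsIso (compare c hδ) := by
  have h1 := flat_modelπ R φ c hA
  have h2 := isPullback_modelπ R φ c
  have h3 := inclusion_compare c hδ
  have h4 := compare_π c hδ
  exact isIso_of_isPullback (Z := (modelThickening R φ).scheme)
    (i := (modelThickening R φ).inclusion) (πZ := modelπ R φ c) (i' := Y.iX)
    augmentation_surjective isNilpotent_ker_augmentation
    h2 Y.isPullback_X (compare c hδ) h3 h4

omit [Finite κ] in
/-- The lifts of equations of `D` are sent to equations of the thickening: this is what the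
condition on `dlog` in `Represents` says. -/
lemma isEquation_compareApp {V : Y.total.X.Opens} {y : Γ(Y.total.X, V)}
    (hy : Y.iX.app V y ∈ localEquations P.ι (Y.iX ⁻¹ᵁ V)) (hy' : Y.total.ι.app V y = 0) :
    (compareApp c hδ V y).IsEquation := by
  choose ℓ hℓ using fun k ↦ (R.bijective_smul _ _ hy).2 ((δ k).toFun V y)
  exact ⟨hy, ℓ, fun k ↦ ⟨hℓ k, (hδ k).dlog V y hy hy' (ℓ k) (hℓ k)⟩⟩

/-- The comparison morphism maps divisor to divisor, as the lifts of an equation of `D` to the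
deformation are sent to equations of the thickening. -/
lemma exists_compareD (hD : IsEffectiveCartier P.ι) :
    ∃ l : (modelIdeal R φ hD).subscheme ⟶ Y.total.D,
      l ≫ Y.total.ι = (modelIdeal R φ hD).subschemeι ≫ compare c hδ := by
  have := Y.total.isClosedImmersion
  refine exists_lift_of_isClosedImmersion _ _ fun V hV s hs ↦ ?_
  refine app_eq_zero_of_locally _ s fun z hz ↦ ?_
  have hα := augmentation_surjective (A := A) (M := M)
  have hK := isNilpotent_ker_augmentation (A := A) (M := M)
  have := surjective_of_isPullback Y.isPullback_X hα hK
  obtain ⟨x, rfl⟩ := Y.iX.surjective z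
  obtain ⟨U, hxU, g, hg⟩ := hD x
  obtain ⟨W, hW, hxW, hWU⟩ := exists_isAffineOpen_preimage Y.isPullback_X hα hK
    (U := U ⊓ Y.iX ⁻¹ᵁ V) ⟨hxU, hz⟩
  have hWV : W ≤ V := le_of_preimage_le Y.isPullback_X hα hK (hWU.trans inf_le_right)
  have hWa := isAffineOpen_preimage_of_isPullback Y.isPullback_X hα hW
  have hg := resO_mem_localEquations (hWU.trans inf_le_left) hg
  obtain ⟨y, hy, hyg⟩ := exists_equation_lift Y.isPullback_X hα Y.isPullback_D hW _
    (app_eq_zero_of_mem_localEquations hWa hg)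
  rw [← hyg] at hg
  have := Y.total.flat_divisor
  have h1 : RingHom.ker (Y.total.ι.app W).hom = Ideal.span {y} := by
    refine ker_app_eq_span Y.isPullback_X hα hK Y.isPullback_D hW hy fun s hs ↦ ?_
    rw [← ker_app_eq_of_mem_localEquations hWa hg]
    exact hs
  have h2 : Y.total.ι.app W (resO hWV s) = 0 := by
    rw [app_resO Y.total.ι hWV (Y.total.ι.preimage_mono hWV), hs, map_zero]
  have h3 : resO hWV s ∈ Ideal.span {y} := h1 ▸ h2
  obtain ⟨u, hu⟩ := Ideal.mem_span_singleton'.mp h3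
  refine ⟨W, hWV, hxW, ?_⟩
  have h4 := app_subschemeι_eq_zero_of_isEquation hD hWa (isEquation_compareApp c hδ hg hy)
  have h5 : ((modelIdeal R φ hD).subschemeι ≫ compare c hδ).app W y = 0 := h4
  rw [← hu, map_mul, h5, mul_zero]

/-- A deformation with a family of morphisms `φ k : Ω¹(log D) ⟶ J` is the deformation defined by
these morphisms. -/
lemma nonempty_equivalence_modelDeformation [IsLocalRing A]
    (hA : IsNilpotent (IsLocalRing.maximalIdeal A)) (hD : IsEffectiveCartier P.ι)
    (h : ∀ k, Rel R Y (LinearMap.proj k ∘ₗ c.toLinearMap) (φ k)) :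
    Nonempty ((modelDeformation R φ c hA hD).Equivalence Y) := by
  choose δ hδ using h
  obtain ⟨l, hl⟩ := exists_compareD c hδ hD
  have hα := augmentation_surjective (A := A) (M := M)
  have hK := isNilpotent_ker_augmentation (A := A) (M := M)
  have := Y.total.isClosedImmersion
  have h1 := isIso_compare c hδ hA
  have hiD : modelιD hD ≫ l = Y.iD := by
    rw [← cancel_mono Y.total.ι, Category.assoc, hl, ← Category.assoc, modelιD_subschemeι,
      Category.assoc, inclusion_compare, Y.isPullback_D.w]
  have := flat_subschemeι_modelπ (R := R) (φ := φ) c hD hA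
  have h2 : IsIso l := isIso_of_isPullback hα hK
    ((isPullback_modelιD hD).paste_vert (isPullback_modelπ R φ c))
    (Y.isPullback_D.paste_vert Y.isPullback_X) l hiD (by
      rw [← Category.assoc, hl, Category.assoc, compare_π])
  exact ⟨{
    eX := @asIso _ _ _ _ (compare c hδ) h1
    eD := @asIso _ _ _ _ l h2
    comm_π := compare_π c hδ
    comm_ι := hl
    comm_iX := inclusion_compare c hδ
    comm_iD := hiD }⟩

lemma equivalence_of_rel [IsLocalRing A] (hA : IsNilpotent (IsLocalRing.maximalIdeal A))
    (hD : IsEffectiveCartier P.ι) {Y' : Deformation P (augmentation A M)}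
    (h : ∀ k, Rel R Y (LinearMap.proj k ∘ₗ c.toLinearMap) (φ k))
    (h' : ∀ k, Rel R Y' (LinearMap.proj k ∘ₗ c.toLinearMap) (φ k)) : Y ≈ Y' :=
  Setoid.trans (Setoid.symm (nonempty_equivalence_modelDeformation c hA hD h))
    (nonempty_equivalence_modelDeformation c hA hD h')

end Compare

/-! ### Generic points -/

section Generic

lemma isField_of_mem_minimalPrimes {R S : Type*} [CommRing R] [CommRing S] [Algebra R S]
    [_root_.IsReduced S] (p : Ideal R) [p.IsPrime] [IsLocalization.AtPrime S p]
    (hp : p ∈ minimalPrimes R) : IsField S := by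
  have := IsLocalization.AtPrime.isLocalRing S p
  refine IsLocalRing.isField_iff_maximalIdeal_eq.mpr ?_
  have h1 := IsLocalization.AtPrime.radical_map_of_mem_minimalPrimes (A := S) p ⊥ hp
  rw [IsLocalization.AtPrime.map_eq_maximalIdeal p S, Ideal.map_bot] at h1
  rw [← h1]
  exact nilradical_eq_zero _

lemma mem_of_algebraMap_eq_zero {R S : Type*} [CommRing R] [CommRing S] [Algebra R S]
    (p : Ideal R) [hp : p.IsPrime] [IsLocalization.AtPrime S p] {g : R}
    (h : algebraMap R S g = 0) : g ∈ p := by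
  obtain ⟨t, ht⟩ := (IsLocalization.map_eq_zero_iff p.primeCompl S g).mp h
  have h3 : t.1 * g ∈ p := ht ▸ p.zero_mem
  exact (hp.mem_or_mem h3).resolve_left t.2

lemma isField_stalk_of_mem_minimalPrimes {X : Scheme.{0}} [IsReduced X] {V : X.Opens}
    (hV : IsAffineOpen V) (y : PrimeSpectrum Γ(X, V)) (hy : y.asIdeal ∈ minimalPrimes Γ(X, V))
    (hyV : hV.fromSpec y ∈ V) : IsField (X.presheaf.stalk (hV.fromSpec y)) := by
  exact @isField_of_mem_minimalPrimes _ _ _ _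
    (TopCat.Presheaf.algebra_section_stalk X.presheaf ⟨hV.fromSpec y, hyV⟩) inferInstance
    y.asIdeal y.isPrime (hV.isLocalization_stalk' y hyV) hy

/-- A section of a reduced scheme that vanishes at the generic points is zero. -/
lemma eq_zero_of_germ_eq_zero {X : Scheme.{0}} [IsReduced X] {V : X.Opens} (hV : IsAffineOpen V)
    (g : Γ(X, V)) (h : ∀ (x : X) (hx : x ∈ V), IsField (X.presheaf.stalk x) →
      X.presheaf.germ V x hx g = 0) : g = 0 := by
  have : _root_.IsReduced Γ(X, V) := IsReduced.component_reduced V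
  have h1 : g ∈ sInf (⊥ : Ideal Γ(X, V)).minimalPrimes := by
    refine Submodule.mem_sInf.mpr fun (p : Ideal Γ(X, V)) hp ↦ ?_
    have hpp : p.IsPrime := hp.1.1
    let y : PrimeSpectrum Γ(X, V) := ⟨p, hpp⟩
    have hyV : hV.fromSpec y ∈ V := by
      have : hV.fromSpec y ∈ Set.range hV.fromSpec := ⟨y, rfl⟩
      rwa [hV.range_fromSpec] at this
    exact @mem_of_algebraMap_eq_zero _ _ _ _
      (TopCat.Presheaf.algebra_section_stalk X.presheaf ⟨hV.fromSpec y, hyV⟩) p hpp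
      (hV.isLocalization_stalk' y hyV) g
      (h _ hyV (isField_stalk_of_mem_minimalPrimes hV y hp hyV))
  rw [Ideal.sInf_minimalPrimes] at h1
  have h2 : (⊥ : Ideal Γ(X, V)).radical = ⊥ := nilradical_eq_zero _
  rwa [h2] at h1

lemma exists_smul_eq_of_smul_eq_zero {A N : Type*} [CommRing A] [AddCommGroup N] [Module A N]
    [Module.Free A N] {a b : A} (h : ∀ c, a * c = 0 → c ∈ Ideal.span {b}) (x : N)
    (hx : a • x = 0) : ∃ y, x = b • y := by
  let e := Module.Free.chooseBasis A N
  have h1 : ∀ i, ∃ d, d * b = e.repr x i := fun i ↦ Ideal.mem_span_singleton'.mp (h _ (by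
    have := congrArg (fun v ↦ e.repr v i) hx
    simpa using this))
  choose d hd using h1
  refine ⟨e.repr.symm (Finsupp.onFinset (e.repr x).support
    (fun i ↦ if i ∈ (e.repr x).support then d i else 0) (fun i hi ↦ by
      by_contra h
      exact hi (if_neg h))), ?_⟩
  refine e.repr.injective (Finsupp.ext fun i ↦ ?_)
  rw [map_smul, LinearEquiv.apply_symm_apply, Finsupp.smul_apply, Finsupp.onFinset_apply]
  split_ifs with hi
  · rw [← hd, smul_eq_mul, mul_comm]
  · simpa using hi

variable {k A : Type} [Field k] [CommRing A] {α : A →+* k} {P : FlatPair k} (Q : Deformation P α)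

/-- The points of a deformation of `X` at which the local ring of `X` is a field. -/
def genericPoints : Set Q.total.X := {z | ∃ x, Q.iX x = z ∧ IsField (P.X.presheaf.stalk x)}

variable [IsLocalRing A] (hA : IsNilpotent (IsLocalRing.maximalIdeal A))

include hA in
lemma free_stalk (z : Q.total.X) : letI := (stalkHom Q.total.π z).toModule
    Module.Free A (Q.total.X.presheaf.stalk z) := by
  letI := (stalkHom Q.total.π z).toModule
  have := Q.total.flat
  have : Module.Flat A (Q.total.X.presheaf.stalk z) := flat_stalkHom z
  exact free_of_flat_of_isNilpotent_maximalIdeal hA _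

variable (hα : Function.Surjective α) {t : A} {n : ℕ} (ht : RingHom.ker α = Ideal.span {t})
  (h1 : ∀ c, t * c = 0 → c ∈ Ideal.span {t ^ n}) (h2 : ∀ c, t ^ n * c = 0 → c ∈ Ideal.span {t})
  (h3 : t ^ (n + 1) = 0)

include hα hA ht h1 h2 h3

/-- A section of a deformation of a reduced scheme that vanishes at the generic points is zero, over
a ring like `k[t] / t ^ (n + 1)`. -/
lemma eq_zero_of_germ_genericPoints_of_isAffineOpen [IsReduced P.X] {V : Q.total.X.Opens}
    (hV : IsAffineOpen V) (f : Γ(Q.total.X, V))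
    (hf : ∀ z (hz : z ∈ V), z ∈ genericPoints Q → Q.total.X.presheaf.germ V z hz f = 0) :
    f = 0 := by
  letI : Module A Γ(Q.total.X, V) := (structHom Q.total.π V).toModule
  have := Q.total.flat
  have : Module.Flat A Γ(Q.total.X, V) := flat_structHom hV
  have := free_of_flat_of_isNilpotent_maximalIdeal hA Γ(Q.total.X, V)
  suffices H : ∀ (m : ℕ) (f : Γ(Q.total.X, V)), (∀ z (hz : z ∈ V), z ∈ genericPoints Q →
      Q.total.X.presheaf.germ V z hz f = 0) → t ^ m • f = 0 → f = 0 from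
    H (n + 1) f hf (by rw [h3, zero_smul])
  intro m
  induction m with
  | zero => intro f _ h; rwa [pow_zero, one_smul] at h
  | succ m ih =>
    intro f hf h
    refine ih f hf ?_
    rw [pow_succ', mul_smul] at h
    obtain ⟨g, hg⟩ := exists_smul_eq_of_smul_eq_zero h1 _ h
    -- As `t ^ n • g` vanishes at the generic points of `X`, so does `g` modulo `t`.
    have hg0 : Q.iX.app V g = 0 := by
      refine eq_zero_of_germ_eq_zero
        (isAffineOpen_preimage_of_isPullback Q.isPullback_X hα hV) _ fun x hx hfx ↦ ?_
      letI := (stalkHom Q.total.π (Q.iX x)).toModule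
      have := free_stalk Q hA (Q.iX x)
      have hs (a : A) (y : Γ(Q.total.X, V)) : Q.total.X.presheaf.germ V (Q.iX x) hx (a • y) =
          a • Q.total.X.presheaf.germ V (Q.iX x) hx y :=
        (map_mul (Q.total.X.presheaf.germ V (Q.iX x) hx).hom (structHom Q.total.π V a) y).trans
          (congrArg (· * _) (germ_structHom Q.total.π hx a))
      have h4 := hf (Q.iX x) hx ⟨x, rfl, hfx⟩
      have h5 : t ^ n • Q.total.X.presheaf.germ V (Q.iX x) hx g = 0 := by
        rw [← hs, ← hg, hs, h4, smul_zero]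
      obtain ⟨y, hy⟩ := exists_smul_eq_of_smul_eq_zero h2 _ h5
      have h6 := Q.iX.germ_stalkMap_apply V x hx g
      rw [hy] at h6
      refine h6.symm.trans ((map_mul (Q.iX.stalkMap x).hom (stalkHom Q.total.π _ t) y).trans ?_)
      have h7 : α t = 0 := by
        rw [← RingHom.mem_ker, ht]; exact Ideal.mem_span_singleton_self t
      have h8 := stalkMap_stalkHom Q.isPullback_X.w x t
      rw [h7, map_zero] at h8
      exact (congrArg (· * _) h8).trans (zero_mul _)
    have hg1 : g ∈ RingHom.ker (Q.iX.app V).hom := hg0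
    rw [ker_app_of_isPullback Q.isPullback_X hα hV, ht, Ideal.map_span, Set.image_singleton] at hg1
    obtain ⟨y, hy⟩ := Ideal.mem_span_singleton'.mp hg1
    have hy : g = t • y := hy.symm.trans (mul_comm _ _)
    rw [hg, hy, smul_smul, ← pow_succ, h3, zero_smul]

lemma eq_zero_of_germ_genericPoints [IsReduced P.X] {U : Q.total.X.Opens} (f : Γ(Q.total.X, U))
    (hf : ∀ z (hz : z ∈ U), z ∈ genericPoints Q → Q.total.X.presheaf.germ U z hz f = 0) :
    f = 0 := by
  refine TopCat.Presheaf.section_ext Q.total.X.sheaf U _ _ fun z hz ↦ ?_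
  obtain ⟨V, hV, hzV, h⟩ := exists_isAffineOpen_le hz
  have h4 : resO h f = 0 := eq_zero_of_germ_genericPoints_of_isAffineOpen Q hA hα ht h1 h2 h3 hV _
    fun z' hz' hS ↦
      (Q.total.X.presheaf.germ_res_apply (homOfLE h) z' hz' f).trans (hf z' (h hz') hS)
  have h5 := Q.total.X.presheaf.germ_res_apply (homOfLE h) z hzV f
  refine h5.symm.trans ((congrArg _ h4).trans ?_)
  exact (map_zero _).trans (map_zero _).symm

omit [IsLocalRing A] hA ht h1 h2 h3 in
/-- The equations of the divisor are units at the generic points. -/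
lemma isUnit_germ_of_mem_localEquations (hK : IsNilpotent (RingHom.ker α)) {U : Q.total.X.Opens}
    {g : Γ(Q.total.X, U)} (hg : g ∈ localEquations Q.total.ι U) {z : Q.total.X} (hz : z ∈ U)
    (hS : z ∈ genericPoints Q) : IsUnit (Q.total.X.presheaf.germ U z hz g) := by
  obtain ⟨x, rfl, hx⟩ := hS
  obtain ⟨V, hV, hzV, h⟩ := exists_isAffineOpen_le hz
  have e := Q.total.X.presheaf.germ_res_apply (homOfLE h) _ hzV g
  rw [← e]
  have hnz := mem_nonZeroDivisors_of_mem_localEquations hV (resO_mem_localEquations h hg)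
  letI := TopCat.Presheaf.algebra_section_stalk Q.total.X.presheaf ⟨Q.iX x, hzV⟩
  have := hV.isLocalization_stalk ⟨Q.iX x, hzV⟩
  have hnz' : Q.total.X.presheaf.germ V (Q.iX x) hzV (resO h g) ∈
      nonZeroDivisors (Q.total.X.presheaf.stalk (Q.iX x)) :=
    IsLocalization.map_nonZeroDivisors_le (hV.primeIdealOf ⟨Q.iX x, hzV⟩).asIdeal.primeCompl
      (Q.total.X.presheaf.stalk (Q.iX x)) (Submonoid.mem_map_of_mem _ hnz)
  refine isUnit_of_map_unit (Q.iX.stalkMap x).hom _ ?_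
  letI := hx.toField
  refine IsUnit.mk0 _ fun h0 ↦ ?_
  have h4 : Q.total.X.presheaf.germ V (Q.iX x) hzV (resO h g) ∈ RingHom.ker (Q.iX.stalkMap x).hom :=
    h0
  rw [ker_stalkMap_of_isPullback Q.isPullback_X hα x] at h4
  obtain ⟨m, hm⟩ := hK
  have h5 := Ideal.pow_mem_pow h4 m
  rw [← Ideal.map_pow, hm, Ideal.zero_eq_bot, Ideal.map_bot, Ideal.mem_bot] at h5
  have h6 := pow_mem hnz' m
  rw [h5] at h6
  exact one_ne_zero (h6.2 1 (mul_zero _))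

end Generic

/-! ### The resolution by skyscraper modules at the generic points -/

section Resolution

variable {X : Scheme.{0}}

/-- An injective module that contains the local ring at `x`. -/
def stalkInjective (x : X) : ModuleCat.{0} (X.presheaf.stalk x) :=
  Injective.under (ModuleCat.of (X.presheaf.stalk x) (X.presheaf.stalk x))

/-- The inclusion of the local ring at `x` in an injective module. -/
def toStalkInjective (x : X) : X.presheaf.stalk x →ₗ[X.presheaf.stalk x] stalkInjective x :=
  (Injective.ι (ModuleCat.of (X.presheaf.stalk x) (X.presheaf.stalk x))).hom

lemma toStalkInjective_injective (x : X) : Function.Injective (toStalkInjective x) :=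
  (ModuleCat.mono_iff_injective (Injective.ι
    (ModuleCat.of (X.presheaf.stalk x) (X.presheaf.stalk x)))).mp inferInstance

variable (S : Set X)

/-- The morphism from the structure sheaf to the product of the injective modules at the points of
`S`. -/
def toSkyProdInjective : structureSheaf X ⟶ skyProd X S stalkInjective where
  val := PresheafOfModules.homMk
    { app := fun U ↦ AddCommGrpCat.ofHom (X := Γ(X, U.unop))
        (Y := SkyProd X S stalkInjective U.unop)
        (AddMonoidHom.mk' (fun f x ↦ toStalkInjective x.1 (X.presheaf.germ U.unop x.1 x.2.1 f))
          fun f g ↦ by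
            funext x
            exact (congrArg (toStalkInjective x.1)
              (map_add (X.presheaf.germ U.unop x.1 x.2.1).hom f g)).trans (map_add _ _ _))
      naturality := fun U V i ↦ by
        ext f
        funext x
        exact congrArg (toStalkInjective x.1) (X.presheaf.germ_res_apply i.unop x.1 x.2.1 f) }
    (fun U f g ↦ by
      funext x
      exact (congrArg (toStalkInjective x.1)
        (map_mul (X.presheaf.germ U.unop x.1 x.2.1).hom f g)).trans
        ((toStalkInjective x.1).map_smul _ _))

variable {S} in
lemma mono_toSkyProdInjective (hS : ∀ (U : X.Opens) (f : Γ(X, U)), (∀ z (hz : z ∈ U), z ∈ S →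
    X.presheaf.germ U z hz f = 0) → f = 0) : Mono (toSkyProdInjective S) := by
  have h1 : Mono ((Scheme.Modules.toPresheaf X).map (toSkyProdInjective S)) := by
    refine (NatTrans.mono_iff_mono_app _).mpr fun U ↦ (AddCommGrpCat.mono_iff_injective _).mpr ?_
    refine (injective_iff_map_eq_zero ((toSkyProdInjective S).app U.unop).hom).mpr fun f hf ↦ ?_
    refine hS U.unop f fun z hz hzS ↦ toStalkInjective_injective z ?_
    exact (congrFun hf ⟨z, hz, hzS⟩).trans (map_zero _).symm
  exact (Scheme.Modules.toPresheaf X).mono_of_mono_map h1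

/-- The resolution of the structure sheaf by skyscraper modules at a set of points that detects
whether a section is zero and at which the equations of `D` are units. -/
def skyInjRes {D : Scheme.{0}} (ι : D ⟶ X) (hS : ∀ (U : X.Opens) (f : Γ(X, U)),
    (∀ z (hz : z ∈ U), z ∈ S → X.presheaf.germ U z hz f = 0) → f = 0)
    (hι : ∀ (U : X.Opens) (g : Γ(X, U)), g ∈ localEquations ι U → ∀ z (hz : z ∈ U), z ∈ S →
      IsUnit (X.presheaf.germ U z hz g)) : InjRes ι where
  I := skyProd X S stalkInjective
  J := Limits.cokernel (toSkyProdInjective S)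
  j := toSkyProdInjective S
  q := Limits.cokernel.π _
  w := Limits.cokernel.condition _
  shortExact :=
    { exact := ShortComplex.exact_cokernel _
      mono_f := mono_toSkyProdInjective hS
      epi_g := inferInstanceAs (Epi (Limits.cokernel.π _)) }
  injective := injective_skyProd X S stalkInjective fun x ↦ Injective.injective_under _
  bijective_smul U g hg := by
    have hu := fun x : {x : X // x ∈ U ∧ x ∈ S} ↦ hι U g hg x.1 x.2.1 x.2.2
    refine ⟨fun m m' h ↦ funext fun x ↦ ?_, fun m ↦ ⟨fun x ↦ (↑(hu x).unit⁻¹ :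
      X.presheaf.stalk x.1) • (m : SkyProd X S stalkInjective U) x, funext fun x ↦ ?_⟩⟩
    · exact (hu x).smul_left_cancel.mp (congrFun h x)
    · change X.presheaf.germ U x.1 x.2.1 g • (↑(hu x).unit⁻¹ : X.presheaf.stalk x.1) •
        (m : SkyProd X S stalkInjective U) x = _
      rw [smul_smul, IsUnit.mul_val_inv, one_smul]

end Resolution

section Generic

/-- The local rings of a scheme locally of finite type over a field are essentially of finite
type. -/
lemma essFiniteType_stalk {k : Type} [Field k] {X : Scheme.{0}} (π : X ⟶ Spec (.of k))
    [LocallyOfFiniteType π] (x : X) :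
    @Algebra.EssFiniteType k (X.presheaf.stalk x) _ _ (stalkHom π x).toAlgebra := by
  obtain ⟨V, hV, hxV, -⟩ := exists_isAffineOpen_le (U := ⊤) (x := x) trivial
  letI : Algebra k Γ(X, V) := (structHom π V).toAlgebra
  letI : Algebra k (X.presheaf.stalk x) := (stalkHom π x).toAlgebra
  letI alg : Algebra Γ(X, V) (X.presheaf.stalk x) :=
    TopCat.Presheaf.algebra_section_stalk X.presheaf ⟨x, hxV⟩
  have h1 := hV.isLocalization_stalk ⟨x, hxV⟩
  have h2 := @Algebra.EssFiniteType.of_isLocalization Γ(X, V) (X.presheaf.stalk x) _ _ alg _ h1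
  have : IsScalarTower k Γ(X, V) (X.presheaf.stalk x) :=
    IsScalarTower.of_algebraMap_eq fun b ↦ (germ_structHom π hxV b).symm
  have h3 : (structHom π V).FiniteType := by
    have h4 := π.finiteType_appLE (isAffineOpen_top _) hV le_top
    have h5 : (Scheme.ΓSpecIso (.of k)).inv.hom.FiniteType := RingHom.FiniteType.of_surjective _
      (ConcreteCategory.bijective_of_isIso (Scheme.ΓSpecIso (.of k)).inv).2
    exact h4.comp h5
  have : Algebra.FiniteType k Γ(X, V) := h3
  exact Algebra.EssFiniteType.comp k Γ(X, V) (X.presheaf.stalk x)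

variable {k A : Type} [Field k] [PerfectField k] [CommRing A] [Algebra k A] (e : A →ₐ[k] k)
  {P : FlatPair k} [LocallyOfFiniteType P.π] (Q : Deformation P e.toRingHom)

/-- At the generic points, a deformation over the dual numbers is trivial. -/
lemma exists_stalk_ringHom (he : IsNilpotent (RingHom.ker e))
    (Y : Deformation Q.total (augmentation A A)) (z : Q.total.X) (hz : z ∈ genericPoints Q) :
    ∃ Ψ : Y.total.X.presheaf.stalk (Y.iX z) →+*
        TrivSqZeroExt (Q.total.X.presheaf.stalk z) (Q.total.X.presheaf.stalk z),
      (∀ y, (Ψ y).fst = Y.iX.stalkMap z y) ∧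
      ∀ b, (Ψ (stalkHom Y.total.π (Y.iX z) b)).snd = stalkHom Q.total.π z b.snd := by
  obtain ⟨x, rfl, hx⟩ := hz
  let z := Q.iX x
  have hα : Function.Surjective e.toRingHom := fun a ↦ ⟨algebraMap k A a, e.commutes a⟩
  letI := hx.toField
  letI : Algebra k (P.X.presheaf.stalk x) := (stalkHom P.π x).toAlgebra
  have := essFiniteType_stalk P.π x
  letI : Algebra A (Q.total.X.presheaf.stalk z) := (stalkHom Q.total.π z).toAlgebra
  letI : Algebra (TrivSqZeroExt A A) (Y.total.X.presheaf.stalk (Y.iX z)) :=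
    (stalkHom Y.total.π (Y.iX z)).toAlgebra
  have := Y.total.flat
  have : Module.Flat (TrivSqZeroExt A A) (Y.total.X.presheaf.stalk (Y.iX z)) := flat_stalkHom _
  have := isClosedImmersion_of_isPullback Q.isPullback_X hα
  have := isClosedImmersion_of_isPullback Y.isPullback_X augmentation_surjective
  obtain ⟨Ψ, h1, h2⟩ := exists_ringHom_trivSqZeroExt e he (κ := P.X.presheaf.stalk x)
    (Y.iX.stalkMap z).hom (Y.iX.stalkMap_surjective z) (stalkMap_stalkHom Y.isPullback_X.w z)
    (fun y hy ↦ by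
      have h : y ∈ RingHom.ker (Y.iX.stalkMap z).hom := hy
      rwa [ker_stalkMap_of_isPullback Y.isPullback_X augmentation_surjective z] at h)
    (Q.iX.stalkMap x).hom (Q.iX.stalkMap_surjective x) (stalkMap_stalkHom Q.isPullback_X.w x)
    (fun y hy ↦ by
      have h : y ∈ RingHom.ker (Q.iX.stalkMap x).hom := hy
      rwa [ker_stalkMap_of_isPullback Q.isPullback_X hα x] at h)
  refine ⟨Ψ, h1, fun b ↦ ?_⟩
  refine (congrArg TrivSqZeroExt.snd (h2 b)).trans ?_
  rw [TrivSqZeroExt.snd_add, TrivSqZeroExt.snd_inl, zero_add, TrivSqZeroExt.snd_inr]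
  rfl

/-- A deformation over the dual numbers belongs to a morphism `Ω¹(log D) ⟶ J`, where `J = I / 𝒪` for
the product `I` of injective modules at the generic points. -/
lemma exists_rel (he : IsNilpotent (RingHom.ker e)) (Y : Deformation Q.total (augmentation A A))
    (hS : ∀ (U : Q.total.X.Opens) (f : Γ(Q.total.X, U)),
      (∀ z (hz : z ∈ U), z ∈ genericPoints Q → Q.total.X.presheaf.germ U z hz f = 0) → f = 0)
    (hι : ∀ (U : Q.total.X.Opens) (g : Γ(Q.total.X, U)), g ∈ localEquations Q.total.ι U →
      ∀ z (hz : z ∈ U), z ∈ genericPoints Q → IsUnit (Q.total.X.presheaf.germ U z hz g)) :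
    ∃ φ, Rel (skyInjRes (genericPoints Q) Q.total.ι hS hι) Y LinearMap.id φ := by
  choose Ψ h1 h2 using exists_stalk_ringHom e Q he Y
  have hg (V : Y.total.X.Opens) (z : Q.total.X) (hz : z ∈ Y.iX ⁻¹ᵁ V) (hzS : z ∈ genericPoints Q)
      (y : Γ(Y.total.X, V)) : (Ψ z hzS (Y.total.X.presheaf.germ V (Y.iX z) hz y)).fst =
        Q.total.X.presheaf.germ (Y.iX ⁻¹ᵁ V) z hz (Y.iX.app V y) := by
    rw [h1]
    exact Y.iX.germ_stalkMap_apply V z hz y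
  let δ : SheafDer Y.iX (skyProd Q.total.X (genericPoints Q) stalkInjective) :=
    { toFun := fun V ↦ AddMonoidHom.mk'
        (fun y ↦ ((fun z ↦ toStalkInjective z.1 (Ψ z.1 z.2.2
          (Y.total.X.presheaf.germ V (Y.iX z.1) z.2.1 y)).snd :
            SkyProd Q.total.X (genericPoints Q) stalkInjective (Y.iX ⁻¹ᵁ V))))
        (fun y y' ↦ by
          funext z
          rw [map_add, map_add, TrivSqZeroExt.snd_add, map_add]
          rfl)
      map_mul := fun V y y' ↦ by
        funext z
        change toStalkInjective z.1 (Ψ z.1 z.2.2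
          (Y.total.X.presheaf.germ V (Y.iX z.1) z.2.1 (y * y'))).snd =
            Q.total.X.presheaf.germ _ z.1 z.2.1 (Y.iX.app V y) • toStalkInjective z.1 _ +
            Q.total.X.presheaf.germ _ z.1 z.2.1 (Y.iX.app V y') • toStalkInjective z.1 _
        rw [map_mul, map_mul, TrivSqZeroExt.snd_mul, map_add, hg, hg, ← map_smul, ← map_smul,
          op_smul_eq_smul]
      map_res := fun V W h h' y ↦ by
        funext z
        exact congrArg (fun t ↦ toStalkInjective z.1 (Ψ z.1 z.2.2 t).snd)
          (Y.total.X.presheaf.germ_res_apply (homOfLE h) (Y.iX z.1) z.2.1 y) }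
  refine Rel.exists_of_sheafDer (R := skyInjRes (genericPoints Q) Q.total.ι hS hι) δ fun V b ↦ ?_
  funext z
  have h3 : (Ψ z.1 z.2.2 (Y.total.X.presheaf.germ V (Y.iX z.1) z.2.1
      (structHom Y.total.π V b))).snd =
      Q.total.X.presheaf.germ _ z.1 z.2.1 (structHom Q.total.π (Y.iX ⁻¹ᵁ V) b.snd) := by
    have h4 := germ_structHom Y.total.π (V := V) (z := Y.iX z.1) z.2.1 b
    have h5 := germ_structHom Q.total.π (V := Y.iX ⁻¹ᵁ V) (z := z.1) z.2.1 b.snd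
    exact (congrArg (fun t ↦ (Ψ z.1 z.2.2 t).snd) h4).trans ((h2 _ _ b).trans h5.symm)
  exact congrArg (toStalkInjective z.1) h3

end Generic

/-! ### Base change of deformations -/

section BaseChange

variable {A B B' : Type} [CommRing A] [CommRing B] [CommRing B'] {P : FlatPair A} {α : B →+* A}
  {α' : B' →+* A}

/-- Base changes of deformations exist, and they are deformations of the same pair if the
augmentations are compatible. -/
lemma exists_isBaseChange (g : B →+* B') (hg : α'.comp g = α) (Y : Deformation P α) :
    ∃ Y' : Deformation P α', Y.IsBaseChange g Y' := by
  have e : Spec.map (CommRingCat.ofHom α) =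
      Spec.map (CommRingCat.ofHom α') ≫ Spec.map (CommRingCat.ofHom g) := by
    rw [← Spec.map_comp, ← CommRingCat.ofHom_comp, hg]
  have := Y.total.isClosedImmersion
  have := Y.total.flat
  have := Y.total.flat_divisor
  have hX := IsPullback.of_hasPullback Y.total.π (Spec.map (CommRingCat.ofHom g))
  have hD := IsPullback.of_hasPullback Y.total.ι
    (Limits.pullback.fst Y.total.π (Spec.map (CommRingCat.ofHom g)))
  have hY := Y.isPullback_X
  rw [e] at hY
  let iX := hX.lift Y.iX (P.π ≫ Spec.map (CommRingCat.ofHom α')) (by rw [hY.w, Category.assoc])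
  have hiX : iX ≫ _ = Y.iX := hX.lift_fst _ _ _
  have hiX' : iX ≫ _ = P.π ≫ Spec.map (CommRingCat.ofHom α') := hX.lift_snd _ _ _
  let iD := hD.lift Y.iD (P.ι ≫ iX) (by rw [Category.assoc, hiX, Y.isPullback_D.w])
  have hiD : iD ≫ _ = Y.iD := hD.lift_fst _ _ _
  have hiD' : iD ≫ _ = P.ι ≫ iX := hD.lift_snd _ _ _
  refine ⟨{ total := ⟨_, _, _, _, MorphismProperty.of_isPullback hD inferInstance,
    MorphismProperty.of_isPullback hX inferInstance,
    MorphismProperty.of_isPullback (hD.paste_vert hX) inferInstance⟩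
            iX := iX
            iD := iD
            isPullback_X := IsPullback.of_right (by rwa [hiX]) hiX' hX
            isPullback_D := IsPullback.of_right (by rw [hiD, hiX]; exact Y.isPullback_D) hiD' hD },
    _, _, hX, hD, hiX, hiD⟩

end BaseChange

/-! ### The first-order deformations of a pair -/

section Main

variable {A : Type} [CommRing A] [IsLocalRing A] {P : FlatPair A} (R : InjRes P.ι)
  (hA : IsNilpotent (IsLocalRing.maximalIdeal A)) (hD : IsEffectiveCartier P.ι)

omit [IsLocalRing A] in
lemma rel_of_equivalence {Y Y' : Deformation P (augmentation A A)} (e : Y ≈ Y')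
    {φ : logDifferentialsPresheaf P.π P.ι ⟶ R.J.val} (h : Rel R Y LinearMap.id φ) :
    Rel R Y' LinearMap.id φ := by
  obtain ⟨e⟩ := e
  have h1 : Y'.IsBaseChange (mapHom LinearMap.id) Y := by
    have h2 : Spec.map (CommRingCat.ofHom (mapHom (LinearMap.id (R := A) (M := A)))) = 𝟙 _ := by
      have : mapHom (LinearMap.id (R := A) (M := A)) = RingHom.id _ := by
        ext x <;> simp
      rw [this]
      exact Spec.map_id _
    refine ⟨e.eX.hom, e.eD.hom, ?_, IsPullback.of_horiz_isIso ⟨e.comm_ι⟩, e.comm_iX, e.comm_iD⟩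
    rw [h2]
    exact IsPullback.of_horiz_isIso ⟨by rw [e.comm_π, Category.comp_id]⟩
  exact Rel.of_isBaseChange h1 h

variable (hex : ∀ Y : Deformation P (augmentation A A), ∃ φ, Rel R Y LinearMap.id φ)

include hA hD in
/-- Isomorphic deformations are those with the same class: both conditions say that `φ - φ'` lifts
to `I`. -/
lemma equivalence_iff_connecting_eq {Y Y' : Deformation P (augmentation A A)}
    {φ φ' : logDifferentialsPresheaf P.π P.ι ⟶ R.J.val} (h : Rel R Y LinearMap.id φ)
    (h' : Rel R Y' LinearMap.id φ') : Y ≈ Y' ↔ connecting P R φ = connecting P R φ' := by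
  rw [← sub_eq_zero]
  have e : connecting P R φ - connecting P R φ' = connecting P R (φ - φ') := by
    rw [sub_eq_iff_eq_add, ← connecting_add, sub_add_cancel]
  rw [e, connecting_eq_zero_iff]
  constructor
  · intro hY
    have h1 := (rel_of_equivalence R hY h).add h'.neg
    rw [add_neg_cancel, ← sub_eq_add_neg] at h1
    exact h1.exists_hom
  · rintro ⟨θ, hθ⟩
    have h1 := h'.add (Rel.of_hom R Y' θ)
    rw [add_zero, ← hθ, add_sub_cancel] at h1
    let c : A ≃ₗ[A] (Unit → A) := (LinearEquiv.funUnique Unit A A).symm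
    exact equivalence_of_rel (φ := fun _ ↦ φ) c hA hD (fun _ ↦ h) (fun _ ↦ h1)

include hA hD in
lemma exists_rel_of_hom (φ : logDifferentialsPresheaf P.π P.ι ⟶ R.J.val) :
    ∃ Y : Deformation P (augmentation A A), Rel R Y LinearMap.id φ := by
  let c : A ≃ₗ[A] (Unit → A) := (LinearEquiv.funUnique Unit A A).symm
  exact ⟨modelDeformation R (fun _ ↦ φ) c hA hD, rel_modelDeformation R (fun _ ↦ φ) c hA hD ()⟩

include hA hD in
/-- Two morphisms belong to a common deformation over `A[ε₁, ε₂]`; it realizes the sum of their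
classes. -/
lemma exists_rel_of_hom_pair (φ ψ : logDifferentialsPresheaf P.π P.ι ⟶ R.J.val) :
    ∃ Z : Deformation P (augmentation A (A × A)), Rel R Z (LinearMap.fst A A A) φ ∧
      Rel R Z (LinearMap.snd A A A) ψ := by
  let c : (A × A) ≃ₗ[A] (Bool → A) :=
    { toFun := fun x b ↦ cond b x.1 x.2
      map_add' := fun x y ↦ by funext b; cases b <;> rfl
      map_smul' := fun a x ↦ by funext b; cases b <;> rfl
      invFun := fun f ↦ (f true, f false)
      left_inv := fun x ↦ rfl
      right_inv := fun f ↦ by funext b; cases b <;> rfl }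
  exact ⟨modelDeformation R (fun b ↦ cond b φ ψ) c hA hD,
    rel_modelDeformation R (fun b ↦ cond b φ ψ) c hA hD true,
    rel_modelDeformation R (fun b ↦ cond b φ ψ) c hA hD false⟩

omit [IsLocalRing A] in
/-- The class in `Ext¹` depends only on the deformation and on `c`. -/
lemma Rel.connecting_eq {M : Type} [AddCommGroup M] [Module A M] [Module Aᵐᵒᵖ M]
    [IsCentralScalar A M] {Y : Deformation P (augmentation A M)} {c : M →ₗ[A] A}
    {φ φ' : logDifferentialsPresheaf P.π P.ι ⟶ R.J.val} (h : Rel R Y c φ) (h' : Rel R Y c φ') :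
    connecting P R φ = connecting P R φ' := by
  have h1 := h.add h'.neg
  rw [add_neg_cancel, ← sub_eq_add_neg] at h1
  have h2 := (connecting_eq_zero_iff P R (φ - φ')).mpr h1.exists_hom
  rw [← sub_add_cancel φ φ', connecting_add, h2, zero_add]

variable {R}

/-- The class in `Ext¹` of a deformation over the dual numbers. -/
def deformationClass (Y : Deformation P (augmentation A A)) : LogExt1 P :=
  connecting P R (hex Y).choose

omit [IsLocalRing A] in
lemma deformationClass_eq {Y : Deformation P (augmentation A A)}
    {φ : logDifferentialsPresheaf P.π P.ι ⟶ R.J.val} (h : Rel R Y LinearMap.id φ) :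
    deformationClass hex Y = connecting P R φ :=
  Rel.connecting_eq R (hex Y).choose_spec h

include hA hD in
lemma equivalence_iff_deformationClass_eq {Y Y' : Deformation P (augmentation A A)} :
    Y ≈ Y' ↔ deformationClass hex Y = deformationClass hex Y' :=
  equivalence_iff_connecting_eq R hA hD (hex Y).choose_spec (hex Y').choose_spec

/-- The bijection from `T¹` to `Ext¹`. -/
def T1.classEquiv : T1 P ≃ LogExt1 P :=
  Equiv.ofBijective (Quotient.lift (deformationClass hex)
    fun _ _ h ↦ (equivalence_iff_deformationClass_eq hA hD hex).mp h) (by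
      refine ⟨?_, fun x ↦ ?_⟩
      · rintro ⟨Y⟩ ⟨Y'⟩ h
        exact Quotient.sound ((equivalence_iff_deformationClass_eq hA hD hex).mpr h)
      · obtain ⟨φ, rfl⟩ := connecting_surjective P R x
        obtain ⟨Y, hY⟩ := exists_rel_of_hom R hA hD φ
        exact ⟨T1.mk Y, deformationClass_eq hex hY⟩)

lemma T1.classEquiv_eq {Y : Deformation P (augmentation A A)}
    {φ : logDifferentialsPresheaf P.π P.ι ⟶ R.J.val} (h : Rel R Y LinearMap.id φ) :
    T1.classEquiv hA hD hex (T1.mk Y) = connecting P R φ := deformationClass_eq hex h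

omit [IsLocalRing A] in
lemma augmentation_comp_mapHom {M N : Type} [AddCommGroup M] [Module A M] [Module Aᵐᵒᵖ M]
    [IsCentralScalar A M] [AddCommGroup N] [Module A N] [Module Aᵐᵒᵖ N] [IsCentralScalar A N]
    (f : M →ₗ[A] N) : (augmentation A N).comp (mapHom f) = augmentation A M := by
  ext x; simp

lemma T1.isSum_iff (ξ η ζ : T1 P) : T1.IsSum ξ η ζ ↔ T1.classEquiv hA hD hex ζ =
    T1.classEquiv hA hD hex ξ + T1.classEquiv hA hD hex η := by
  constructor
  · rintro ⟨Z, Y₁, Y₂, Y, h₁, h₂, h, rfl, rfl, rfl⟩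
    obtain ⟨φ₁, r₁⟩ := hex Y₁
    obtain ⟨φ₂, r₂⟩ := hex Y₂
    obtain ⟨φ, r⟩ := hex Y
    rw [T1.classEquiv_eq hA hD hex r₁, T1.classEquiv_eq hA hD hex r₂,
      T1.classEquiv_eq hA hD hex r, ← connecting_add]
    refine Rel.connecting_eq R (Rel.of_isBaseChange h r) ?_
    exact (Rel.of_isBaseChange h₁ r₁).add (Rel.of_isBaseChange h₂ r₂)
  · intro h
    obtain ⟨Y₁, rfl⟩ := Quotient.exists_rep ξ
    obtain ⟨Y₂, rfl⟩ := Quotient.exists_rep η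
    obtain ⟨Y, rfl⟩ := Quotient.exists_rep ζ
    obtain ⟨φ₁, r₁⟩ := hex Y₁
    obtain ⟨φ₂, r₂⟩ := hex Y₂
    obtain ⟨Z, z₁, z₂⟩ := exists_rel_of_hom_pair R hA hD φ₁ φ₂
    have key (f : A × A →ₗ[A] A) (φ : logDifferentialsPresheaf P.π P.ι ⟶ R.J.val)
        (hf : Rel R Z f φ) (x : T1 P) (hx : T1.classEquiv hA hD hex x = connecting P R φ) :
        ∃ Y', Z.IsBaseChange (mapHom f) Y' ∧ T1.mk Y' = x := by
      obtain ⟨Y', hY'⟩ := exists_isBaseChange (mapHom f) (augmentation_comp_mapHom f) Z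
      obtain ⟨φ', r'⟩ := hex Y'
      refine ⟨Y', hY', (T1.classEquiv hA hD hex).injective ?_⟩
      rw [hx, T1.classEquiv_eq hA hD hex r']
      exact Rel.connecting_eq R (Rel.of_isBaseChange hY' r') hf
    have e₁ := T1.classEquiv_eq hA hD hex r₁
    have e₂ := T1.classEquiv_eq hA hD hex r₂
    obtain ⟨Y₁', b₁, c₁⟩ := key _ _ z₁ (T1.mk Y₁) e₁
    obtain ⟨Y₂', b₂, c₂⟩ := key _ _ z₂ (T1.mk Y₂) e₂
    obtain ⟨Y', b, c⟩ := key _ _ (z₁.add z₂) (T1.mk Y) (by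
      rw [connecting_add, ← e₁, ← e₂]; exact h)
    exact ⟨Z, Y₁', Y₂', Y', b₁, b₂, b, c₁, c₂, c⟩

lemma T1.isSMul_iff (a : A) (ξ ζ : T1 P) : T1.IsSMul a ξ ζ ↔ T1.classEquiv hA hD hex ζ =
    a • T1.classEquiv hA hD hex ξ := by
  have key {Y Y' : Deformation P (augmentation A A)}
      (h : Y.IsBaseChange (mapHom (a • LinearMap.id)) Y') :
      T1.classEquiv hA hD hex (T1.mk Y') = a • T1.classEquiv hA hD hex (T1.mk Y) := by
    obtain ⟨φ, r⟩ := hex Y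
    obtain ⟨φ', r'⟩ := hex Y'
    rw [T1.classEquiv_eq hA hD hex r, T1.classEquiv_eq hA hD hex r', ← connecting_smul]
    exact Rel.connecting_eq R (Rel.of_isBaseChange h r') (r.smul a)
  constructor
  · rintro ⟨Y, Y', h, rfl, rfl⟩
    exact key h
  · intro h
    obtain ⟨Y, rfl⟩ := Quotient.exists_rep ξ
    obtain ⟨Y', hY'⟩ := exists_isBaseChange _
      (augmentation_comp_mapHom (a • LinearMap.id (R := A) (M := A))) Y
    exact ⟨Y, Y', hY', rfl, (T1.classEquiv hA hD hex).injective ((key hY').trans h.symm)⟩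

end Main

/-! ### The ring of truncated polynomials -/

section TruncPoly

lemma isLocalHom_of_isNilpotent_ker {A k : Type*} [CommRing A] [CommRing k] {α : A →+* k}
    (hα : Function.Surjective α) (hK : IsNilpotent (RingHom.ker α)) : IsLocalHom α where
  map_nonunit a ha := by
    obtain ⟨b, hb⟩ := ha.exists_right_inv
    obtain ⟨b, rfl⟩ := hα b
    have h1 : a * b - 1 ∈ RingHom.ker α := by
      rw [RingHom.mem_ker, map_sub, map_mul, hb, map_one, sub_self]
    obtain ⟨n, hn⟩ := hK
    have h2 : IsNilpotent (a * b - 1) := ⟨n, by simpa [hn] using Ideal.pow_mem_pow h1 n⟩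
    have h3 := h2.isUnit_add_one
    rw [sub_add_cancel] at h3
    exact isUnit_of_mul_isUnit_left h3

lemma maximalIdeal_eq_ker {A k : Type*} [CommRing A] [IsLocalRing A] [Field k] {α : A →+* k}
    (hα : Function.Surjective α) : IsLocalRing.maximalIdeal A = RingHom.ker α :=
  (IsLocalRing.eq_maximalIdeal (RingHom.ker_isMaximal_of_surjective α hα)).symm

variable (n : ℕ)

/-- The class of the variable in `ℂ[t] / (t ^ (n + 1))`. -/
def TruncPoly.t : TruncPoly n := Ideal.Quotient.mk _ Polynomial.X

lemma residue_surjective : Function.Surjective (residue n) := fun a ↦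
  ⟨Ideal.Quotient.mk _ (Polynomial.C a), Polynomial.eval_C⟩

lemma TruncPoly.t_pow : TruncPoly.t n ^ (n + 1) = 0 := by
  rw [TruncPoly.t, ← map_pow, Ideal.Quotient.eq_zero_iff_mem]
  exact Ideal.mem_span_singleton_self _

lemma ker_residue : RingHom.ker (residue n) = Ideal.span {TruncPoly.t n} := by
  refine le_antisymm (fun a ha ↦ ?_) ((Ideal.span_singleton_le_iff_mem _).mpr Polynomial.eval_X)
  obtain ⟨p, rfl⟩ := Ideal.Quotient.mk_surjective a
  have hp : p.eval 0 = 0 := ha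
  rw [← Polynomial.coeff_zero_eq_eval_zero] at hp
  obtain ⟨q, rfl⟩ := Polynomial.X_dvd_iff.mpr hp
  rw [map_mul]
  exact Ideal.mul_mem_right _ _ (Ideal.mem_span_singleton_self _)

lemma isNilpotent_ker_residue : IsNilpotent (RingHom.ker (residue n)) :=
  ⟨n + 1, by rw [ker_residue, Ideal.span_singleton_pow, TruncPoly.t_pow]; simp⟩

lemma TruncPoly.mem_span_of_pow_mul_eq_zero {i j : ℕ} (h : i + j = n + 1) (c : TruncPoly n)
    (hc : TruncPoly.t n ^ i * c = 0) : c ∈ Ideal.span {TruncPoly.t n ^ j} := by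
  obtain ⟨p, rfl⟩ := Ideal.Quotient.mk_surjective c
  rw [TruncPoly.t, ← map_pow, ← map_mul, Ideal.Quotient.eq_zero_iff_mem,
    Ideal.mem_span_singleton, ← h, pow_add] at hc
  obtain ⟨q, rfl⟩ := (mul_dvd_mul_iff_left (pow_ne_zero i Polynomial.X_ne_zero)).mp hc
  rw [TruncPoly.t, map_mul, map_pow]
  exact Ideal.mul_mem_right _ _ (Ideal.mem_span_singleton_self _)

instance : IsLocalRing (TruncPoly n) :=
  have := isLocalHom_of_isNilpotent_ker (residue_surjective n) (isNilpotent_ker_residue n)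
  (residue n).domain_isLocalRing

/-- The residue map as a homomorphism of algebras. -/
def residueAlgHom : TruncPoly n →ₐ[ℂ] ℂ where
  toRingHom := residue n
  commutes' _ := Polynomial.eval_C

end TruncPoly

end LogDef

end

theorem mainTheorem9 (n : ℕ) (P : LogDef.FlatPair ℂ) [IsReduced P.X]
    [LocallyOfFiniteType P.π] [QuasiCompact P.π] (hD : LogDef.IsEffectiveCartier P.ι)
    (hsm : ∀ d : P.D, ∃ U : P.X.Opens, P.ι d ∈ U ∧ Smooth (U.ι ≫ P.π))
    (Q : LogDef.Deformation P (LogDef.residue n)) :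
    ∃ Φ : LogDef.T1 Q.total ≃ LogDef.LogExt1 Q.total,
      (∀ ξ η ζ : LogDef.T1 Q.total, LogDef.T1.IsSum ξ η ζ ↔ Φ ζ = Φ ξ + Φ η) ∧
      (∀ (a : LogDef.TruncPoly n) (ξ ζ : LogDef.T1 Q.total), LogDef.T1.IsSMul a ξ ζ ↔ Φ ζ = a • Φ ξ) := by
  have hα := LogDef.residue_surjective n
  have hK := LogDef.isNilpotent_ker_residue n
  have hA : IsNilpotent (IsLocalRing.maximalIdeal (LogDef.TruncPoly n)) := by
    rwa [LogDef.maximalIdeal_eq_ker hα]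
  have := Q.total.isClosedImmersion
  have := Q.total.flat
  have := Q.total.flat_divisor
  have hD' : LogDef.IsEffectiveCartier Q.total.ι :=
    LogDef.isEffectiveCartier_of_thickening Q.isPullback_X hα hK Q.isPullback_D hA hD
  -- In `ℂ[t] / (t ^ (n + 1))` the annihilators of `t` and of `t ^ n` are `(t ^ n)` and `(t)`.
  have hS (U : Q.total.X.Opens) (f : Γ(Q.total.X, U))
      (hf : ∀ z (hz : z ∈ U), z ∈ LogDef.genericPoints Q →
        Q.total.X.presheaf.germ U z hz f = 0) : f = 0 :=
    LogDef.eq_zero_of_germ_genericPoints Q hA hα (LogDef.ker_residue n)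
      (fun c hc ↦ LogDef.TruncPoly.mem_span_of_pow_mul_eq_zero n (add_comm 1 n) c
        (by rwa [pow_one]))
      (fun c hc ↦ by
        simpa using LogDef.TruncPoly.mem_span_of_pow_mul_eq_zero n (j := 1) rfl c hc)
      (LogDef.TruncPoly.t_pow n) f hf
  have hι (U : Q.total.X.Opens) (g : Γ(Q.total.X, U))
      (hg : g ∈ LogDef.localEquations Q.total.ι U) (z) (hz : z ∈ U)
      (hzS : z ∈ LogDef.genericPoints Q) : IsUnit (Q.total.X.presheaf.germ U z hz g) :=
    LogDef.isUnit_germ_of_mem_localEquations Q hα hK hg hz hzS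
  have hex := LogDef.exists_rel (LogDef.residueAlgHom n) Q hK (hS := hS) (hι := hι)
  exact ⟨LogDef.T1.classEquiv hA hD' hex, LogDef.T1.isSum_iff hA hD' hex,
    LogDef.T1.isSMul_iff hA hD' hex⟩
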